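/- Let $N\ge 1$, $1\le p<\infty$, let $m\ge 1$ and $0\le k\le m-1$ be integers, let $\alpha>0$, and let $Q$ be a fixed open cube in $\mathbf R^N$ with sides parallel to the axes; $2Q$ is the concentric cube of twice the side length. Write $\|\nabla^j u\|_{L^p(\Omega)}=\sum_{|\gamma|=j}\|D^\gamma u\|_{L^p(\Omega)}$ with weak derivatives, let $W^{m,p}(\Omega)$ be the Sobolev space with norm $\sum_{j=0}^m\|\nabla^j u\|_{L^p(\Omega)}$, let $W^{m,p}_0(\Omega)$ be the closure of $C_0^\infty(\Omega)$ in it, and let $\mathcal P_k$ be the polynomials of degree at most $k$ in $\mathbf R^N$. For $\mathcal A\subset W^{m,p}(Q)$ and $0\le k\le m-1$ put $$\Gamma_{m,k,p}(\mathcal A)=\inf\left\{\frac{\|\nabla^m u\|^p_{L^p(2Q)}}{\|P\|^p_{L^p(Q)}} : 0\ne P\in\mathcal P_k,\ u\in W^{m,p}_0(2Q),\ (u-P)|_Q\in\mathcal A\right\},\qquad \inf\emptyset=\infty .$$ For $u\in W^{m,p}(Q)$ let $\Pi u$ be a polynomial $P\in\mathcal P_{m-1}$ that minimizes $\sum_{i=0}^{m-1}\|\nabla^i(u-P)\|_{L^p(Q)}$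 (it is unique if $p>1$; if $p=1$, any choice of minimizers may be taken), let $\Pi_k u$ be the sum of the terms of degree at most $k$ of $\Pi u$, and let $\Pi_k^{\rm co}u=\Pi u-\Pi_k u$. Let $T^\alpha_{m,k,p,\mathcal A}$ be the set of all $u\in\mathcal A$ with $$\|\Pi_k u\|_{L^p(Q)}\ge\alpha\|\Pi_k^{\rm co}u\|_{L^p(Q)}\quad\text{and}\quad \|u-\Pi u\|_{L^p(Q)}\le\tfrac12\|\Pi u\|_{L^p(Q)},$$ and put $$\Theta^\alpha_{m,k,p}(\mathcal A)=\min\left[\inf\left\{\frac{\|\nabla^m u\|^p_{L^p(Q)}}{\|\Pi_k u\|^p_{L^p(Q)}} : u\in T^\alpha_{m,k,p,\mathcal A},\ \Pi_k u\ne 0\right\},\,1\right].$$ Then there are constants $\delta,C>0$, independent of $\mathcal A$ (and of the choice of minimizers), such that for every $\mathcal A\subset W^{m,p}(Q)$ with $\Gamma_{m,k,p}(\mathcal A)\le\delta$ $$\Theta^\alpha_{m,k,p}(\mathcal A)\le C\,\Gamma_{m,k,p}(\mathcal A).$$ Moreover, there are constants $\delta,C>0$, independent of $\mathcal A$ (and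 of the choice of minimizers), such that for every $\mathcal A\subset W^{m,p}(Q)$ with $\Gamma_{m,m-1,p}(\mathcal A)\le\delta$ $$\Theta^\alpha_{m,m-1,p}(\mathcal A)\le C\,\Gamma_{m,m-1,p}(\mathcal A)\quad\text{and}\quad \Gamma_{m,m-1,p}(\mathcal A)\le C\,\Theta^\alpha_{m,m-1,p}(\mathcal A).$$ -/

import Mathlib

open MeasureTheory
open scoped ENNReal NNReal ContDiff

/-- The open cube in `ℝ^N` with centre `a`, side length `ℓ` and sides parallel to the axes.
For `Q = cube a ℓ`, the concentric cube `2Q` is `cube a (2 * ℓ)`. -/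
def cube {N : ℕ} (a : Fin N → ℝ) (ℓ : ℝ) : Set (Fin N → ℝ) :=
  {x | ∀ i, |x i - a i| < ℓ / 2}

/-- The classical partial derivative `∂f/∂x_i`. -/
noncomputable def partialDeriv {N : ℕ} (i : Fin N) (f : (Fin N → ℝ) → ℝ) : (Fin N → ℝ) → ℝ :=
  fun x => fderiv ℝ f x (Pi.single i 1)

/-- The classical derivative `D^γ f = ∂₀^{γ₀} ⋯ ∂_{N-1}^{γ_{N-1}} f`, for a multi-index `γ`. -/
noncomputable def multiDeriv {N : ℕ} (γ : Fin N → ℕ) (f : (Fin N → ℝ) → ℝ) : (Fin N → ℝ) → ℝ :=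
  (List.finRange N).foldr (fun i g => (partialDeriv i)^[γ i] g) f

/-- `φ ∈ C^∞_0(Ω)`. -/
structure IsTestFunction {N : ℕ} (Ω : Set (Fin N → ℝ)) (φ : (Fin N → ℝ) → ℝ) : Prop where
  smooth : ContDiff ℝ ∞ φ
  compact_support : HasCompactSupport φ
  support_subset : tsupport φ ⊆ Ω

/-- `g` is the weak (distributional) derivative `D^γ u` in `Ω`. -/
structure HasWeakDeriv {N : ℕ} (Ω : Set (Fin N → ℝ)) (γ : Fin N → ℕ)
    (u g : (Fin N → ℝ) → ℝ) : Prop where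
  locallyIntegrable_left : LocallyIntegrableOn u Ω
  locallyIntegrable_right : LocallyIntegrableOn g Ω
  integral_eq : ∀ φ, IsTestFunction Ω φ →
    ∫ x in Ω, u x * multiDeriv γ φ x = (-1) ^ (∑ i, γ i) * ∫ x in Ω, g x * φ x

open Classical in
/-- A representative of the weak derivative `D^γ u` in `Ω` (zero if there is none). -/
noncomputable def weakDeriv {N : ℕ} (Ω : Set (Fin N → ℝ)) (γ : Fin N → ℕ)
    (u : (Fin N → ℝ) → ℝ) : (Fin N → ℝ) → ℝ :=
  if h : ∃ g, HasWeakDeriv Ω γ u g then h.choose else 0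

/-- `u ∈ W^{m,p}(Ω)`: all weak derivatives of order at most `m` exist and are in `L^p(Ω)`. -/
def MemSobolev {N : ℕ} (Ω : Set (Fin N → ℝ)) (m : ℕ) (p : ℝ≥0) (u : (Fin N → ℝ) → ℝ) : Prop :=
  ∀ γ : Fin N → ℕ, ∑ i, γ i ≤ m →
    ∃ g, HasWeakDeriv Ω γ u g ∧ MemLp g p (volume.restrict Ω)

/-- `‖∇^j u‖_{L^p(Ω)} = ∑_{|γ| = j} ‖D^γ u‖_{L^p(Ω)}`. -/
noncomputable def gradNorm {N : ℕ} (Ω : Set (Fin N → ℝ)) (j : ℕ) (p : ℝ≥0)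
    (u : (Fin N → ℝ) → ℝ) : ℝ≥0∞ :=
  ∑ γ ∈ Finset.piAntidiag (Finset.univ : Finset (Fin N)) j,
    eLpNorm (weakDeriv Ω γ u) p (volume.restrict Ω)

/-- `‖u‖_{W^{m,p}(Ω)} = ∑_{j ≤ m} ‖∇^j u‖_{L^p(Ω)}`. -/
noncomputable def sobolevNorm {N : ℕ} (Ω : Set (Fin N → ℝ)) (m : ℕ) (p : ℝ≥0)
    (u : (Fin N → ℝ) → ℝ) : ℝ≥0∞ :=
  ∑ j ∈ Finset.range (m + 1), gradNorm Ω j p u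

/-- `u ∈ W^{m,p}_0(Ω)`, the closure of `C^∞_0(Ω)` in `W^{m,p}(Ω)`. -/
def MemSobolevZero {N : ℕ} (Ω : Set (Fin N → ℝ)) (m : ℕ) (p : ℝ≥0)
    (u : (Fin N → ℝ) → ℝ) : Prop :=
  MemSobolev Ω m p u ∧
    ∀ ε : ℝ≥0∞, 0 < ε → ∃ φ, IsTestFunction Ω φ ∧ sobolevNorm Ω m p (u - φ) < ε

/-- The elements of `L^p(Ω)` (classes modulo equality almost everywhere in `Ω`). -/
abbrev LpOn {N : ℕ} (Ω : Set (Fin N → ℝ)) (p : ℝ≥0) : Type :=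
  Lp ℝ (p : ℝ≥0∞) (volume.restrict Ω)

/-- The Sobolev space `W^{m,p}(Ω)`, as a set of classes in `L^p(Ω)`. -/
def sobolevSpace {N : ℕ} (Ω : Set (Fin N → ℝ)) (m : ℕ) (p : ℝ≥0) : Set (LpOn Ω p) :=
  {u | MemSobolev Ω m p u}

/-- The polynomial function of `P`. -/
noncomputable def polyFun {N : ℕ} (P : MvPolynomial (Fin N) ℝ) : (Fin N → ℝ) → ℝ :=
  fun x => MvPolynomial.eval x P

/-- `‖P‖_{L^p(Ω)}` for a polynomial `P`. -/
noncomputable def polyNorm {N : ℕ} (Ω : Set (Fin N → ℝ)) (p : ℝ≥0)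
    (P : MvPolynomial (Fin N) ℝ) : ℝ≥0∞ :=
  eLpNorm (polyFun P) p (volume.restrict Ω)

/-- `𝒫_k`, the polynomials of degree at most `k`. -/
noncomputable abbrev polys (N k : ℕ) : Submodule ℝ (MvPolynomial (Fin N) ℝ) :=
  MvPolynomial.restrictTotalDegree (Fin N) ℝ k

/-- The part of degree at most `k` of a polynomial. -/
noncomputable def lowPart {N : ℕ} (k : ℕ) (P : MvPolynomial (Fin N) ℝ) : MvPolynomial (Fin N) ℝ :=
  ∑ j ∈ Finset.range (k + 1), MvPolynomial.homogeneousComponent j P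

/-- For `Q = cube a ℓ`, the set `U_{P,𝒜}` of the `u ∈ W^{m,p}_0(2Q)` with `(u - P)|_Q ∈ 𝒜`. -/
def extensions {N : ℕ} (a : Fin N → ℝ) (ℓ : ℝ) (m : ℕ) (p : ℝ≥0)
    (A : Set (LpOn (cube a ℓ) p)) (P : MvPolynomial (Fin N) ℝ) : Set ((Fin N → ℝ) → ℝ) :=
  {u | MemSobolevZero (cube a (2 * ℓ)) m p u ∧
    ∃ v ∈ A, u - polyFun P =ᵐ[volume.restrict (cube a ℓ)] v}

/-- The polynomial capacity `Γ_{m,k,p}(𝒜)` for `Q = cube a ℓ`; the infimum runs over the nonzero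
polynomials of degree at most `k`, and is `∞` if there is nothing to compete. -/
noncomputable def capGamma {N : ℕ} (a : Fin N → ℝ) (ℓ : ℝ) (m k : ℕ) (p : ℝ≥0)
    (A : Set (LpOn (cube a ℓ) p)) : ℝ≥0∞ :=
  ⨅ P ∈ {P | P ∈ polys N k ∧ P ≠ 0}, ⨅ u ∈ extensions a ℓ m p A P,
    gradNorm (cube a (2 * ℓ)) m p u ^ (p : ℝ) / polyNorm (cube a ℓ) p P ^ (p : ℝ)

/-- The polynomial `R ∈ 𝒫_r` minimizes `∑_{i ≤ r} ‖∇^i (u - P)‖_{L^p(Ω)}` over `P ∈ 𝒫_r`. -/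
def IsBestApprox {N : ℕ} (Ω : Set (Fin N → ℝ)) (r : ℕ) (p : ℝ≥0) (u : LpOn Ω p)
    (R : MvPolynomial (Fin N) ℝ) : Prop :=
  R ∈ polys N r ∧ ∀ P ∈ polys N r,
    ∑ i ∈ Finset.range (r + 1), gradNorm Ω i p (⇑u - polyFun R) ≤
      ∑ i ∈ Finset.range (r + 1), gradNorm Ω i p (⇑u - polyFun P)

/-- `Pr` is the projection `Π_{r,r,p}`: to each `u ∈ W^{r+1,p}(Ω)` it assigns a minimizer.
(The minimizer is unique for `p > 1`; for `p = 1` a choice is involved.) -/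
def IsPolyProjection {N : ℕ} (Ω : Set (Fin N → ℝ)) (r : ℕ) (p : ℝ≥0)
    (Pr : LpOn Ω p → MvPolynomial (Fin N) ℝ) : Prop :=
  ∀ u ∈ sobolevSpace Ω (r + 1) p, IsBestApprox Ω r p u (Pr u)

/-- The set `T^α_{m,k,p,𝒜}`, where `Pr = Π_{m-1,m-1,p}`. -/
def testClass {N : ℕ} (Ω : Set (Fin N → ℝ)) (k : ℕ) (p : ℝ≥0)
    (Pr : LpOn Ω p → MvPolynomial (Fin N) ℝ) (α : ℝ≥0) (A : Set (LpOn Ω p)) : Set (LpOn Ω p) :=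
  {u | u ∈ A ∧
    α * polyNorm Ω p (Pr u - lowPart k (Pr u)) ≤ polyNorm Ω p (lowPart k (Pr u)) ∧
    eLpNorm (⇑u - polyFun (Pr u)) p (volume.restrict Ω) ≤ 1 / 2 * polyNorm Ω p (Pr u)}

/-- The polynomial capacity `Θ^α_{m,k,p}(𝒜)`, where `Pr = Π_{m-1,m-1,p}`; the infimum runs over
the `u` for which the quotient is defined, that is, `Π_{m-1,k,p} u ≠ 0`. -/
noncomputable def capTheta {N : ℕ} (Ω : Set (Fin N → ℝ)) (m k : ℕ) (p : ℝ≥0)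
    (Pr : LpOn Ω p → MvPolynomial (Fin N) ℝ) (α : ℝ≥0) (A : Set (LpOn Ω p)) : ℝ≥0∞ :=
  min (⨅ u ∈ {u | u ∈ testClass Ω k p Pr α A ∧ lowPart k (Pr u) ≠ 0},
    gradNorm Ω m p u ^ (p : ℝ) / polyNorm Ω p (lowPart k (Pr u)) ^ (p : ℝ)) 1

theorem isOpen_cube {N : ℕ} (a : Fin N → ℝ) (ℓ : ℝ) : IsOpen (cube a ℓ) := by
  have : cube a ℓ = ⋂ i, {x | |x i - a i| < ℓ / 2} := by ext; simp [cube]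
  rw [this]
  exact isOpen_iInter_of_finite fun i => isOpen_lt (by fun_prop) continuous_const

theorem cube_subset_closedBall {N : ℕ} (a : Fin N → ℝ) (ℓ : ℝ) (hℓ : 0 < ℓ) :
    cube a ℓ ⊆ Metric.closedBall a (ℓ / 2) := by
  intro x hx
  rw [Metric.mem_closedBall, dist_pi_le_iff (by positivity)]
  intro i
  rw [Real.dist_eq]
  exact (hx i).le

theorem IsTestFunction.partialDeriv {N : ℕ} {Ω : Set (Fin N → ℝ)} {φ : (Fin N → ℝ) → ℝ}
    (h : IsTestFunction Ω φ) (i : Fin N) : IsTestFunction Ω (partialDeriv i φ) := by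
  have hs : tsupport (_root_.partialDeriv i φ) ⊆ tsupport φ :=
    tsupport_fderiv_apply_subset ℝ _
  refine ⟨?_, h.2.mono' (subset_tsupport _ |>.trans hs), hs.trans h.3⟩
  exact (h.1.fderiv_right (m := ∞) (by simp)).clm_apply contDiff_const

theorem contDiff_partialDeriv {N : ℕ} {f : (Fin N → ℝ) → ℝ} (h : ContDiff ℝ ∞ f) (i : Fin N) :
    ContDiff ℝ ∞ (partialDeriv i f) :=
  (h.fderiv_right (m := ∞) (by simp)).clm_apply contDiff_const

theorem integral_mul_partialDeriv {N : ℕ} {Ω : Set (Fin N → ℝ)} {f φ : (Fin N → ℝ) → ℝ}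
    (hf : ContDiff ℝ ∞ f) (h : IsTestFunction Ω φ) (i : Fin N) :
    ∫ x, f x * partialDeriv i φ x = - ∫ x, partialDeriv i f x * φ x := by
  have h' := h.partialDeriv i
  have hf' := contDiff_partialDeriv hf i
  refine integral_mul_fderiv_eq_neg_fderiv_mul_of_integrable ?_ ?_ ?_ ?_ ?_
  · exact (hf'.continuous.mul h.1.continuous).integrable_of_hasCompactSupport h.2.mul_left
  · exact (hf.continuous.mul h'.1.continuous).integrable_of_hasCompactSupport h'.2.mul_left
  · exact (hf.continuous.mul h.1.continuous).integrable_of_hasCompactSupport h.2.mul_left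
  · exact fun x _ => hf.differentiable (by simp) x
  · exact fun x _ => h.1.differentiable (by simp) x

theorem exists_adjoint_iterate {N : ℕ} (Ω : Set (Fin N → ℝ)) (i : Fin N) (n : ℕ)
    {f : (Fin N → ℝ) → ℝ} (hf : ContDiff ℝ ∞ f) :
    ∃ g, ContDiff ℝ ∞ g ∧ ∀ φ, IsTestFunction Ω φ →
      IsTestFunction Ω ((partialDeriv i)^[n] φ) ∧
      ∫ x, f x * (partialDeriv i)^[n] φ x = (-1) ^ n * ∫ x, g x * φ x := by
  induction n with
  | zero => exact ⟨f, hf, fun φ h => ⟨h, by simp⟩⟩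
  | succ n ih =>
    obtain ⟨g, hg, H⟩ := ih
    refine ⟨partialDeriv i g, contDiff_partialDeriv hg i, fun φ h => ?_⟩
    rw [Function.iterate_succ_apply]
    refine ⟨(H _ (h.partialDeriv i)).1, ?_⟩
    rw [(H _ (h.partialDeriv i)).2, integral_mul_partialDeriv hg h]
    ring

theorem exists_adjoint_foldr {N : ℕ} (Ω : Set (Fin N → ℝ)) (γ : Fin N → ℕ) (l : List (Fin N))
    {f : (Fin N → ℝ) → ℝ} (hf : ContDiff ℝ ∞ f) :
    ∃ g, ContDiff ℝ ∞ g ∧ ∀ φ, IsTestFunction Ω φ →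
      IsTestFunction Ω (l.foldr (fun i g => (partialDeriv i)^[γ i] g) φ) ∧
      ∫ x, f x * l.foldr (fun i g => (partialDeriv i)^[γ i] g) φ x
        = (-1) ^ (l.map γ).sum * ∫ x, g x * φ x := by
  induction l generalizing f with
  | nil => exact ⟨f, hf, fun φ h => ⟨h, by simp⟩⟩
  | cons i l ih =>
    obtain ⟨g, hg, H⟩ := exists_adjoint_iterate Ω i (γ i) hf
    obtain ⟨g', hg', H'⟩ := ih hg
    refine ⟨g', hg', fun φ h => ?_⟩
    have h1 := H' φ h
    have h2 := H _ h1.1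
    refine ⟨h2.1, ?_⟩
    rw [List.foldr_cons, h2.2, h1.2, List.map_cons, List.sum_cons]
    ring

theorem setIntegral_mul_test {N : ℕ} {Ω : Set (Fin N → ℝ)} (f : (Fin N → ℝ) → ℝ)
    {φ : (Fin N → ℝ) → ℝ} (h : IsTestFunction Ω φ) :
    ∫ x in Ω, f x * φ x = ∫ x, f x * φ x := by
  refine setIntegral_eq_integral_of_forall_compl_eq_zero fun x hx => ?_
  rw [image_eq_zero_of_notMem_tsupport fun hx' => hx (h.3 hx'), mul_zero]

theorem isTestFunction_multiDeriv {N : ℕ} {Ω : Set (Fin N → ℝ)} (γ : Fin N → ℕ)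
    {φ : (Fin N → ℝ) → ℝ} (h : IsTestFunction Ω φ) : IsTestFunction Ω (multiDeriv γ φ) := by
  obtain ⟨g, -, H⟩ := exists_adjoint_foldr Ω γ (List.finRange N) (f := fun _ => 0) contDiff_const
  exact (H φ h).1

theorem exists_hasWeakDeriv_of_contDiff {N : ℕ} (Ω : Set (Fin N → ℝ)) (γ : Fin N → ℕ)
    {f : (Fin N → ℝ) → ℝ} (hf : ContDiff ℝ ∞ f) : ∃ g, Continuous g ∧ HasWeakDeriv Ω γ f g := by
  obtain ⟨g, hg, H⟩ := exists_adjoint_foldr Ω γ (List.finRange N) hf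
  refine ⟨g, hg.continuous, hf.continuous.locallyIntegrable.locallyIntegrableOn Ω,
    hg.continuous.locallyIntegrable.locallyIntegrableOn Ω, fun φ h => ?_⟩
  rw [setIntegral_mul_test _ h, setIntegral_mul_test _ (isTestFunction_multiDeriv γ h),
    ← List.sum_ofFn, List.ofFn_eq_map]
  exact (H φ h).2

theorem integrable_mul_test {N : ℕ} {Ω : Set (Fin N → ℝ)} (hΩ : IsOpen Ω)
    {f φ : (Fin N → ℝ) → ℝ} (hf : LocallyIntegrableOn f Ω) (h : IsTestFunction Ω φ) :
    IntegrableOn (fun x => f x * φ x) Ω := by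
  have h1 : IntegrableOn (fun x => f x * φ x) (tsupport φ) := by
    have := (hf.integrableOn_compact_subset h.3 h.2)
    exact this.mul_continuousOn h.1.continuous.continuousOn h.2
  refine IntegrableOn.of_forall_sdiff_eq_zero h1 hΩ.measurableSet fun x hx => ?_
  rw [image_eq_zero_of_notMem_tsupport hx.2, mul_zero]

theorem HasWeakDeriv.ae_eq {N : ℕ} {Ω : Set (Fin N → ℝ)} (hΩ : IsOpen Ω) {γ : Fin N → ℕ}
    {u v g g' : (Fin N → ℝ) → ℝ} (h : HasWeakDeriv Ω γ u g) (h' : HasWeakDeriv Ω γ v g')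
    (huv : u =ᵐ[volume.restrict Ω] v) : g =ᵐ[volume.restrict Ω] g' := by
  have key : ∀ᵐ x, x ∈ Ω → (g - g') x = 0 := by
    refine hΩ.ae_eq_zero_of_integral_contDiff_smul_eq_zero
      (h.locallyIntegrable_right.sub h'.locallyIntegrable_right) fun φ h1 h2 h3 => ?_
    have ht : IsTestFunction Ω φ := ⟨h1, h2, h3⟩
    have e1 := h.integral_eq φ ht
    have e2 := h'.integral_eq φ ht
    have e3 : ∫ x in Ω, u x * multiDeriv γ φ x = ∫ x in Ω, v x * multiDeriv γ φ x :=
      integral_congr_ae (huv.mono fun x hx => by simp [hx])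
    have e4 : ∫ x in Ω, g x * φ x = ∫ x in Ω, g' x * φ x := by
      have : ((-1 : ℝ) ^ (∑ i, γ i)) ≠ 0 := by positivity
      exact mul_left_cancel₀ this (by rw [← e1, e3, e2])
    have e5 : ∫ x, φ x • (g - g') x = ∫ x in Ω, (g x * φ x - g' x * φ x) := by
      have := setIntegral_mul_test (g - g') ht
      simp only [smul_eq_mul, mul_comm (φ _)]
      rw [← this]
      congr 1; ext x; simp; ring
    rw [e5, integral_sub (integrable_mul_test hΩ h.2 ht) (integrable_mul_test hΩ h'.2 ht), e4,
      sub_self]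
  rw [Filter.EventuallyEq, ae_restrict_iff' hΩ.measurableSet]
  filter_upwards [key] with x hx hx'
  exact sub_eq_zero.1 (hx hx')

theorem HasWeakDeriv.smul_add {N : ℕ} {Ω : Set (Fin N → ℝ)} (hΩ : IsOpen Ω) {γ : Fin N → ℕ}
    {u v g g' : (Fin N → ℝ) → ℝ} (h : HasWeakDeriv Ω γ u g) (h' : HasWeakDeriv Ω γ v g') (c : ℝ) :
    HasWeakDeriv Ω γ (c • u + v) (c • g + g') := by
  refine ⟨(h.1.smul c).add h'.1, (h.2.smul c).add h'.2, fun φ ht => ?_⟩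
  have ht' := isTestFunction_multiDeriv γ ht
  have e1 : ∀ x, (c • u + v) x * multiDeriv γ φ x
      = c * (u x * multiDeriv γ φ x) + v x * multiDeriv γ φ x := fun x => by simp; ring
  have e2 : ∀ x, (c • g + g') x * φ x = c * (g x * φ x) + g' x * φ x := fun x => by simp; ring
  simp_rw [e1, e2]
  rw [integral_add ((integrable_mul_test hΩ h.1 ht').const_mul c) (integrable_mul_test hΩ h'.1 ht'),
    integral_add ((integrable_mul_test hΩ h.2 ht).const_mul c) (integrable_mul_test hΩ h'.2 ht),
    integral_const_mul, integral_const_mul, h.3 φ ht, h'.3 φ ht]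
  ring

theorem exists_min_sum_norm {ι V E : Type*} [Fintype ι] [AddCommGroup V] [Module ℝ V]
    [Module.Finite ℝ V] [NormedAddCommGroup E] [NormedSpace ℝ E] (T : ι → V →ₗ[ℝ] E) (G : ι → E) :
    ∃ R : V, ∀ P : V, ∑ i, ‖G i - T i R‖ ≤ ∑ i, ‖G i - T i P‖ := by
  let S : Submodule ℝ (ι → E) := LinearMap.range (LinearMap.pi T)
  have : ProperSpace S := FiniteDimensional.proper ℝ S
  obtain ⟨⟨s, R, rfl⟩, hs⟩ :=
    Continuous.exists_forall_le (f := fun s : S => ∑ i, ‖G i - s.1 i‖)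
      (continuous_finsetSum _ fun i _ =>
        (continuous_const.sub ((continuous_apply i).comp continuous_subtype_val)).norm) (by
      refine Filter.tendsto_atTop_mono (f := fun s : S => ‖s‖ - ‖G‖) (fun s => ?_)
        (Filter.tendsto_atTop_add_const_right _ _ (tendsto_norm_cocompact_atTop))
      have h1 : ‖G - s.1‖ ≤ ∑ i, ‖G i - s.1 i‖ := by
        rw [pi_norm_le_iff_of_nonneg (by positivity)]
        exact fun i => Finset.single_le_sum (f := fun i => ‖G i - s.1 i‖)
          (fun _ _ => norm_nonneg _) (Finset.mem_univ i)
      have h2 : ‖s.1‖ - ‖G‖ ≤ ‖G - s.1‖ := by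
        rw [norm_sub_rev]; exact norm_sub_norm_le _ _
      exact h2.trans h1)
  exact ⟨R, fun P => hs ⟨_, P, rfl⟩⟩

theorem weakDeriv_spec {N : ℕ} {Ω : Set (Fin N → ℝ)} {γ : Fin N → ℕ} {u : (Fin N → ℝ) → ℝ}
    (h : ∃ g, HasWeakDeriv Ω γ u g) : HasWeakDeriv Ω γ u (weakDeriv Ω γ u) := by
  rw [weakDeriv, dif_pos h]; exact h.choose_spec

theorem contDiff_polyFun {N : ℕ} (P : MvPolynomial (Fin N) ℝ) : ContDiff ℝ ∞ (polyFun P) := by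
  induction P using MvPolynomial.induction_on with
  | C c =>
    have : polyFun (N := N) (MvPolynomial.C c) = fun _ => c := by ext; simp [polyFun]
    rw [this]; exact contDiff_const
  | add p q hp hq =>
    have : polyFun (p + q) = fun x => polyFun p x + polyFun q x := by ext; simp [polyFun]
    rw [this]; exact hp.add hq
  | mul_X p i hp =>
    have : polyFun (p * MvPolynomial.X i) = fun x => polyFun p x * x i := by ext; simp [polyFun]
    rw [this]; exact hp.mul (contDiff_apply ℝ ℝ i)

/-- The projections `Π_{r,r,p}` exist: in a cube, every Sobolev function has a minimizer. -/
theorem exists_isPolyProjection {N : ℕ} (a : Fin N → ℝ) (ℓ : ℝ) (hℓ : 0 < ℓ) (r : ℕ) (p : ℝ≥0)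
    (hp : 1 ≤ p) : ∃ Pr, IsPolyProjection (cube a ℓ) r p Pr := by
  classical
  have : Fact (1 ≤ (p : ℝ≥0∞)) := ⟨by exact_mod_cast hp⟩
  suffices H : ∀ u : LpOn (cube a ℓ) p, u ∈ sobolevSpace (cube a ℓ) (r + 1) p →
      ∃ R, IsBestApprox (cube a ℓ) r p u R by
    choose! Pr hPr using H
    exact ⟨Pr, hPr⟩
  intro u hu
  have hΩ := isOpen_cube a ℓ
  have hcont : ∀ g : (Fin N → ℝ) → ℝ, Continuous g →
      MemLp g p (volume.restrict (cube a ℓ)) := by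
    intro g hg
    have hK := isCompact_closedBall a (ℓ / 2)
    have hfin : IsFiniteMeasure (volume.restrict (cube a ℓ)) :=
      ⟨by
        rw [Measure.restrict_apply_univ]
        exact (measure_mono (cube_subset_closedBall a ℓ hℓ)).trans_lt hK.measure_lt_top⟩
    obtain ⟨C, hC⟩ := hK.exists_bound_of_continuousOn hg.continuousOn
    refine MemLp.of_bound hg.aestronglyMeasurable C ?_
    rw [ae_restrict_iff' hΩ.measurableSet]
    exact .of_forall fun x hx => hC x (cube_subset_closedBall a ℓ hℓ hx)
  have hPw : ∀ (γ : Fin N → ℕ) (P : MvPolynomial (Fin N) ℝ),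
      HasWeakDeriv (cube a ℓ) γ (polyFun P) (weakDeriv (cube a ℓ) γ (polyFun P)) ∧
      MemLp (weakDeriv (cube a ℓ) γ (polyFun P)) p (volume.restrict (cube a ℓ)) := by
    intro γ P
    obtain ⟨g, hg, hg'⟩ := exists_hasWeakDeriv_of_contDiff (cube a ℓ) γ (contDiff_polyFun P)
    have h := weakDeriv_spec ⟨g, hg'⟩
    exact ⟨h, (hcont g hg).ae_eq (hg'.ae_eq hΩ h (.refl _ _))⟩
  have huw : ∀ γ : Fin N → ℕ, ∑ i, γ i ≤ r →
      HasWeakDeriv (cube a ℓ) γ u (weakDeriv (cube a ℓ) γ u) ∧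
      MemLp (weakDeriv (cube a ℓ) γ u) p (volume.restrict (cube a ℓ)) := by
    intro γ hγ
    obtain ⟨g, hg, hg'⟩ := hu γ (by omega)
    have h := weakDeriv_spec ⟨g, hg⟩
    exact ⟨h, hg'.ae_eq (hg.ae_eq hΩ h (.refl _ _))⟩
  let T : (Fin N → ℕ) → polys N r →ₗ[ℝ] LpOn (cube a ℓ) p := fun γ =>
    { toFun := fun P => (hPw γ P).2.toLp
      map_add' := fun P R => by
        rw [← MemLp.toLp_add, MemLp.toLp_eq_toLp_iff]
        refine (hPw γ _).1.ae_eq hΩ ((hPw γ P).1.smul_add hΩ (hPw γ R).1 1) ?_ |>.trans ?_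
        · exact .of_forall fun x => by simp [polyFun]
        · simp
      map_smul' := fun c P => by
        rw [RingHom.id_apply, ← MemLp.toLp_const_smul, MemLp.toLp_eq_toLp_iff]
        have h0 : HasWeakDeriv (cube a ℓ) γ 0 0 :=
          ⟨locallyIntegrable_zero.locallyIntegrableOn _,
            locallyIntegrable_zero.locallyIntegrableOn _, by simp⟩
        refine (hPw γ _).1.ae_eq hΩ ((hPw γ P).1.smul_add hΩ h0 c) ?_ |>.trans ?_
        · exact .of_forall fun x => by simp [polyFun]
        · simp }
  let I : Finset ((_ : ℕ) × (Fin N → ℕ)) :=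
    (Finset.range (r + 1)).sigma fun i => Finset.piAntidiag Finset.univ i
  have hI : ∀ j : I, ∑ i, j.1.2 i ≤ r := by
    intro ⟨j, hj⟩
    simp only [I, Finset.mem_sigma, Finset.mem_range, Finset.mem_piAntidiag] at hj
    change Finset.univ.sum j.snd ≤ r
    omega
  obtain ⟨R, hR⟩ := exists_min_sum_norm (fun j : I => T j.1.2)
    (fun j : I => (huw j.1.2 (hI j)).2.toLp)
  have key : ∀ P : polys N r,
      ∑ i ∈ Finset.range (r + 1), gradNorm (cube a ℓ) i p (⇑u - polyFun P.1)
        = ENNReal.ofReal (∑ j : I, ‖(huw j.1.2 (hI j)).2.toLp - T j.1.2 P‖) := by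
    intro P
    simp only [gradNorm]
    rw [Finset.sum_sigma', ENNReal.ofReal_sum_of_nonneg (fun _ _ => norm_nonneg _),
      ← Finset.sum_coe_sort]
    refine Finset.sum_congr rfl fun j _ => ?_
    have e : (T j.1.2 P) = (hPw j.1.2 P).2.toLp := rfl
    rw [e, ← MemLp.toLp_sub, Lp.norm_toLp, ENNReal.ofReal_toReal]
    swap
    · exact ((huw j.1.2 (hI j)).2.sub (hPw j.1.2 P).2).2.ne
    refine eLpNorm_congr_ae ?_
    have h3 := (hPw j.1.2 P).1.smul_add hΩ (huw j.1.2 (hI j)).1 (-1)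
    have e3 : (-1 : ℝ) • polyFun P.1 + ⇑u = ⇑u - polyFun P.1 := by
      ext x; simp; ring
    rw [e3] at h3
    refine (weakDeriv_spec ⟨_, h3⟩).ae_eq hΩ h3 (.refl _ _) |>.trans ?_
    exact .of_forall fun x => by simp; ring
  refine ⟨R, R.2, fun P hP => ?_⟩
  rw [key R, key ⟨P, hP⟩]
  exact ENNReal.ofReal_le_ofReal (hR ⟨P, hP⟩)

/-! ### Calculus of the classical derivatives `D^γ` -/

/-! Both capacities ask how small the gradient of order m of a function can be when the function is
close to a nonzero polynomial on Q. In Γ the polynomial is given, and the difference has an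
extension in `W^{m,p}_0(2Q)`; in Θ the polynomial is the projection of the function. The two
estimates convert a competitor for one quantity into a competitor for the other.

From Γ to Θ (`exists_capTheta_le_capGamma`). Let u compete with P in Γ and let v be the element of 𝒜
equal to u - P on Q. Friedrichs' inequality on 2Q bounds the lower-order norms of u by `‖∇^m u‖`, so
-P approximates v within that order of error. Since Πv is a best approximation, it does no worse,
and therefore Πv + P is small as well (`exists_bestApprox_extension_const`). If the quotient of u
and P is small, this error is a small fraction of `‖P‖`. Truncating a polynomial at degree k is
bounded on the finite-dimensional space of polynomials (`exists_polyNorm_lowPart_le`), and P is its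
own truncation. Hence Π_k v is close to -P, the complementary part is small, and v passes both tests
with `‖P‖ ≤ 2‖Π_k v‖`. The gradients of order m of u and v agree on Q because deg P < m, so the
quotient grows at most by the factor 2^p. The number α enters only through how small Γ must be.

From Θ to Γ when k = m - 1 (`exists_capGamma_le`). For u in 𝒜 with Πu ≠ 0, extend u - Πu to a
function w in `W^{m,p}_0(2Q)`. Then w and the polynomial -Πu compete in Γ, and the norm of w is
controlled by the full Sobolev norm of u - Πu on Q, hence by `‖∇^m u‖` through the Poincaré
inequality for best approximations (`exists_bestApprox_const`). The value 1 in the minimum is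
harmless because Γ ≤ δ.

The analytic tools are all derived for boxes or bounded convex open sets. The inequalities of
Friedrichs and Poincaré and the boundedness of mollification share one principle: averaging over
maps that do not concentrate the measure is bounded in L^p (`eLpNorm_le_of_le_average`). Smooth
functions are dense because a convex set can be contracted towards an interior point before
mollifying. The extension is a reflection of higher order across one face of a box after another
(`hasSobolevExtension_cube`), followed by a cut-off (`exists_extension_sobolevZero`). -/

theorem multiIndex_induction {N : ℕ} {P : (Fin N → ℕ) → Prop} (zero : P 0)
    (add_single : ∀ γ i, P γ → P (γ + Pi.single i 1)) (γ : Fin N → ℕ) : P γ := by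
  generalize hn : ∑ i, γ i = n
  induction n generalizing γ with
  | zero =>
    have : γ = 0 := by
      ext i
      simpa using (Finset.sum_eq_zero_iff.1 hn) i (Finset.mem_univ i)
    exact this ▸ zero
  | succ n ih =>
    obtain ⟨i, -, hi⟩ : ∃ i ∈ Finset.univ, γ i ≠ 0 := by
      by_contra! h
      rw [Finset.sum_eq_zero h] at hn
      omega
    have e : γ = (γ - Pi.single i 1) + Pi.single i 1 := by
      ext j
      by_cases h : j = i
      · subst h; simp; omega
      · simp [h]
    rw [e] at hn ⊢
    refine add_single _ _ (ih _ ?_)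
    simpa [Finset.sum_add_distrib, Finset.sum_pi_single'] using hn

theorem sum_add_single {N : ℕ} (γ : Fin N → ℕ) (i : Fin N) :
    ∑ j, (γ + Pi.single i 1 : Fin N → ℕ) j = (∑ j, γ j) + 1 := by
  simp [Finset.sum_add_distrib, Finset.sum_pi_single']

theorem partialDeriv_comm {N : ℕ} {f : (Fin N → ℝ) → ℝ} (hf : ContDiff ℝ ∞ f) (i j : Fin N) :
    partialDeriv i (partialDeriv j f) = partialDeriv j (partialDeriv i f) := by
  ext x
  have hd : DifferentiableAt ℝ (fderiv ℝ f) x :=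
    (hf.fderiv_right (m := ∞) (by simp)).differentiable (by simp) x
  have key : ∀ i j : Fin N, partialDeriv i (partialDeriv j f) x
      = fderiv ℝ (fderiv ℝ f) x (Pi.single i 1) (Pi.single j 1) := by
    intro i j
    change fderiv ℝ (fun y => fderiv ℝ f y (Pi.single j 1)) x (Pi.single i 1) = _
    rw [fderiv_clm_apply hd (differentiableAt_const _)]
    simp
  rw [key, key]
  exact (hf.contDiffAt.isSymmSndFDerivAt (by
    simpa using WithTop.coe_le_coe.2 (le_top : (2 : ℕ∞) ≤ ⊤))) _ _

theorem contDiff_iterate_partialDeriv {N : ℕ} {f : (Fin N → ℝ) → ℝ} (hf : ContDiff ℝ ∞ f)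
    (i : Fin N) (n : ℕ) : ContDiff ℝ ∞ ((partialDeriv i)^[n] f) := by
  induction n generalizing f with
  | zero => exact hf
  | succ n ih => exact ih (contDiff_partialDeriv hf i)

theorem partialDeriv_iterate_comm {N : ℕ} {f : (Fin N → ℝ) → ℝ} (hf : ContDiff ℝ ∞ f)
    (i j : Fin N) (n : ℕ) :
    partialDeriv i ((partialDeriv j)^[n] f) = (partialDeriv j)^[n] (partialDeriv i f) := by
  induction n generalizing f with
  | zero => rfl
  | succ n ih =>
    rw [Function.iterate_succ_apply, Function.iterate_succ_apply,
      ih (contDiff_partialDeriv hf j), partialDeriv_comm hf]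

theorem contDiff_foldr_partialDeriv {N : ℕ} {f : (Fin N → ℝ) → ℝ} (hf : ContDiff ℝ ∞ f)
    (γ : Fin N → ℕ) (l : List (Fin N)) :
    ContDiff ℝ ∞ (l.foldr (fun i g => (partialDeriv i)^[γ i] g) f) := by
  induction l with
  | nil => exact hf
  | cons i l ih => exact contDiff_iterate_partialDeriv ih i _

theorem partialDeriv_foldr_comm {N : ℕ} {f : (Fin N → ℝ) → ℝ} (hf : ContDiff ℝ ∞ f)
    (γ : Fin N → ℕ) (i : Fin N) (l : List (Fin N)) :
    partialDeriv i (l.foldr (fun i g => (partialDeriv i)^[γ i] g) f)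
      = l.foldr (fun i g => (partialDeriv i)^[γ i] g) (partialDeriv i f) := by
  induction l with
  | nil => rfl
  | cons j l ih =>
    rw [List.foldr_cons, List.foldr_cons,
      partialDeriv_iterate_comm (contDiff_foldr_partialDeriv hf γ l), ih]

theorem contDiff_multiDeriv {N : ℕ} {f : (Fin N → ℝ) → ℝ} (hf : ContDiff ℝ ∞ f)
    (γ : Fin N → ℕ) : ContDiff ℝ ∞ (multiDeriv γ f) :=
  contDiff_foldr_partialDeriv hf γ _

theorem partialDeriv_multiDeriv {N : ℕ} {f : (Fin N → ℝ) → ℝ} (hf : ContDiff ℝ ∞ f)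
    (γ : Fin N → ℕ) (i : Fin N) :
    partialDeriv i (multiDeriv γ f) = multiDeriv γ (partialDeriv i f) :=
  partialDeriv_foldr_comm hf γ i _

theorem multiDeriv_zero_index {N : ℕ} (f : (Fin N → ℝ) → ℝ) : multiDeriv 0 f = f := by
  unfold multiDeriv
  generalize List.finRange N = l
  induction l with
  | nil => rfl
  | cons i l ih => simp

/-- `multiDeriv` nests the coordinates in a fixed order. By commutation of partial derivatives the
additional one may be applied first; this reduces later statements to induction on the multi-index,
with the function generalized. -/
theorem multiDeriv_add_single {N : ℕ} {f : (Fin N → ℝ) → ℝ} (hf : ContDiff ℝ ∞ f)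
    (γ : Fin N → ℕ) (i : Fin N) :
    multiDeriv (γ + Pi.single i 1) f = multiDeriv γ (partialDeriv i f) := by
  -- Entries of the list other than i are unaffected; as the list has no repetitions, this handles
  -- what remains after i has been met.
  have h1 : ∀ l : List (Fin N), i ∉ l →
      l.foldr (fun j g => (partialDeriv j)^[(γ + Pi.single i 1 : Fin N → ℕ) j] g) f
        = l.foldr (fun j g => (partialDeriv j)^[γ j] g) f := by
    intro l hl
    induction l with
    | nil => rfl
    | cons j l ih =>
      simp only [List.mem_cons, not_or] at hl
      rw [List.foldr_cons, List.foldr_cons, ih hl.2]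
      simp [Ne.symm hl.1]
  have h2 : ∀ l : List (Fin N), l.Nodup → i ∈ l →
      l.foldr (fun j g => (partialDeriv j)^[(γ + Pi.single i 1 : Fin N → ℕ) j] g) f
        = l.foldr (fun j g => (partialDeriv j)^[γ j] g) (partialDeriv i f) := by
    intro l hn hl
    induction l with
    | nil => simp at hl
    | cons j l ih =>
      rw [List.nodup_cons] at hn
      rw [List.foldr_cons, List.foldr_cons]
      by_cases hj : j = i
      · subst hj
        rw [h1 l hn.1, ← partialDeriv_foldr_comm hf]
        simp
      · have : i ∈ l := by simpa [Ne.symm hj] using hl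
        rw [ih hn.2 this]
        simp [hj]
  exact h2 _ (List.nodup_finRange N) (List.mem_finRange i)

theorem multiDeriv_single {N : ℕ} {f : (Fin N → ℝ) → ℝ} (hf : ContDiff ℝ ∞ f) (i : Fin N) :
    multiDeriv (Pi.single i 1) f = partialDeriv i f := by
  have := multiDeriv_add_single hf 0 i
  rwa [zero_add, multiDeriv_zero_index] at this

theorem partialDeriv_smul_add {N : ℕ} {f g : (Fin N → ℝ) → ℝ} (hf : ContDiff ℝ ∞ f)
    (hg : ContDiff ℝ ∞ g) (c : ℝ) (i : Fin N) :
    partialDeriv i (c • f + g) = c • partialDeriv i f + partialDeriv i g := by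
  ext x
  have h1 := hf.differentiable (by simp) x
  have h2 := hg.differentiable (by simp) x
  simp only [partialDeriv]
  rw [fderiv_add (h1.const_smul c) h2, fderiv_const_smul h1]
  simp [partialDeriv]

theorem multiDeriv_smul_add {N : ℕ} (γ : Fin N → ℕ) {f g : (Fin N → ℝ) → ℝ}
    (hf : ContDiff ℝ ∞ f) (hg : ContDiff ℝ ∞ g) (c : ℝ) :
    multiDeriv γ (c • f + g) = c • multiDeriv γ f + multiDeriv γ g := by
  induction γ using multiIndex_induction generalizing f g with
  | zero => simp [multiDeriv_zero_index]
  | add_single γ i ih =>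
    have hfg : ContDiff ℝ ∞ (c • f + g) := (hf.const_smul c).add hg
    rw [multiDeriv_add_single hfg, multiDeriv_add_single hf,
      multiDeriv_add_single hg, partialDeriv_smul_add hf hg,
      ih (contDiff_partialDeriv hf i) (contDiff_partialDeriv hg i)]

theorem multiDeriv_zero {N : ℕ} (γ : Fin N → ℕ) : multiDeriv γ (0 : (Fin N → ℝ) → ℝ) = 0 := by
  have := multiDeriv_smul_add γ (f := (0 : (Fin N → ℝ) → ℝ)) (g := 0) contDiff_const contDiff_const 1
  simpa using this

theorem multiDeriv_add {N : ℕ} (γ : Fin N → ℕ) {f g : (Fin N → ℝ) → ℝ}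
    (hf : ContDiff ℝ ∞ f) (hg : ContDiff ℝ ∞ g) :
    multiDeriv γ (f + g) = multiDeriv γ f + multiDeriv γ g := by
  simpa using multiDeriv_smul_add γ hf hg 1

theorem multiDeriv_smul {N : ℕ} (γ : Fin N → ℕ) {f : (Fin N → ℝ) → ℝ}
    (hf : ContDiff ℝ ∞ f) (c : ℝ) : multiDeriv γ (c • f) = c • multiDeriv γ f := by
  have := multiDeriv_smul_add γ hf (g := 0) contDiff_const c
  simpa [multiDeriv_zero] using this

theorem multiDeriv_sub {N : ℕ} (γ : Fin N → ℕ) {f g : (Fin N → ℝ) → ℝ}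
    (hf : ContDiff ℝ ∞ f) (hg : ContDiff ℝ ∞ g) :
    multiDeriv γ (f - g) = multiDeriv γ f - multiDeriv γ g := by
  have := multiDeriv_smul_add γ hg hf (-1)
  simpa [sub_eq_neg_add] using this

theorem multiDeriv_sum {N : ℕ} {ι : Type*} (γ : Fin N → ℕ) (s : Finset ι)
    {f : ι → (Fin N → ℝ) → ℝ} (hf : ∀ j ∈ s, ContDiff ℝ ∞ (f j)) :
    multiDeriv γ (∑ j ∈ s, f j) = ∑ j ∈ s, multiDeriv γ (f j) := by
  classical
  induction s using Finset.induction_on with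
  | empty => simp [multiDeriv_zero]
  | insert j s hj ih =>
    have hs : ContDiff ℝ ∞ (∑ j ∈ s, f j) := by
      rw [show (∑ j ∈ s, f j) = fun x => ∑ j ∈ s, f j x by ext; simp]
      exact ContDiff.sum fun j hj => hf j (Finset.mem_insert_of_mem hj)
    rw [Finset.sum_insert hj, Finset.sum_insert hj, multiDeriv_add γ (hf j (by simp)) hs,
      ih fun j hj => hf j (Finset.mem_insert_of_mem hj)]

/-- The affine map of `ℝ^N` that acts on each coordinate separately. -/
def diagAffine {N : ℕ} (d b : Fin N → ℝ) (x : Fin N → ℝ) : Fin N → ℝ := d * x + b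

theorem contDiff_diagAffine {N : ℕ} (d b : Fin N → ℝ) : ContDiff ℝ ∞ (diagAffine d b) := by
  rw [contDiff_pi]
  intro i
  simp only [diagAffine, Pi.add_apply, Pi.mul_apply]
  fun_prop

theorem partialDeriv_comp_diagAffine {N : ℕ} {f : (Fin N → ℝ) → ℝ} (hf : ContDiff ℝ ∞ f)
    (d b : Fin N → ℝ) (i : Fin N) :
    partialDeriv i (f ∘ diagAffine d b) = d i • (partialDeriv i f ∘ diagAffine d b) := by
  ext x
  have h2 : HasFDerivAt (diagAffine d b) (ContinuousLinearMap.pi fun i =>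
      d i • ContinuousLinearMap.proj (R := ℝ) (φ := fun _ : Fin N => ℝ) i) x := by
    rw [hasFDerivAt_pi]
    intro i
    simp only [diagAffine, Pi.add_apply, Pi.mul_apply]
    exact ((hasFDerivAt_apply i x).const_mul (d i)).add_const _
  have h1 := (hf.differentiable (by simp) (diagAffine d b x)).hasFDerivAt
  simp only [partialDeriv, Function.comp_apply, Pi.smul_apply, smul_eq_mul]
  rw [(h1.comp x h2).fderiv, ContinuousLinearMap.comp_apply, ← smul_eq_mul, ← map_smul]
  congr 1
  ext j
  by_cases hj : j = i
  · subst hj; simp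
  · simp [hj]

/-- This single chain rule covers the contraction used before mollifying, the substitution t ↦ y - t
in a convolution, and the maps used for reflection. -/
theorem multiDeriv_comp_diagAffine {N : ℕ} (γ : Fin N → ℕ) {f : (Fin N → ℝ) → ℝ}
    (hf : ContDiff ℝ ∞ f) (d b : Fin N → ℝ) :
    multiDeriv γ (f ∘ diagAffine d b)
      = (∏ i, d i ^ γ i) • (multiDeriv γ f ∘ diagAffine d b) := by
  induction γ using multiIndex_induction generalizing f with
  | zero => simp [multiDeriv_zero_index]
  | add_single γ i ih =>
    have h := contDiff_partialDeriv hf i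
    rw [multiDeriv_add_single (hf.comp (contDiff_diagAffine d b)), multiDeriv_add_single hf,
      partialDeriv_comp_diagAffine hf, multiDeriv_smul γ (h.comp (contDiff_diagAffine d b)), ih h,
      smul_smul]
    congr 1
    simp only [Pi.add_apply, pow_add, Finset.prod_mul_distrib]
    rw [mul_comm]
    congr 1
    rw [Finset.prod_eq_single i] <;> simp +contextual

/-! ### Calculus of weak derivatives -/

theorem HasWeakDeriv.zero_index {N : ℕ} {Ω : Set (Fin N → ℝ)} {u : (Fin N → ℝ) → ℝ}
    (hu : LocallyIntegrableOn u Ω) : HasWeakDeriv Ω 0 u u :=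
  ⟨hu, hu, fun φ _ => by simp [multiDeriv_zero_index]⟩

theorem HasWeakDeriv.comp_single {N : ℕ} {Ω : Set (Fin N → ℝ)} {γ : Fin N → ℕ} {i : Fin N}
    {u g h : (Fin N → ℝ) → ℝ} (hg : HasWeakDeriv Ω (Pi.single i 1) u g)
    (hh : HasWeakDeriv Ω γ g h) : HasWeakDeriv Ω (γ + Pi.single i 1) u h := by
  refine ⟨hg.1, hh.2, fun φ ht => ?_⟩
  have := hg.3 _ (isTestFunction_multiDeriv γ ht)
  rw [multiDeriv_single (contDiff_multiDeriv ht.1 γ), partialDeriv_multiDeriv ht.1,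
    ← multiDeriv_add_single ht.1] at this
  rw [this, hh.3 φ ht, sum_add_single, pow_succ]
  simp

/-- Testing the first-order identity against D^γ φ cancels one factor of -1. It is the step by which
a first weak derivative of a function in W^{n+1,p} is seen to lie in W^{n,p}. -/
theorem HasWeakDeriv.of_add_single {N : ℕ} {Ω : Set (Fin N → ℝ)} {γ : Fin N → ℕ} {i : Fin N}
    {u g h : (Fin N → ℝ) → ℝ} (hg : HasWeakDeriv Ω (Pi.single i 1) u g)
    (hh : HasWeakDeriv Ω (γ + Pi.single i 1) u h) : HasWeakDeriv Ω γ g h := by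
  refine ⟨hg.2, hh.2, fun φ ht => ?_⟩
  have e1 := hg.3 _ (isTestFunction_multiDeriv γ ht)
  have e2 := hh.3 φ ht
  rw [multiDeriv_single (contDiff_multiDeriv ht.1 γ), partialDeriv_multiDeriv ht.1,
    ← multiDeriv_add_single ht.1, e2, sum_add_single, pow_succ] at e1
  simp at e1
  linarith

theorem hasWeakDeriv_multiDeriv {N : ℕ} (Ω : Set (Fin N → ℝ)) (γ : Fin N → ℕ)
    {f : (Fin N → ℝ) → ℝ} (hf : ContDiff ℝ ∞ f) : HasWeakDeriv Ω γ f (multiDeriv γ f) := by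
  have hl : ∀ g : (Fin N → ℝ) → ℝ, ContDiff ℝ ∞ g → LocallyIntegrableOn g Ω := fun g hg =>
    hg.continuous.locallyIntegrable.locallyIntegrableOn Ω
  induction γ using multiIndex_induction generalizing f with
  | zero => rw [multiDeriv_zero_index]; exact .zero_index (hl f hf)
  | add_single γ i ih =>
    rw [multiDeriv_add_single hf]
    have hf' := contDiff_partialDeriv hf i
    refine HasWeakDeriv.comp_single ⟨hl _ hf, hl _ hf', fun φ ht => ?_⟩ (ih hf')
    rw [multiDeriv_single ht.1, setIntegral_mul_test _ ht, setIntegral_mul_test _ (ht.partialDeriv i),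
      integral_mul_partialDeriv hf ht]
    simp

theorem HasWeakDeriv.mono {N : ℕ} {Ω Ω' : Set (Fin N → ℝ)} (hΩ : Ω' ⊆ Ω) {γ : Fin N → ℕ}
    {u g : (Fin N → ℝ) → ℝ} (h : HasWeakDeriv Ω γ u g) : HasWeakDeriv Ω' γ u g := by
  refine ⟨h.1.mono_set hΩ, h.2.mono_set hΩ, fun φ ht => ?_⟩
  have ht' : IsTestFunction Ω φ := ⟨ht.1, ht.2, ht.3.trans hΩ⟩
  have := h.3 φ ht'
  rwa [setIntegral_mul_test _ ht', setIntegral_mul_test _ (isTestFunction_multiDeriv γ ht'),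
    ← setIntegral_mul_test _ ht, ← setIntegral_mul_test _ (isTestFunction_multiDeriv γ ht)] at this

theorem MeasureTheory.LocallyIntegrableOn.congr_ae_restrict {N : ℕ} {Ω : Set (Fin N → ℝ)}
    {u v : (Fin N → ℝ) → ℝ} (h : LocallyIntegrableOn u Ω)
    (huv : u =ᵐ[volume.restrict Ω] v) : LocallyIntegrableOn v Ω := by
  intro x hx
  obtain ⟨t, ht, hut⟩ := h x hx
  refine ⟨t ∩ Ω, Filter.inter_mem ht self_mem_nhdsWithin, ?_⟩
  refine (hut.mono_set Set.inter_subset_left).congr_fun_ae ?_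
  exact ae_restrict_of_ae_restrict_of_subset Set.inter_subset_right huv

theorem HasWeakDeriv.congr {N : ℕ} {Ω : Set (Fin N → ℝ)} {γ : Fin N → ℕ}
    {u v g g' : (Fin N → ℝ) → ℝ} (h : HasWeakDeriv Ω γ u g)
    (huv : u =ᵐ[volume.restrict Ω] v) (hg : g =ᵐ[volume.restrict Ω] g') :
    HasWeakDeriv Ω γ v g' := by
  refine ⟨h.1.congr_ae_restrict huv, h.2.congr_ae_restrict hg, fun φ ht => ?_⟩
  rw [← integral_congr_ae (huv.mono fun x hx => by simp [hx] :
    (fun x => u x * multiDeriv γ φ x) =ᵐ[volume.restrict Ω] fun x => v x * multiDeriv γ φ x),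
    h.3 φ ht, integral_congr_ae (hg.mono fun x hx => by simp [hx] :
    (fun x => g x * φ x) =ᵐ[volume.restrict Ω] fun x => g' x * φ x)]

theorem HasWeakDeriv.weakDeriv_ae_eq {N : ℕ} {Ω : Set (Fin N → ℝ)} (hΩ : IsOpen Ω)
    {γ : Fin N → ℕ} {u g : (Fin N → ℝ) → ℝ} (h : HasWeakDeriv Ω γ u g) :
    weakDeriv Ω γ u =ᵐ[volume.restrict Ω] g :=
  (weakDeriv_spec ⟨g, h⟩).ae_eq hΩ h (.refl _ _)

theorem HasWeakDeriv.sub {N : ℕ} {Ω : Set (Fin N → ℝ)} (hΩ : IsOpen Ω) {γ : Fin N → ℕ}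
    {u v g g' : (Fin N → ℝ) → ℝ} (h : HasWeakDeriv Ω γ u g) (h' : HasWeakDeriv Ω γ v g') :
    HasWeakDeriv Ω γ (u - v) (g - g') := by
  have := h'.smul_add hΩ h (-1)
  simpa [sub_eq_neg_add] using this

theorem HasWeakDeriv.add {N : ℕ} {Ω : Set (Fin N → ℝ)} (hΩ : IsOpen Ω) {γ : Fin N → ℕ}
    {u v g g' : (Fin N → ℝ) → ℝ} (h : HasWeakDeriv Ω γ u g) (h' : HasWeakDeriv Ω γ v g') :
    HasWeakDeriv Ω γ (u + v) (g + g') := by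
  simpa using h.smul_add hΩ h' 1

/-- Weak derivatives pass to limits in `L^p`. -/
theorem HasWeakDeriv.of_approx {N : ℕ} {Ω : Set (Fin N → ℝ)} {γ : Fin N → ℕ} (hΩ : IsOpen Ω)
    {p : ℝ≥0} (hp : 1 ≤ p) {u g : (Fin N → ℝ) → ℝ}
    (hu : MemLp u p (volume.restrict Ω)) (hg : MemLp g p (volume.restrict Ω))
    (h : ∀ ε : ℝ≥0, 0 < ε → ∃ v w, HasWeakDeriv Ω γ v w ∧
      eLpNorm (v - u) p (volume.restrict Ω) ≤ ε ∧ eLpNorm (w - g) p (volume.restrict Ω) ≤ ε) :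
    HasWeakDeriv Ω γ u g := by
  have hp' : (1 : ℝ≥0∞) ≤ p := by exact_mod_cast hp
  have hl : ∀ v : (Fin N → ℝ) → ℝ, MemLp v p (volume.restrict Ω) → LocallyIntegrableOn v Ω :=
    fun v hv => locallyIntegrableOn_of_locallyIntegrable_restrict (hv.locallyIntegrable hp')
  refine ⟨hl u hu, hl g hg, fun φ ht => ?_⟩
  have ht' := isTestFunction_multiDeriv γ ht
  -- For p = 1 the conjugate exponent is ∞. Hölder's inequality for `eLpNorm` treats this case
  -- together with the others, since test functions belong to every L^q.
  have hq : ENNReal.HolderConjugate (p : ℝ≥0∞) (ENNReal.conjExponent p) :=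
    ENNReal.HolderConjugate.conjExponent hp'
  generalize ENNReal.conjExponent (p : ℝ≥0∞) = q at hq
  have hmem : ∀ ψ, IsTestFunction Ω ψ → MemLp ψ q (volume.restrict Ω) := fun ψ hψ =>
    (hψ.1.continuous.memLp_of_hasCompactSupport hψ.2).restrict Ω
  have key : ∀ ψ, IsTestFunction Ω ψ → ∀ (v w : (Fin N → ℝ) → ℝ) (ε : ℝ≥0),
      LocallyIntegrableOn v Ω → LocallyIntegrableOn w Ω →
      eLpNorm (v - w) p (volume.restrict Ω) ≤ ε →
      |(∫ x in Ω, v x * ψ x) - ∫ x in Ω, w x * ψ x| ≤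
        ε * (eLpNorm ψ q (volume.restrict Ω)).toReal := by
    intro ψ hψ v w ε hv hw hε
    rw [← integral_sub (integrable_mul_test hΩ hv hψ) (integrable_mul_test hΩ hw hψ)]
    have h2 := eLpNorm_smul_le_mul_eLpNorm (p := p) (q := q) (r := 1)
      (μ := volume.restrict Ω) (φ := v - w) (f := ψ) (hmem ψ hψ).1
      (hv.aestronglyMeasurable.sub hw.aestronglyMeasurable)
    rw [eLpNorm_one_eq_lintegral_enorm] at h2
    have h3 : ‖∫ x in Ω, (v x * ψ x - w x * ψ x)‖ₑ
        ≤ ε * eLpNorm ψ q (volume.restrict Ω) := by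
      refine (enorm_integral_le_lintegral_enorm _).trans ?_
      refine le_trans (le_of_eq ?_) (h2.trans (mul_le_mul_left hε _))
      refine lintegral_congr fun x => ?_
      simp [sub_mul]
    have h4 := ENNReal.toReal_mono (ENNReal.mul_ne_top ENNReal.coe_ne_top (hmem ψ hψ).2.ne) h3
    simpa using h4
  set M : ℝ := (eLpNorm (multiDeriv γ φ) q (volume.restrict Ω)).toReal
    + (eLpNorm φ q (volume.restrict Ω)).toReal with hM
  have hM0 : 0 ≤ M := by positivity
  set x : ℝ := |(∫ x in Ω, u x * multiDeriv γ φ x) - (-1) ^ (∑ i, γ i) * ∫ x in Ω, g x * φ x| with hx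
  have hbound : ∀ ε : ℝ≥0, 0 < ε → x ≤ ε * M := by
    intro ε hε
    obtain ⟨v, w, hvw, h1, h2⟩ := h ε hε
    have k1 := key _ ht' v u ε hvw.1 (hl u hu) h1
    have k2 := key _ ht w g ε hvw.2 (hl g hg) h2
    rw [hvw.3 φ ht] at k1
    have k3 : |(-1) ^ (∑ i, γ i) * (∫ x in Ω, w x * φ x) - (-1) ^ (∑ i, γ i) * ∫ x in Ω, g x * φ x|
        = |(∫ x in Ω, w x * φ x) - ∫ x in Ω, g x * φ x| := by
      rw [← mul_sub, abs_mul]; simp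
    rw [← k3] at k2
    rw [abs_sub_comm] at k1
    refine (abs_sub_le _ _ _).trans ((add_le_add k1 k2).trans ?_)
    rw [hM, mul_add]
  have hx0 : x = 0 := by
    by_contra hne
    have hpos : 0 < x := lt_of_le_of_ne (abs_nonneg _) (Ne.symm hne)
    -- This ε turns x ≤ ε M into x ≤ x/2, as M < M + 1.
    have := hbound (x / (2 * (M + 1))).toNNReal (by rw [Real.toNNReal_pos]; positivity)
    rw [Real.coe_toNNReal _ (by positivity)] at this
    rw [div_mul_eq_mul_div, le_div_iff₀ (by positivity)] at this
    nlinarith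
  exact sub_eq_zero.1 (abs_eq_zero.1 hx0)

/-! ### Averages over measurable families of maps -/

/-- If `G` is bounded by the average of `g` over a family of maps `A (·, z)` which on average do
not concentrate the measure `ν`, then the `L^p` norm of `G` is controlled by that of `g`. -/
theorem eLpNorm_le_of_le_average {X Z : Type*} [MeasurableSpace X] [MeasurableSpace Z]
    {ν : Measure X} [SFinite ν] {μ : Measure Z} [IsProbabilityMeasure μ] {A : X × Z → X}
    (hA : Measurable A) {K : ℝ≥0} (hK : (ν.prod μ).map A ≤ K • ν) {p : ℝ≥0} (hp : 1 ≤ p)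
    {g G : X → ℝ} (hg : AEStronglyMeasurable g ν) (M : ℝ≥0)
    (h : ∀ᵐ x ∂ν, ‖G x‖ₑ ≤ M * ∫⁻ z, ‖g (A (x, z))‖ₑ ∂μ) :
    eLpNorm G p ν ≤ (M * K ^ (1 / (p : ℝ)) : ℝ≥0) * eLpNorm g p ν := by
  have hp0 : p ≠ 0 := (zero_lt_one.trans_le hp).ne'
  have hp' : (0 : ℝ) < p := by exact_mod_cast zero_lt_one.trans_le hp
  have hgA : AEStronglyMeasurable (g ∘ A) (ν.prod μ) := by
    refine AEStronglyMeasurable.comp_measurable ?_ hA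
    exact ((hg.smul_measure K).mono_measure hK)
  have key : eLpNorm G p ν ^ (p : ℝ) ≤
      ((M * K ^ (1 / (p : ℝ)) : ℝ≥0) * eLpNorm g p ν) ^ (p : ℝ) := by
    rw [ENNReal.mul_rpow_of_nonneg _ _ hp'.le, eLpNorm_nnreal_pow_eq_lintegral hp0,
      eLpNorm_nnreal_pow_eq_lintegral hp0]
    have e1 : ∀ᵐ x ∂ν, ‖G x‖ₑ ^ (p : ℝ) ≤
        (M : ℝ≥0∞) ^ (p : ℝ) * ∫⁻ z, ‖(g ∘ A) (x, z)‖ₑ ^ (p : ℝ) ∂μ := by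
      filter_upwards [h, hgA.prodMk_left] with x hx hx'
      refine (ENNReal.rpow_le_rpow hx hp'.le).trans ?_
      rw [ENNReal.mul_rpow_of_nonneg _ _ hp'.le]
      gcongr
      -- Jensen's inequality: the measure of the parameters is a probability measure, so its L^1
      -- norm is at most its L^p norm.
      have := eLpNorm_le_eLpNorm_of_exponent_le (p := 1) (q := p) (by exact_mod_cast hp) hx'
      have := ENNReal.rpow_le_rpow this hp'.le
      rwa [eLpNorm_nnreal_pow_eq_lintegral hp0, eLpNorm_one_eq_lintegral_enorm] at this
    refine (lintegral_mono_ae e1).trans ?_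
    have hm : AEMeasurable (fun q => ‖(g ∘ A) q‖ₑ ^ (p : ℝ)) (ν.prod μ) :=
      hgA.enorm.pow_const _
    rw [lintegral_const_mul' _ _ (by simp [ENNReal.rpow_eq_top_iff, hp'.not_gt]),
      ← lintegral_prod _ hm]
    have hm' : AEMeasurable (fun x => ‖g x‖ₑ ^ (p : ℝ)) ((ν.prod μ).map A) :=
      ((hg.smul_measure K).mono_measure hK).enorm.pow_const _
    have e2 := lintegral_map' hm' hA.aemeasurable
    simp only [Function.comp_apply]
    rw [← e2]
    refine (mul_le_mul_right (lintegral_mono' hK le_rfl) _).trans (le_of_eq ?_)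
    rw [lintegral_smul_measure]
    have : ((M * K ^ (1 / (p : ℝ)) : ℝ≥0) : ℝ≥0∞) ^ (p : ℝ) = (M : ℝ≥0∞) ^ (p : ℝ) * K := by
      rw [← ENNReal.coe_rpow_of_nonneg _ hp'.le, NNReal.mul_rpow, ← NNReal.rpow_mul,
        one_div_mul_cancel hp'.ne', NNReal.rpow_one, ENNReal.coe_mul,
        ENNReal.coe_rpow_of_nonneg _ hp'.le]
    rw [this, mul_assoc]
    rfl
  exact (ENNReal.rpow_le_rpow_iff hp').1 key

/-- By Fubini it is enough that almost every single map of the family is non-concentrating. The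
segments in Poincaré's inequality need a finer argument, because there the bound fails for some
parameters. -/
theorem map_prod_le_of_forall {X Z : Type*} [MeasurableSpace X] [MeasurableSpace Z]
    {ν : Measure X} [SFinite ν] {μ : Measure Z} [IsProbabilityMeasure μ] {A : X × Z → X}
    (hA : Measurable A) {K : ℝ≥0}
    (hK : ∀ᵐ z ∂μ, ν.map (fun x => A (x, z)) ≤ K • ν) : (ν.prod μ).map A ≤ K • ν := by
  rw [Measure.le_iff]
  intro s hs
  rw [Measure.map_apply hA hs, Measure.prod_apply_symm (hA hs)]
  calc ∫⁻ z, ν ((fun x => (x, z)) ⁻¹' (A ⁻¹' s)) ∂μ ≤ ∫⁻ _, (K • ν) s ∂μ := by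
        refine lintegral_mono_ae ?_
        filter_upwards [hK] with z hz
        have := hz s
        have hm : Measurable fun x => A (x, z) := hA.comp measurable_prodMk_right
        rwa [Measure.map_apply hm hs] at this
    _ = (K • ν) s := by simp

theorem measurable_diagAffine {N : ℕ} (d b : Fin N → ℝ) : Measurable (diagAffine d b) :=
  (contDiff_diagAffine d b).continuous.measurable

theorem map_diagAffine_volume {N : ℕ} {d : Fin N → ℝ} (hd : ∀ i, d i ≠ 0) (b : Fin N → ℝ) :
    (volume : Measure (Fin N → ℝ)).map (diagAffine d b)
      = (‖∏ i, d i‖₊⁻¹ : ℝ≥0) • (volume : Measure (Fin N → ℝ)) := by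
  have hdet : LinearMap.det (Matrix.toLin' (Matrix.diagonal d)) = ∏ i, d i := by
    rw [LinearMap.det_toLin', Matrix.det_diagonal]
  have h0 : LinearMap.det (Matrix.toLin' (Matrix.diagonal d)) ≠ 0 := by
    rw [hdet]; exact Finset.prod_ne_zero_iff.2 fun i _ => hd i
  have e : diagAffine d b = (fun x => x + b) ∘ (Matrix.toLin' (Matrix.diagonal d)) := by
    ext x i
    simp [diagAffine, Matrix.mulVec_diagonal]
  rw [e, ← Measure.map_map (measurable_add_const b)
    (LinearMap.continuous_of_finiteDimensional _).measurable,
    Measure.map_linearMap_addHaar_eq_smul_addHaar _ h0, Measure.map_smul, map_add_right_eq_self,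
    hdet]
  rw [ENNReal.ofReal, abs_inv, Real.toNNReal_inv, ← Real.norm_eq_abs, norm_toNNReal]
  rfl

theorem map_diagAffine_restrict_le {N : ℕ} {d b : Fin N → ℝ} (hd : ∀ i, d i ≠ 0)
    {S B : Set (Fin N → ℝ)} (hB : MeasurableSet B) (h : Set.MapsTo (diagAffine d b) S B) :
    (volume.restrict S).map (diagAffine d b) ≤ (‖∏ i, d i‖₊⁻¹ : ℝ≥0) • volume.restrict B := by
  rw [Measure.le_iff]
  intro s hs
  have hm := measurable_diagAffine d b
  rw [Measure.map_apply hm hs, Measure.restrict_apply (hm hs), Measure.smul_apply,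
    Measure.restrict_apply hs]
  have := congrArg (fun μ : Measure (Fin N → ℝ) => μ (s ∩ B)) (map_diagAffine_volume hd b)
  simp only [Measure.smul_apply] at this
  rw [← this, Measure.map_apply hm (hs.inter hB)]
  exact measure_mono fun x hx => ⟨hx.1, h hx.2⟩

/-! ### Density of smooth functions in `W^{m,p}(B)`, for a bounded convex open set `B` -/

/-- Convolution with `ψ`. -/
noncomputable def mollify {N : ℕ} (ψ g : (Fin N → ℝ) → ℝ) : (Fin N → ℝ) → ℝ :=
  convolution ψ g (ContinuousLinearMap.lsmul ℝ ℝ) volume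

theorem mollify_apply {N : ℕ} (ψ g : (Fin N → ℝ) → ℝ) (x : Fin N → ℝ) :
    mollify ψ g x = ∫ t, ψ t * g (x - t) := by
  simp [mollify, convolution_def]

theorem mollify_apply' {N : ℕ} (ψ g : (Fin N → ℝ) → ℝ) (x : Fin N → ℝ) :
    mollify ψ g x = ∫ t, g t * ψ (x - t) := by
  rw [mollify, convolution_lsmul_swap]
  simp [mul_comm]

theorem contDiff_mollify {N : ℕ} {ψ g : (Fin N → ℝ) → ℝ} (h : IsTestFunction Set.univ ψ)
    (hg : LocallyIntegrable g) : ContDiff ℝ ∞ (mollify ψ g) :=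
  h.2.contDiff_convolution_left (n := ⊤) _ h.1 hg

theorem partialDeriv_mollify {N : ℕ} {ψ g : (Fin N → ℝ) → ℝ} (h : IsTestFunction Set.univ ψ)
    (hg : LocallyIntegrable g) (i : Fin N) :
    partialDeriv i (mollify ψ g) = mollify (partialDeriv i ψ) g := by
  ext x
  have e : ∀ φ : (Fin N → ℝ) → ℝ, mollify φ g
      = convolution g φ (ContinuousLinearMap.lsmul ℝ ℝ).flip volume := fun φ => by
    rw [mollify, convolution_flip]
  rw [e, e, partialDeriv, (h.2.hasFDerivAt_convolution_right _ hg (h.1.of_le (by simp)) x).fderiv]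
  exact convolution_precompR_apply _ hg (h.2.fderiv (𝕜 := ℝ))
    ((h.1.fderiv_right (m := ∞) (by simp)).continuous) x _

theorem multiDeriv_mollify {N : ℕ} (γ : Fin N → ℕ) {ψ g : (Fin N → ℝ) → ℝ}
    (h : IsTestFunction Set.univ ψ) (hg : LocallyIntegrable g) :
    multiDeriv γ (mollify ψ g) = mollify (multiDeriv γ ψ) g := by
  induction γ using multiIndex_induction generalizing ψ with
  | zero => simp [multiDeriv_zero_index]
  | add_single γ i ih =>
    rw [multiDeriv_add_single (contDiff_mollify h hg), partialDeriv_mollify h hg,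
      ih (h.partialDeriv i), multiDeriv_add_single h.1]

/-- Derivatives of a convolution fall on the function, away from the boundary. -/
theorem mollify_multiDeriv {N : ℕ} {B : Set (Fin N → ℝ)} (hB : IsOpen B) {γ : Fin N → ℕ}
    {u g ψ : (Fin N → ℝ) → ℝ} (hu : HasWeakDeriv B γ u g) (h : IsTestFunction Set.univ ψ)
    {y : Fin N → ℝ} (hy : ∀ t ∈ tsupport ψ, y - t ∈ B) :
    mollify (multiDeriv γ ψ) (B.indicator u) y = mollify ψ (B.indicator g) y := by
  have e : ∀ φ : (Fin N → ℝ) → ℝ, φ ∘ diagAffine (fun _ => -1) y = fun t => φ (y - t) := by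
    intro φ; ext t
    simp only [diagAffine, Function.comp_apply]
    congr 1
    ext i
    simp; ring
  have hh : Continuous (fun t : Fin N → ℝ => y - t) := by fun_prop
  have hφ : IsTestFunction B (fun t => ψ (y - t)) := by
    refine ⟨?_, ?_, ?_⟩
    · rw [← e]; exact h.1.comp (contDiff_diagAffine _ _)
    · exact h.2.comp_homeomorph (Homeomorph.subLeft y)
    · intro t ht
      have : y - t ∈ tsupport ψ := tsupport_comp_subset_preimage ψ hh ht
      simpa using hy _ this
  have key := hu.3 _ hφ
  -- The substitution t ↦ y - t yields the factor (-1)^|γ|, which cancels the sign in the definition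
  -- of the weak derivative.
  rw [← e, multiDeriv_comp_diagAffine γ h.1, e, Finset.prod_pow_eq_pow_sum] at key
  rw [mollify_apply', mollify_apply']
  have ei : ∀ v φ : (Fin N → ℝ) → ℝ, ∫ t, B.indicator v t * φ (y - t)
      = ∫ t in B, v t * φ (y - t) := by
    intro v φ
    rw [← integral_indicator hB.measurableSet]
    congr 1; ext t
    by_cases ht : t ∈ B <;> simp [ht]
  rw [ei, ei]
  simp only [Pi.smul_apply, smul_eq_mul] at key
  have e2 : ∀ t, u t * ((-1) ^ (∑ i, γ i) * multiDeriv γ ψ (y - t))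
      = (-1) ^ (∑ i, γ i) * (u t * multiDeriv γ ψ (y - t)) := fun t => by ring
  simp_rw [e2] at key
  rw [integral_const_mul] at key
  exact mul_left_cancel₀ (by positivity) key

theorem diagAffine_const {N : ℕ} (c : ℝ) (b x : Fin N → ℝ) :
    diagAffine (fun _ => c) b x = c • x + b := by
  ext i; simp [diagAffine]

/-- The pull-back of the mollified function under a contraction of `B` towards `b`. -/
noncomputable def shrinkMollify {N : ℕ} (B : Set (Fin N → ℝ)) (b : Fin N → ℝ) (ε : ℝ)
    (ψ g : (Fin N → ℝ) → ℝ) : (Fin N → ℝ) → ℝ :=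
  mollify ψ (B.indicator g) ∘ diagAffine (fun _ => 1 - ε) (ε • b)

/-- The point is the convex combination of x and b - t/ε with weights 1 - ε and ε, and b - t/ε lies
in the ball inside B. Contraction towards b thus makes room for a mollifier of radius ε r up to the
boundary. -/
theorem shrink_sub_mem {N : ℕ} {B : Set (Fin N → ℝ)} (hB : Convex ℝ B) {b : Fin N → ℝ} {r ε : ℝ}
    (hb : Metric.ball b r ⊆ B) (hε : 0 < ε) (hε1 : ε ≤ 1) {x t : Fin N → ℝ} (hx : x ∈ B)
    (ht : t ∈ Metric.ball (0 : Fin N → ℝ) (ε * r)) :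
    diagAffine (fun _ => 1 - ε) (ε • b) x - t ∈ B := by
  have e : diagAffine (fun _ => 1 - ε) (ε • b) x - t
      = (1 - ε) • x + ε • (b - ε⁻¹ • t) := by
    rw [diagAffine_const, smul_sub, smul_inv_smul₀ hε.ne']
    abel
  rw [e]
  refine hB hx (hb ?_) (by linarith) hε.le (by ring)
  rw [Metric.mem_ball, dist_eq_norm] at *
  rw [sub_zero] at ht
  rw [sub_sub_cancel_left, norm_neg, norm_smul, norm_inv, Real.norm_of_nonneg hε.le,
    inv_mul_lt_iff₀ hε]
  exact ht

/-- The function is the average, with density ψ in t, of g composed with x ↦ (1 - ε) x + ε b - t.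
For relevant t these maps send B into itself, and since ε ≤ 1/2 their Jacobians are at least 2^{-N}.
-/
theorem eLpNorm_shrinkMollify_le {N : ℕ} {B : Set (Fin N → ℝ)} (hBo : IsOpen B)
    (hB : Convex ℝ B) {b : Fin N → ℝ} {r ε : ℝ} (hb : Metric.ball b r ⊆ B) (hε : 0 < ε)
    (hε1 : ε ≤ 1 / 2) {p : ℝ≥0} (hp : 1 ≤ p) {ψ g : (Fin N → ℝ) → ℝ} (hψ : Continuous ψ)
    (hψ0 : ∀ t, 0 ≤ ψ t) (hψ1 : ∫ t, ψ t = 1)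
    (hψs : Function.support ψ ⊆ Metric.ball (0 : Fin N → ℝ) (ε * r))
    (hg : AEStronglyMeasurable g (volume.restrict B)) :
    eLpNorm (shrinkMollify B b ε ψ g) p (volume.restrict B)
      ≤ ((2 ^ N) ^ (1 / (p : ℝ)) : ℝ≥0) * eLpNorm g p (volume.restrict B) := by
  let μ : Measure (Fin N → ℝ) := volume.withDensity fun t => ENNReal.ofReal (ψ t)
  have hψm : Measurable fun t => ENNReal.ofReal (ψ t) := by fun_prop
  have hμ : IsProbabilityMeasure μ := by
    refine ⟨?_⟩
    rw [withDensity_apply _ .univ, Measure.restrict_univ, ← ofReal_integral_eq_lintegral_ofReal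
      (integrable_of_integral_eq_one hψ1) (.of_forall hψ0), hψ1, ENNReal.ofReal_one]
  let A : (Fin N → ℝ) × (Fin N → ℝ) → (Fin N → ℝ) :=
    fun q => diagAffine (fun _ => 1 - ε) (ε • b) q.1 - q.2
  have hA : Measurable A :=
    ((measurable_diagAffine _ _).comp measurable_fst).sub measurable_snd
  have hμs : ∀ᵐ t ∂μ, t ∈ Metric.ball (0 : Fin N → ℝ) (ε * r) := by
    rw [ae_withDensity_iff hψm]
    refine .of_forall fun t ht => hψs ?_
    rw [Function.mem_support]
    intro h0
    simp [h0] at ht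
  have hK : ((volume.restrict B).prod μ).map A ≤ (2 ^ N : ℝ≥0) • volume.restrict B := by
    refine map_prod_le_of_forall hA ?_
    filter_upwards [hμs] with t ht
    have e : (fun x => A (x, t)) = diagAffine (fun _ => 1 - ε) (ε • b - t) := by
      ext x i; simp [A, diagAffine]; ring
    rw [e]
    refine (map_diagAffine_restrict_le (fun _ => by linarith) hBo.measurableSet ?_).trans ?_
    · intro x hx
      have := shrink_sub_mem hB hb hε (by linarith) hx ht
      rwa [show diagAffine (fun _ => 1 - ε) (ε • b) x - t
        = diagAffine (fun _ => 1 - ε) (ε • b - t) x from congrFun e x] at this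
    · have hle : (‖∏ _i : Fin N, (1 - ε)‖₊⁻¹ : ℝ≥0) ≤ 2 ^ N := by
        rw [Finset.prod_const, Finset.card_univ, Fintype.card_fin, nnnorm_pow, ← inv_pow]
        gcongr
        rw [← NNReal.coe_le_coe]
        push_cast
        rw [Real.norm_of_nonneg (by linarith), inv_le_comm₀ (by linarith) (by norm_num)]
        norm_num at *; linarith
      rw [Measure.le_iff]
      intro s _
      simp only [Measure.smul_apply]
      exact mul_le_mul_left (ENNReal.coe_le_coe.2 hle) _
  have hgi : AEStronglyMeasurable (B.indicator g) (volume.restrict B) :=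
    hg.congr (indicator_ae_eq_restrict hBo.measurableSet).symm
  have := eLpNorm_le_of_le_average hA hK hp hgi (G := shrinkMollify B b ε ψ g) 1 (by
    refine .of_forall fun x => ?_
    rw [ENNReal.coe_one, one_mul, lintegral_withDensity_eq_lintegral_mul_non_measurable _ hψm
      (.of_forall fun _ => ENNReal.ofReal_lt_top), shrinkMollify, Function.comp_apply,
      mollify_apply]
    refine (enorm_integral_le_lintegral_enorm _).trans (le_of_eq ?_)
    refine lintegral_congr fun t => ?_
    rw [enorm_mul, Real.enorm_eq_ofReal (hψ0 t)]
    rfl)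
  rw [one_mul] at this
  refine this.trans (le_of_eq ?_)
  congr 1
  exact eLpNorm_congr_ae (indicator_ae_eq_restrict hBo.measurableSet)

theorem isFiniteMeasure_restrict_of_isBounded {N : ℕ} {B : Set (Fin N → ℝ)}
    (hB : Bornology.IsBounded B) : IsFiniteMeasure (volume.restrict B) :=
  ⟨by rw [Measure.restrict_apply_univ]; exact hB.measure_lt_top⟩

theorem MeasureTheory.MemLp.integrable_indicator {N : ℕ} {B : Set (Fin N → ℝ)} (hBo : IsOpen B)
    (hB : Bornology.IsBounded B) {p : ℝ≥0} (hp : 1 ≤ p) {g : (Fin N → ℝ) → ℝ}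
    (hg : MemLp g p (volume.restrict B)) : Integrable (B.indicator g) := by
  have := isFiniteMeasure_restrict_of_isBounded hB
  rw [integrable_indicator_iff hBo.measurableSet]
  exact hg.integrable (by exact_mod_cast hp)

/-- Because the operators are bounded uniformly in ε, g may be replaced by a compactly supported
continuous f. For f uniform continuity gives convergence uniformly on B, and B has finite measure.
-/
theorem shrinkMollify_approx {N : ℕ} {B : Set (Fin N → ℝ)} (hBo : IsOpen B)
    (hB : Convex ℝ B) (hBb : Bornology.IsBounded B) {b : Fin N → ℝ} {r : ℝ} (hr : 0 < r)
    (hb : Metric.ball b r ⊆ B) {p : ℝ≥0} (hp : 1 ≤ p) {g : (Fin N → ℝ) → ℝ}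
    (hg : MemLp g p (volume.restrict B)) {η : ℝ≥0} (hη : 0 < η) :
    ∃ ε₀ > 0, ∀ ε, 0 < ε → ε < ε₀ → ∀ ψ, IsTestFunction Set.univ ψ → (∀ t, 0 ≤ ψ t) →
      ∫ t, ψ t = 1 → Function.support ψ ⊆ Metric.ball (0 : Fin N → ℝ) (ε * r) →
      eLpNorm (shrinkMollify B b ε ψ g - g) p (volume.restrict B) ≤ η := by
  have := isFiniteMeasure_restrict_of_isBounded hBb
  have hp' : (1 : ℝ≥0∞) ≤ p := by exact_mod_cast hp
  set K : ℝ≥0 := (2 ^ N) ^ (1 / (p : ℝ)) with hK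
  have hη' : ((η / (3 * (K + 1)) : ℝ≥0) : ℝ≥0∞) ≠ 0 := by
    rw [ENNReal.coe_ne_zero]; positivity
  obtain ⟨f, hfc, hfg, hf, hfp⟩ := hg.exists_hasCompactSupport_eLpNorm_sub_le
    ENNReal.coe_ne_top hη'
  set V : ℝ≥0 := (volume B).toNNReal ^ (1 / (p : ℝ)) with hV
  have hω : (0 : ℝ) < η / (3 * (V + 1)) := by positivity
  obtain ⟨δ, hδ, hfδ⟩ := Metric.uniformContinuous_iff.1
    (hfc.uniformContinuous_of_continuous hf) _ hω
  obtain ⟨D, hD⟩ := hBb.subset_closedBall b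
  have hD0 : 0 ≤ D := by
    have := hD (hb (Metric.mem_ball_self hr))
    simpa using this
  -- A point is displaced by at most ε D through the contraction and by less than ε r through the
  -- mollifier; the total must stay below the modulus δ of f.
  refine ⟨min (1 / 2) (δ / (D + r)), by positivity, fun ε hε hεε ψ hψ hψ0 hψ1 hψs => ?_⟩
  have hε2 : ε ≤ 1 / 2 := (hεε.trans_le (min_le_left _ _)).le
  have hεδ : ε * (D + r) < δ := by
    rw [← lt_div_iff₀ (by positivity)]
    exact hεε.trans_le (min_le_right _ _)
  have hsub : shrinkMollify B b ε ψ g - g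
      = (shrinkMollify B b ε ψ (g - f) + (shrinkMollify B b ε ψ f - f)) + (f - g) := by
    have hfi := (hfp.integrable_indicator hBo hBb hp).locallyIntegrable
    have : mollify ψ (B.indicator g) = mollify ψ (B.indicator (g - f))
        + mollify ψ (B.indicator f) := by
      have hgfi := ((hg.sub hfp).integrable_indicator hBo hBb hp).locallyIntegrable
      rw [mollify, mollify, mollify, ← ConvolutionExists.distrib_add
        (hψ.2.convolutionExists_left _ hψ.1.continuous hgfi)
        (hψ.2.convolutionExists_left _ hψ.1.continuous hfi), ← Set.indicator_add']
      simp
    ext x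
    simp only [shrinkMollify, this, Pi.sub_apply, Pi.add_apply, Function.comp_apply]
    ring
  have hsm : ∀ v : (Fin N → ℝ) → ℝ, MemLp v p (volume.restrict B) →
      AEStronglyMeasurable (shrinkMollify B b ε ψ v) (volume.restrict B) := fun v hv =>
    (((contDiff_mollify hψ (hv.integrable_indicator hBo hBb hp).locallyIntegrable).comp
      (contDiff_diagAffine _ _)).continuous.aestronglyMeasurable)
  have b1 : eLpNorm (shrinkMollify B b ε ψ (g - f)) p (volume.restrict B) ≤ (η / 3 : ℝ≥0) := by
    refine (eLpNorm_shrinkMollify_le hBo hB hb hε hε2 hp hψ.1.continuous hψ0 hψ1 hψs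
      (hg.sub hfp).1).trans ((mul_le_mul_right hfg _).trans ?_)
    rw [← ENNReal.coe_mul, ENNReal.coe_le_coe, ← hK]
    have : K * (η / (3 * (K + 1))) = η / 3 * (K / (K + 1)) := by field_simp
    rw [this]
    exact mul_le_of_le_one_right (by positivity) (div_le_one_of_le₀ (by simp) (by positivity))
  have b3 : eLpNorm (f - g) p (volume.restrict B) ≤ (η / 3 : ℝ≥0) := by
    rw [eLpNorm_sub_comm]
    refine hfg.trans (ENNReal.coe_le_coe.2 ?_)
    gcongr
    exact le_mul_of_one_le_right (by positivity) (by simp)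
  have b2 : eLpNorm (shrinkMollify B b ε ψ f - f) p (volume.restrict B) ≤ (η / 3 : ℝ≥0) := by
    have hpt : ∀ᵐ x ∂volume.restrict B, ‖(shrinkMollify B b ε ψ f - f) x‖
        ≤ η / (3 * (V + 1)) := by
      rw [ae_restrict_iff' hBo.measurableSet]
      refine .of_forall fun x hx => ?_
      rw [Pi.sub_apply, ← dist_eq_norm]
      refine dist_convolution_le (R := ε * r) hω.le hψs hψ0 hψ1
        (hfp.integrable_indicator hBo hBb hp).1 fun y hy => ?_
      set z := diagAffine (fun _ => 1 - ε) (ε • b) x with hz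
      have hy' : z - y ∈ Metric.ball (0 : Fin N → ℝ) (ε * r) := by
        rw [mem_ball_zero_iff, ← dist_eq_norm, dist_comm]; exact hy
      have hyB : y ∈ B := by
        have := shrink_sub_mem hB hb hε (by linarith) hx hy'
        rwa [sub_sub_cancel] at this
      rw [Set.indicator_of_mem hyB]
      refine (hfδ ?_).le
      have h1 : dist z x ≤ ε * D := by
        rw [hz, diagAffine_const, dist_eq_norm, show (1 - ε) • x + ε • b - x = ε • (b - x) by
          module, norm_smul, Real.norm_of_nonneg hε.le]
        gcongr
        have := hD hx
        rwa [Metric.mem_closedBall, dist_comm, dist_eq_norm] at this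
      calc dist y x ≤ dist y z + dist z x := dist_triangle _ _ _
        _ < ε * r + ε * D := add_lt_add_of_lt_of_le hy h1
        _ < δ := by linarith
    refine (eLpNorm_le_of_ae_bound hpt).trans ?_
    rw [Measure.restrict_apply_univ]
    have hVV : (volume B) ^ ((p : ℝ≥0∞).toReal)⁻¹ = (V : ℝ≥0∞) := by
      rw [hV, ENNReal.coe_rpow_of_nonneg _ (by positivity),
        ENNReal.coe_toNNReal hBb.measure_lt_top.ne]
      simp
    rw [hVV]
    have : ENNReal.ofReal (η / (3 * (V + 1))) = ((η / (3 * (V + 1)) : ℝ≥0) : ℝ≥0∞) := by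
      rw [ENNReal.ofReal]
      congr 1
      rw [Real.toNNReal_eq_iff_eq_coe (by positivity)]
      push_cast; rfl
    rw [this, ← ENNReal.coe_mul, ENNReal.coe_le_coe]
    have : V * (η / (3 * (V + 1))) = η / 3 * (V / (V + 1)) := by field_simp
    rw [this]
    exact mul_le_of_le_one_right (by positivity) (div_le_one_of_le₀ (by simp) (by positivity))
  rw [hsub]
  refine (eLpNorm_add_le (((hsm _ (hg.sub hfp)).add ((hsm _ hfp).sub hfp.1))) (hfp.1.sub hg.1)
    hp').trans ?_
  refine (add_le_add ((eLpNorm_add_le (hsm _ (hg.sub hfp)) ((hsm _ hfp).sub hfp.1) hp').trans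
    (add_le_add b1 b2)) b3).trans (le_of_eq ?_)
  rw [← ENNReal.coe_add, ← ENNReal.coe_add]
  congr 1
  ring

theorem finite_multiIndex_sum_le (N m : ℕ) : {γ : Fin N → ℕ | ∑ i, γ i ≤ m}.Finite := by
  refine (Set.finite_Iic (fun _ : Fin N => m)).subset fun γ hγ i => ?_
  exact (Finset.single_le_sum (f := γ) (fun _ _ => Nat.zero_le _) (Finset.mem_univ i)).trans hγ

theorem MemSobolev.hasWeakDeriv {N m : ℕ} {Ω : Set (Fin N → ℝ)} {p : ℝ≥0}
    {u : (Fin N → ℝ) → ℝ} (hu : MemSobolev Ω m p u) {γ : Fin N → ℕ} (hγ : ∑ i, γ i ≤ m) :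
    HasWeakDeriv Ω γ u (weakDeriv Ω γ u) :=
  let ⟨g, hg, _⟩ := hu γ hγ
  weakDeriv_spec ⟨g, hg⟩

theorem MemSobolev.memLp_weakDeriv {N m : ℕ} {Ω : Set (Fin N → ℝ)} (hΩ : IsOpen Ω) {p : ℝ≥0}
    {u : (Fin N → ℝ) → ℝ} (hu : MemSobolev Ω m p u) {γ : Fin N → ℕ} (hγ : ∑ i, γ i ≤ m) :
    MemLp (weakDeriv Ω γ u) p (volume.restrict Ω) :=
  let ⟨_, hg, hg'⟩ := hu γ hγ
  hg'.ae_eq (hg.weakDeriv_ae_eq hΩ).symm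

theorem weakDeriv_zero_ae_eq {N : ℕ} {Ω : Set (Fin N → ℝ)} (hΩ : IsOpen Ω)
    {u : (Fin N → ℝ) → ℝ} (hu : LocallyIntegrableOn u Ω) :
    weakDeriv Ω 0 u =ᵐ[volume.restrict Ω] u :=
  (HasWeakDeriv.zero_index hu).weakDeriv_ae_eq hΩ

theorem MemSobolev.locallyIntegrableOn {N m : ℕ} {Ω : Set (Fin N → ℝ)} {p : ℝ≥0}
    {u : (Fin N → ℝ) → ℝ} (hu : MemSobolev Ω m p u) : LocallyIntegrableOn u Ω :=
  (hu.hasWeakDeriv (γ := 0) (by simp)).1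

theorem MemSobolev.memLp {N m : ℕ} {Ω : Set (Fin N → ℝ)} (hΩ : IsOpen Ω) {p : ℝ≥0}
    {u : (Fin N → ℝ) → ℝ} (hu : MemSobolev Ω m p u) : MemLp u p (volume.restrict Ω) :=
  (hu.memLp_weakDeriv hΩ (γ := 0) (by simp)).ae_eq
    (weakDeriv_zero_ae_eq hΩ hu.locallyIntegrableOn)

/-- Functions smooth in the whole space are dense in `W^{m,p}(B)`. -/
theorem MemSobolev.exists_contDiff_approx {N m : ℕ} {B : Set (Fin N → ℝ)} (hBo : IsOpen B)
    (hB : Convex ℝ B) (hBb : Bornology.IsBounded B) (hBn : B.Nonempty) {p : ℝ≥0} (hp : 1 ≤ p)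
    {u : (Fin N → ℝ) → ℝ} (hu : MemSobolev B m p u) {η : ℝ≥0} (hη : 0 < η) :
    ∃ f, ContDiff ℝ ∞ f ∧ ∀ γ : Fin N → ℕ, ∑ i, γ i ≤ m →
      eLpNorm (multiDeriv γ f - weakDeriv B γ u) p (volume.restrict B) ≤ η := by
  have hp' : (1 : ℝ≥0∞) ≤ p := by exact_mod_cast hp
  obtain ⟨b, hbB⟩ := hBn
  obtain ⟨r, hr, hb⟩ := Metric.isOpen_iff.1 hBo b hbB
  have ev1 : ∀ γ ∈ {γ : Fin N → ℕ | ∑ i, γ i ≤ m}, ∀ᶠ ε in nhdsWithin (0 : ℝ) (Set.Ioi 0),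
      ∀ ψ, IsTestFunction Set.univ ψ → (∀ t, 0 ≤ ψ t) →
      ∫ t, ψ t = 1 → Function.support ψ ⊆ Metric.ball (0 : Fin N → ℝ) (ε * r) →
      eLpNorm (shrinkMollify B b ε ψ (weakDeriv B γ u) - weakDeriv B γ u) p (volume.restrict B)
        ≤ (η / 2 : ℝ≥0) := by
    intro γ hγ
    obtain ⟨ε₀, hε₀, H⟩ := shrinkMollify_approx hBo hB hBb hr hb hp (hu.memLp_weakDeriv hBo hγ)
      (half_pos hη)
    filter_upwards [Ioo_mem_nhdsGT hε₀] with ε hε using H ε hε.1 hε.2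
  -- By the chain rule the contraction multiplies D^γ by (1 - ε)^|γ|, so this factor must also be
  -- close to 1.
  have ev2 : ∀ γ ∈ {γ : Fin N → ℕ | ∑ i, γ i ≤ m}, ∀ᶠ ε in nhdsWithin (0 : ℝ) (Set.Ioi 0),
      |(1 - ε) ^ (∑ i, γ i) - 1| * (eLpNorm (weakDeriv B γ u) p (volume.restrict B)).toReal
        < (η / 2 : ℝ≥0) := by
    intro γ hγ
    have hc : Continuous fun ε : ℝ => |(1 - ε) ^ (∑ i, γ i) - 1| *
        (eLpNorm (weakDeriv B γ u) p (volume.restrict B)).toReal := by fun_prop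
    have := (hc.tendsto 0).mono_left (nhdsWithin_le_nhds (s := Set.Ioi 0))
    refine this.eventually_lt_const ?_
    simpa using hη
  -- Only finitely many multi-indices occur, so one ε, and hence one smooth function, serves for all
  -- of them.
  obtain ⟨ε, h1, h2, hε, hε1⟩ := (((finite_multiIndex_sum_le N m).eventually_all.2 ev1).and
    (((finite_multiIndex_sum_le N m).eventually_all.2 ev2).and
      (Ioo_mem_nhdsGT (zero_lt_one (α := ℝ))))).exists
  let Ψ : ContDiffBump (0 : Fin N → ℝ) :=
    ⟨ε * r / 4, ε * r / 2, by positivity, by have : 0 < ε * r := by positivity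
                                             linarith⟩
  let ψ := Ψ.normed volume
  have hψ : IsTestFunction Set.univ ψ :=
    ⟨Ψ.contDiff_normed, Ψ.hasCompactSupport_normed, Set.subset_univ _⟩
  have hψ1 : ∫ t, ψ t = 1 := Ψ.integral_normed
  have hts : tsupport ψ ⊆ Metric.ball (0 : Fin N → ℝ) (ε * r) := by
    rw [Ψ.tsupport_normed_eq]
    refine Metric.closedBall_subset_ball ?_
    have : 0 < ε * r := by positivity
    change ε * r / 2 < ε * r
    linarith
  have hui := ((hu.memLp hBo).integrable_indicator hBo hBb hp).locallyIntegrable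
  have hsmooth := contDiff_mollify hψ hui
  refine ⟨shrinkMollify B b ε ψ u, hsmooth.comp (contDiff_diagAffine _ _), fun γ hγ => ?_⟩
  have hg := hu.memLp_weakDeriv hBo hγ
  set g := weakDeriv B γ u with hgdef
  have e : multiDeriv γ (shrinkMollify B b ε ψ u) - g =ᵐ[volume.restrict B]
      (1 - ε) ^ (∑ i, γ i) • (shrinkMollify B b ε ψ g - g) + ((1 - ε) ^ (∑ i, γ i) - 1) • g := by
    rw [Filter.EventuallyEq, ae_restrict_iff' hBo.measurableSet]
    refine .of_forall fun x hx => ?_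
    rw [shrinkMollify, multiDeriv_comp_diagAffine γ hsmooth, Finset.prod_pow_eq_pow_sum,
      multiDeriv_mollify γ hψ hui]
    simp only [Pi.sub_apply, Pi.smul_apply, Function.comp_apply, Pi.add_apply, smul_eq_mul]
    rw [mollify_multiDeriv hBo (hu.hasWeakDeriv hγ) hψ fun t ht =>
      shrink_sub_mem hB hb hε hε1.le hx (hts ht)]
    simp only [shrinkMollify, Function.comp_apply, ← hgdef]
    ring
  rw [eLpNorm_congr_ae e]
  have hsm : AEStronglyMeasurable (shrinkMollify B b ε ψ g) (volume.restrict B) :=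
    (((contDiff_mollify hψ (hg.integrable_indicator hBo hBb hp).locallyIntegrable).comp
      (contDiff_diagAffine _ _)).continuous.aestronglyMeasurable)
  refine (eLpNorm_add_le ((hsm.sub hg.1).const_smul _) (hg.1.const_smul _) hp').trans ?_
  rw [eLpNorm_const_smul, eLpNorm_const_smul]
  have b1 : ‖(1 - ε) ^ (∑ i, γ i)‖ₑ * eLpNorm (shrinkMollify B b ε ψ g - g) p (volume.restrict B)
      ≤ (η / 2 : ℝ≥0) := by
    refine (mul_le_of_le_one_left' ?_).trans
      (h1 γ hγ ψ hψ Ψ.nonneg_normed hψ1 ((subset_tsupport _).trans hts))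
    rw [Real.enorm_eq_ofReal (pow_nonneg (by linarith) _), ENNReal.ofReal_le_one]
    exact pow_le_one₀ (by linarith) (by linarith)
  have b2 : ‖(1 - ε) ^ (∑ i, γ i) - 1‖ₑ * eLpNorm g p (volume.restrict B) ≤ (η / 2 : ℝ≥0) := by
    have := (h2 γ hγ).le
    rw [← ENNReal.ofReal_toReal hg.2.ne, Real.enorm_eq_ofReal_abs,
      ← ENNReal.ofReal_mul (abs_nonneg _)]
    refine (ENNReal.ofReal_le_ofReal this).trans (le_of_eq ?_)
    exact ENNReal.ofReal_coe_nnreal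
  refine (add_le_add b1 b2).trans (le_of_eq ?_)
  rw [← ENNReal.coe_add, add_halves]

/-! ### The inequalities of Friedrichs and Poincaré for smooth functions -/

theorem enorm_coe_nnreal (c : ℝ≥0) : ‖(c : ℝ)‖ₑ = c := by
  rw [Real.enorm_eq_ofReal (NNReal.coe_nonneg c), ENNReal.ofReal_coe_nnreal]

theorem enorm_sub_le_lintegral_fderiv {N : ℕ} {f : (Fin N → ℝ) → ℝ} (hf : ContDiff ℝ ∞ f)
    (x v : Fin N → ℝ) :
    ‖f (x + v) - f x‖ₑ ≤ ∫⁻ t in Set.Icc (0 : ℝ) 1, ‖fderiv ℝ f (x + t • v) v‖ₑ := by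
  have hd : ∀ t ∈ Set.uIcc (0 : ℝ) 1,
      HasDerivAt (fun t : ℝ => f (x + t • v)) (fderiv ℝ f (x + t • v) v) t := by
    intro t _
    have h1 := (hf.differentiable (by simp) (x + t • v)).hasFDerivAt
    have h2 : HasDerivAt (fun t : ℝ => x + t • v) v t := by
      simpa using ((hasDerivAt_id t).smul_const v).const_add x
    exact h1.comp_hasDerivAt t h2
  have hc : Continuous fun t : ℝ => fderiv ℝ f (x + t • v) v := by
    have := (hf.fderiv_right (m := ∞) (by simp)).continuous
    fun_prop
  have := intervalIntegral.integral_eq_sub_of_hasDerivAt hd (hc.intervalIntegrable _ _)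
  simp only [one_smul, zero_smul, add_zero] at this
  rw [← this, intervalIntegral.integral_of_le zero_le_one, ← integral_Icc_eq_integral_Ioc]
  exact enorm_integral_le_lintegral_enorm _

theorem isProbabilityMeasure_Icc_zero_one :
    IsProbabilityMeasure ((volume : Measure ℝ).restrict (Set.Icc 0 1)) :=
  ⟨by simp⟩

/-- A translation by the full side length L in the direction i leaves the cube, so φ vanishes at the
end of the segment and the fundamental theorem of calculus bounds φ at its start. Translations
preserve the measure, so averaging over the segment costs no constant besides L. -/
theorem IsTestFunction.eLpNorm_le_partialDeriv {N : ℕ} {a : Fin N → ℝ} {L : ℝ≥0}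
    {φ : (Fin N → ℝ) → ℝ} (h : IsTestFunction (cube a L) φ) {p : ℝ≥0} (hp : 1 ≤ p) (i : Fin N) :
    eLpNorm φ p (volume.restrict (cube a L))
      ≤ L * eLpNorm (_root_.partialDeriv i φ) p (volume.restrict (cube a L)) := by
  have hr : ∀ ψ, IsTestFunction (cube a L) ψ →
      eLpNorm ψ p (volume.restrict (cube a L)) = eLpNorm ψ p volume := fun ψ hψ =>
    eLpNorm_restrict_eq_of_support_subset ((subset_tsupport _).trans hψ.3)
  rw [hr _ h, hr _ (h.partialDeriv i)]
  have := isProbabilityMeasure_Icc_zero_one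
  let v : Fin N → ℝ := (L : ℝ) • Pi.single i 1
  let A : (Fin N → ℝ) × ℝ → (Fin N → ℝ) := fun q => q.1 + q.2 • v
  have hA : Measurable A := by fun_prop
  have hK : ((volume : Measure (Fin N → ℝ)).prod (volume.restrict (Set.Icc 0 1))).map A
      ≤ (1 : ℝ≥0) • (volume : Measure (Fin N → ℝ)) := by
    refine map_prod_le_of_forall hA (.of_forall fun t => ?_)
    simp only [A]
    rw [map_add_right_eq_self, one_smul]
  have key := eLpNorm_le_of_le_average hA hK hp (G := φ) (g := _root_.partialDeriv i φ)
    (h.partialDeriv i).1.continuous.aestronglyMeasurable L (by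
    refine .of_forall fun x => ?_
    by_cases hx : x ∈ cube a L
    · have hxv : φ (x + v) = 0 := by
        refine image_eq_zero_of_notMem_tsupport fun hc => ?_
        have h1 := h.3 hc i
        have h2 := hx i
        simp only [v, Pi.add_apply, Pi.smul_apply, Pi.single_eq_same, smul_eq_mul, mul_one] at h1
        rw [abs_lt] at h1 h2
        linarith
      have := enorm_sub_le_lintegral_fderiv h.1 x v
      rw [hxv, zero_sub, enorm_neg] at this
      refine this.trans (le_of_eq ?_)
      rw [← lintegral_const_mul' _ _ ENNReal.coe_ne_top]
      refine lintegral_congr fun t => ?_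
      simp only [v, map_smul, smul_eq_mul, enorm_mul, A, _root_.partialDeriv]
      rw [enorm_coe_nnreal]
    · rw [image_eq_zero_of_notMem_tsupport fun hc => hx (h.3 hc)]
      simp)
  simpa using key

/-- For fixed y and t the map contracts x by 1 - t, which degenerates as t → 1. For fixed x and t it
contracts y by t, which degenerates as t → 0. Each half of the interval uses the variable whose
factor is at least 1/2, at the cost of 2^N; for t ≥ 1/2 the normalization of the measure in y is
absorbed by the integration in x. -/
theorem map_segment_le {N : ℕ} {B : Set (Fin N → ℝ)} (hBo : IsOpen B) (hB : Convex ℝ B)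
    (hBb : Bornology.IsBounded B) (hBn : B.Nonempty) :
    ((volume.restrict B).prod
        (((volume B)⁻¹ • volume.restrict B).prod (volume.restrict (Set.Icc (0 : ℝ) 1)))).map
      (fun q : (Fin N → ℝ) × (Fin N → ℝ) × ℝ => q.1 + q.2.2 • (q.2.1 - q.1))
      ≤ (2 ^ N : ℝ≥0) • volume.restrict B := by
  have hfin := isFiniteMeasure_restrict_of_isBounded hBb
  have hB0 : volume B ≠ 0 := (hBo.measure_pos _ hBn).ne'
  have hB1 : volume B ≠ ⊤ := hBb.measure_lt_top.ne
  have hfin' : IsProbabilityMeasure ((volume B)⁻¹ • volume.restrict B) :=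
    ⟨by simp [ENNReal.inv_mul_cancel hB0 hB1]⟩
  have hprob := isProbabilityMeasure_Icc_zero_one
  set A : (Fin N → ℝ) × (Fin N → ℝ) × ℝ → (Fin N → ℝ) :=
    fun q => q.1 + q.2.2 • (q.2.1 - q.1) with hAdef
  have hA : Measurable A := by fun_prop
  -- contraction towards a point of `B`, by a factor between `1/2` and `1`
  have hcontr : ∀ c : ℝ, 1 / 2 ≤ c → c ≤ 1 → ∀ y ∈ B, ∀ s, MeasurableSet s →
      volume.restrict B {x | c • x + (1 - c) • y ∈ s}
        ≤ (2 ^ N : ℝ≥0) * volume.restrict B s := by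
    intro c hc hc1 y hy s hs
    have hmaps : Set.MapsTo (diagAffine (fun _ => c) ((1 - c) • y)) B B := fun x hx => by
      rw [diagAffine_const]; exact hB hx hy (by linarith) (by linarith) (by ring)
    have hle : (‖∏ _i : Fin N, c‖₊⁻¹ : ℝ≥0) ≤ 2 ^ N := by
      rw [Finset.prod_const, Finset.card_univ, Fintype.card_fin, nnnorm_pow, ← inv_pow]
      gcongr
      rw [← NNReal.coe_le_coe]
      push_cast
      rw [Real.norm_of_nonneg (by linarith), inv_le_comm₀ (by linarith) (by norm_num)]
      norm_num at *; linarith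
    have h1 := map_diagAffine_restrict_le (fun _ => by linarith : ∀ _ : Fin N, c ≠ 0)
      hBo.measurableSet hmaps s
    rw [Measure.map_apply (measurable_diagAffine _ _) hs, Measure.smul_apply] at h1
    simp only [Set.preimage, diagAffine_const] at h1
    exact h1.trans (mul_le_mul_left (ENNReal.coe_le_coe.2 hle) _)
  rw [Measure.le_iff]
  intro s hs
  have hS : MeasurableSet (A ⁻¹' s) := hA hs
  have hm : Measurable fun z : (Fin N → ℝ) × ℝ =>
      volume.restrict B ((fun x => (x, z)) ⁻¹' (A ⁻¹' s)) := measurable_measure_prodMk_right hS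
  rw [Measure.map_apply hA hs, Measure.prod_apply_symm hS, lintegral_prod_symm _ hm.aemeasurable,
    Measure.smul_apply]
  calc _ ≤ ∫⁻ t in Set.Icc (0 : ℝ) 1, (2 ^ N : ℝ≥0) * volume.restrict B s := ?_
    _ = _ := by simp
  refine setLIntegral_mono measurable_const fun t ht => ?_
  have hmem : ∀ᵐ y ∂(volume B)⁻¹ • volume.restrict B, y ∈ B :=
    Measure.ae_smul_measure (ae_restrict_mem hBo.measurableSet) _
  rcases le_total t (1 / 2) with h | h
  · calc _ ≤ ∫⁻ _, (2 ^ N : ℝ≥0) * volume.restrict B s ∂((volume B)⁻¹ • volume.restrict B) := by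
          refine lintegral_mono_ae ?_
          filter_upwards [hmem] with y hy
          have := hcontr (1 - t) (by linarith) (by linarith [ht.1]) y hy s hs
          refine le_trans (le_of_eq ?_) this
          congr 1
          ext x
          simp only [Set.mem_preimage, hAdef, Set.mem_ofPred_eq]
          rw [show x + t • (y - x) = (1 - t) • x + (1 - (1 - t)) • y by module]
      _ = _ := by rw [lintegral_const, measure_univ, mul_one]
  · have hS' : MeasurableSet {q : (Fin N → ℝ) × (Fin N → ℝ) | A (q.1, q.2, t) ∈ s} := by
      have : Measurable fun q : (Fin N → ℝ) × (Fin N → ℝ) => A (q.1, q.2, t) := by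
        simp only [hAdef]; fun_prop
      exact this hs
    have e := Measure.prod_apply_symm (μ := volume.restrict B)
      (ν := (volume B)⁻¹ • volume.restrict B) hS'
    rw [Measure.prod_apply hS'] at e
    refine le_trans (le_of_eq e.symm) ?_
    calc _ ≤ ∫⁻ _, (volume B)⁻¹ * ((2 ^ N : ℝ≥0) * volume.restrict B s) ∂volume.restrict B := by
          refine lintegral_mono_ae ?_
          filter_upwards [ae_restrict_mem hBo.measurableSet] with x hx
          have := hcontr t h ht.2 x hx s hs
          rw [Measure.smul_apply, smul_eq_mul]
          refine mul_le_mul_right (le_trans (le_of_eq ?_) this) _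
          congr 1
          ext y
          simp only [Set.mem_preimage, hAdef, Set.mem_ofPred_eq]
          rw [show x + t • (y - x) = t • y + (1 - t) • x by module]
      _ = _ := by
        rw [lintegral_const, Measure.restrict_apply_univ, mul_comm, ← mul_assoc,
          ENNReal.mul_inv_cancel hB0 hB1, one_mul]

theorem enorm_fderiv_apply_le {N : ℕ} (f : (Fin N → ℝ) → ℝ) (z v : Fin N → ℝ) {D : ℝ≥0}
    (hv : ‖v‖ ≤ D) : ‖fderiv ℝ f z v‖ₑ ≤ D * ‖∑ i, ‖partialDeriv i f z‖‖ₑ := by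
  have h1 : ‖fderiv ℝ f z v‖ ≤ D * ∑ i, ‖partialDeriv i f z‖ := by
    have e : v = ∑ i, v i • (Pi.single i 1 : Fin N → ℝ) := pi_eq_sum_univ' v
    rw [e, map_sum, Finset.mul_sum]
    refine (norm_sum_le _ _).trans (Finset.sum_le_sum fun i _ => ?_)
    rw [map_smul, norm_smul]
    exact mul_le_mul_of_nonneg_right ((norm_le_pi_norm v i).trans hv) (norm_nonneg _)
  have h2 : ‖fderiv ℝ f z v‖ ≤ ‖(D : ℝ) * ∑ i, ‖partialDeriv i f z‖‖ := h1.trans (le_abs_self _)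
  have h3 := enorm_le_iff_norm_le.2 h2
  rwa [enorm_mul, enorm_coe_nnreal] at h3

/-- Poincaré's inequality for smooth functions on a bounded convex open set. -/
theorem exists_poincare_const {N : ℕ} {B : Set (Fin N → ℝ)} (hBo : IsOpen B) (hB : Convex ℝ B)
    (hBb : Bornology.IsBounded B) (hBn : B.Nonempty) {p : ℝ≥0} (hp : 1 ≤ p) :
    ∃ C : ℝ≥0, ∀ f : (Fin N → ℝ) → ℝ, ContDiff ℝ ∞ f → ∃ c : ℝ,
      eLpNorm (fun x => f x - c) p (volume.restrict B)
        ≤ C * ∑ i, eLpNorm (partialDeriv i f) p (volume.restrict B) := by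
  have hfin := isFiniteMeasure_restrict_of_isBounded hBb
  have hB0 : volume B ≠ 0 := (hBo.measure_pos _ hBn).ne'
  have hB1 : volume B ≠ ⊤ := hBb.measure_lt_top.ne
  have hfin' : IsProbabilityMeasure ((volume B)⁻¹ • volume.restrict B) :=
    ⟨by simp [ENNReal.inv_mul_cancel hB0 hB1]⟩
  have hprob := isProbabilityMeasure_Icc_zero_one
  obtain ⟨D, hD⟩ := hBb.exists_norm_le
  obtain ⟨b, hb⟩ := hBn
  have hD0 : 0 ≤ D := (norm_nonneg b).trans (hD b hb)
  -- Bounds the length of every segment between points of B.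
  let D' : ℝ≥0 := (2 * D).toNNReal
  have hD' : (D' : ℝ) = 2 * D := Real.coe_toNNReal _ (by positivity)
  refine ⟨D' * (2 ^ N) ^ (1 / (p : ℝ)), fun f hf => ?_⟩
  set μ := (volume B)⁻¹ • volume.restrict B with hμ
  have hfi : Integrable f μ := by
    refine Integrable.smul_measure ?_ (by simp [hB0])
    have : IntegrableOn f (closure B) :=
      hf.continuous.continuousOn.integrableOn_compact hBb.isCompact_closure
    exact this.mono_set subset_closure
  -- The constant is the mean of f over B, so f(x) - c is the mean of f(x) - f(y) over y, and each
  -- difference is an integral along the segment from x to y.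
  refine ⟨∫ y, f y ∂μ, ?_⟩
  let A : (Fin N → ℝ) × (Fin N → ℝ) × ℝ → (Fin N → ℝ) := fun q => q.1 + q.2.2 • (q.2.1 - q.1)
  have hA : Continuous A := by fun_prop
  have hd : ∀ i, Continuous (partialDeriv i f) := fun i => (contDiff_partialDeriv hf i).continuous
  have hgc : Continuous fun z => ∑ i, ‖partialDeriv i f z‖ :=
    continuous_finsetSum _ fun i _ => (hd i).norm
  have key := eLpNorm_le_of_le_average hA.measurable
    (map_segment_le hBo hB hBb ⟨b, hb⟩) hp (G := fun x => f x - ∫ y, f y ∂μ)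
    (g := fun z => ∑ i, ‖partialDeriv i f z‖) hgc.aestronglyMeasurable D' (by
    filter_upwards [ae_restrict_mem hBo.measurableSet] with x hx
    have e : f x - ∫ y, f y ∂μ = ∫ y, (f x - f y) ∂μ := by
      rw [integral_sub (integrable_const _) hfi]; simp
    have hgA : Continuous fun z : (Fin N → ℝ) × ℝ => ‖∑ i, ‖partialDeriv i f (A (x, z))‖‖ₑ :=
      (hgc.comp (hA.comp (by fun_prop : Continuous fun z : (Fin N → ℝ) × ℝ => (x, z)))).enorm
    rw [e, lintegral_prod _ hgA.measurable.aemeasurable, ← lintegral_const_mul' _ _ ENNReal.coe_ne_top]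
    refine (enorm_integral_le_lintegral_enorm _).trans (lintegral_mono_ae ?_)
    have hmem : ∀ᵐ y ∂μ, y ∈ B :=
      Measure.ae_smul_measure (ae_restrict_mem hBo.measurableSet) _
    filter_upwards [hmem] with y hy
    have h1 := enorm_sub_le_lintegral_fderiv hf x (y - x)
    rw [add_sub_cancel, ← enorm_neg, neg_sub] at h1
    refine h1.trans ?_
    rw [← lintegral_const_mul' _ _ ENNReal.coe_ne_top]
    refine lintegral_mono fun t => ?_
    refine enorm_fderiv_apply_le f _ _ ?_
    rw [hD']
    refine (norm_sub_le _ _).trans ?_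
    linarith [hD x hx, hD y hy])
  refine key.trans (mul_le_mul_right ?_ _)
  have e : (fun z => ∑ i, ‖partialDeriv i f z‖) = ∑ i, fun z => ‖partialDeriv i f z‖ := by
    ext z; simp
  rw [e]
  refine (eLpNorm_sum_le (fun i _ => (hd i).norm.aestronglyMeasurable)
    (by exact_mod_cast hp)).trans (le_of_eq ?_)
  exact Finset.sum_congr rfl fun i _ => eLpNorm_norm _

/-! ### The seminorms `‖∇^j u‖` -/

theorem mem_multiIndices {N j : ℕ} {γ : Fin N → ℕ} :
    γ ∈ Finset.piAntidiag (Finset.univ : Finset (Fin N)) j ↔ ∑ i, γ i = j := by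
  simp [Finset.mem_piAntidiag]

theorem gradNorm_eq {N j : ℕ} {Ω : Set (Fin N → ℝ)} (hΩ : IsOpen Ω) {p : ℝ≥0}
    {u : (Fin N → ℝ) → ℝ} {g : (Fin N → ℕ) → (Fin N → ℝ) → ℝ}
    (h : ∀ γ, ∑ i, γ i = j → HasWeakDeriv Ω γ u (g γ)) :
    gradNorm Ω j p u = ∑ γ ∈ Finset.piAntidiag (Finset.univ : Finset (Fin N)) j,
      eLpNorm (g γ) p (volume.restrict Ω) :=
  Finset.sum_congr rfl fun γ hγ =>
    eLpNorm_congr_ae ((h γ (mem_multiIndices.1 hγ)).weakDeriv_ae_eq hΩ)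

theorem gradNorm_eq_of_contDiff {N : ℕ} {Ω : Set (Fin N → ℝ)} (hΩ : IsOpen Ω) (j : ℕ) (p : ℝ≥0)
    {f : (Fin N → ℝ) → ℝ} (hf : ContDiff ℝ ∞ f) :
    gradNorm Ω j p f = ∑ γ ∈ Finset.piAntidiag (Finset.univ : Finset (Fin N)) j,
      eLpNorm (multiDeriv γ f) p (volume.restrict Ω) :=
  gradNorm_eq hΩ fun γ _ => hasWeakDeriv_multiDeriv Ω γ hf

theorem HasWeakDeriv.eLpNorm_le_gradNorm {N : ℕ} {Ω : Set (Fin N → ℝ)} (hΩ : IsOpen Ω)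
    {p : ℝ≥0} {γ : Fin N → ℕ} {u g : (Fin N → ℝ) → ℝ} (h : HasWeakDeriv Ω γ u g) :
    eLpNorm g p (volume.restrict Ω) ≤ gradNorm Ω (∑ i, γ i) p u := by
  rw [← eLpNorm_congr_ae (h.weakDeriv_ae_eq hΩ)]
  exact Finset.single_le_sum (f := fun γ => eLpNorm (weakDeriv Ω γ u) p (volume.restrict Ω))
    (fun _ _ => zero_le) (mem_multiIndices.2 rfl)

theorem gradNorm_le_sobolevNorm {N j m : ℕ} (Ω : Set (Fin N → ℝ)) (hj : j ≤ m) (p : ℝ≥0)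
    (u : (Fin N → ℝ) → ℝ) : gradNorm Ω j p u ≤ sobolevNorm Ω m p u :=
  Finset.single_le_sum (f := fun j => gradNorm Ω j p u) (fun _ _ => zero_le)
    (Finset.mem_range.2 (by omega))

theorem HasWeakDeriv.eLpNorm_le_sobolevNorm {N m : ℕ} {Ω : Set (Fin N → ℝ)} (hΩ : IsOpen Ω)
    {p : ℝ≥0} {γ : Fin N → ℕ} (hγ : ∑ i, γ i ≤ m) {u g : (Fin N → ℝ) → ℝ}
    (h : HasWeakDeriv Ω γ u g) :
    eLpNorm g p (volume.restrict Ω) ≤ sobolevNorm Ω m p u :=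
  (h.eLpNorm_le_gradNorm hΩ).trans (gradNorm_le_sobolevNorm Ω hγ p u)

theorem sobolevNorm_mono_order {N n m : ℕ} (Ω : Set (Fin N → ℝ)) (h : n ≤ m) (p : ℝ≥0)
    (u : (Fin N → ℝ) → ℝ) : sobolevNorm Ω n p u ≤ sobolevNorm Ω m p u :=
  Finset.sum_le_sum_of_subset (Finset.range_mono (by omega))

theorem MemSobolev.mono_order {N n m : ℕ} {Ω : Set (Fin N → ℝ)} {p : ℝ≥0}
    {u : (Fin N → ℝ) → ℝ} (hu : MemSobolev Ω m p u) (h : n ≤ m) : MemSobolev Ω n p u :=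
  fun γ hγ => hu γ (hγ.trans h)

theorem MemSobolev.mono_set {N m : ℕ} {Ω Ω' : Set (Fin N → ℝ)} (h : Ω' ⊆ Ω) {p : ℝ≥0}
    {u : (Fin N → ℝ) → ℝ} (hu : MemSobolev Ω m p u) : MemSobolev Ω' m p u := fun γ hγ =>
  let ⟨g, hg, hg'⟩ := hu γ hγ
  ⟨g, hg.mono h, hg'.mono_measure (Measure.restrict_mono h le_rfl)⟩

theorem MemSobolev.sub {N m : ℕ} {Ω : Set (Fin N → ℝ)} (hΩ : IsOpen Ω) {p : ℝ≥0}
    {u v : (Fin N → ℝ) → ℝ} (hu : MemSobolev Ω m p u) (hv : MemSobolev Ω m p v) :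
    MemSobolev Ω m p (u - v) := fun γ hγ =>
  let ⟨g, hg, hg'⟩ := hu γ hγ
  let ⟨h, hh, hh'⟩ := hv γ hγ
  ⟨g - h, hg.sub hΩ hh, hg'.sub hh'⟩

theorem Continuous.memLp_restrict_of_isBounded {N : ℕ} {Ω : Set (Fin N → ℝ)}
    (hΩ : Bornology.IsBounded Ω) (p : ℝ≥0) {f : (Fin N → ℝ) → ℝ} (hf : Continuous f) :
    MemLp f p (volume.restrict Ω) := by
  have := isFiniteMeasure_restrict_of_isBounded hΩ
  obtain ⟨C, hC⟩ := hΩ.isCompact_closure.exists_bound_of_continuousOn hf.continuousOn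
  refine MemLp.of_bound hf.aestronglyMeasurable C ?_
  exact ae_restrict_of_ae_restrict_of_subset subset_closure
    ((ae_restrict_iff' isClosed_closure.measurableSet).2 (.of_forall hC))

theorem memSobolev_of_contDiff {N : ℕ} {Ω : Set (Fin N → ℝ)} (hΩb : Bornology.IsBounded Ω)
    (m : ℕ) (p : ℝ≥0) {f : (Fin N → ℝ) → ℝ} (hf : ContDiff ℝ ∞ f) : MemSobolev Ω m p f :=
  fun γ _ => ⟨_, hasWeakDeriv_multiDeriv Ω γ hf,
    (contDiff_multiDeriv hf γ).continuous.memLp_restrict_of_isBounded hΩb p⟩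

theorem gradNorm_sub_le {N j m : ℕ} {Ω : Set (Fin N → ℝ)} (hΩ : IsOpen Ω) {p : ℝ≥0} (hp : 1 ≤ p)
    (hj : j ≤ m) {u v : (Fin N → ℝ) → ℝ} (hu : MemSobolev Ω m p u) (hv : MemSobolev Ω m p v) :
    gradNorm Ω j p (u - v) ≤ gradNorm Ω j p u + gradNorm Ω j p v := by
  rw [gradNorm_eq hΩ (u := u - v) (fun γ hγ => (hu.hasWeakDeriv (hγ.trans_le hj)).sub hΩ
    (hv.hasWeakDeriv (hγ.trans_le hj))), gradNorm, gradNorm, ← Finset.sum_add_distrib]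
  refine Finset.sum_le_sum fun γ hγ => ?_
  have hγ' := (mem_multiIndices.1 hγ).trans_le hj
  exact eLpNorm_sub_le (hu.memLp_weakDeriv hΩ hγ').1 (hv.memLp_weakDeriv hΩ hγ').1
    (by exact_mod_cast hp)

theorem gradNorm_add_le {N j m : ℕ} {Ω : Set (Fin N → ℝ)} (hΩ : IsOpen Ω) {p : ℝ≥0} (hp : 1 ≤ p)
    (hj : j ≤ m) {u v : (Fin N → ℝ) → ℝ} (hu : MemSobolev Ω m p u) (hv : MemSobolev Ω m p v) :
    gradNorm Ω j p (u + v) ≤ gradNorm Ω j p u + gradNorm Ω j p v := by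
  rw [gradNorm_eq hΩ (u := u + v) (fun γ hγ => (hu.hasWeakDeriv (hγ.trans_le hj)).add hΩ
    (hv.hasWeakDeriv (hγ.trans_le hj))), gradNorm, gradNorm, ← Finset.sum_add_distrib]
  refine Finset.sum_le_sum fun γ hγ => ?_
  have hγ' := (mem_multiIndices.1 hγ).trans_le hj
  exact eLpNorm_add_le (hu.memLp_weakDeriv hΩ hγ').1 (hv.memLp_weakDeriv hΩ hγ').1
    (by exact_mod_cast hp)

theorem gradNorm_congr {N j m : ℕ} {Ω : Set (Fin N → ℝ)} (hΩ : IsOpen Ω) {p : ℝ≥0} (hj : j ≤ m)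
    {u v : (Fin N → ℝ) → ℝ} (hu : MemSobolev Ω m p u) (huv : u =ᵐ[volume.restrict Ω] v) :
    gradNorm Ω j p v = gradNorm Ω j p u :=
  gradNorm_eq hΩ fun _ hγ => (hu.hasWeakDeriv (hγ.trans_le hj)).congr huv (.refl _ _)

theorem gradNorm_mono_set {N j m : ℕ} {Ω Ω' : Set (Fin N → ℝ)} (hΩ' : IsOpen Ω') (h : Ω' ⊆ Ω)
    {p : ℝ≥0} (hj : j ≤ m) {u : (Fin N → ℝ) → ℝ} (hu : MemSobolev Ω m p u) :
    gradNorm Ω' j p u ≤ gradNorm Ω j p u := by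
  rw [gradNorm_eq hΩ' fun _ hγ => (hu.hasWeakDeriv (hγ.trans_le hj)).mono h, gradNorm]
  exact Finset.sum_le_sum fun _ _ => eLpNorm_mono_measure _ (Measure.restrict_mono h le_rfl)

theorem gradNorm_ne_top {N j m : ℕ} {Ω : Set (Fin N → ℝ)} (hΩ : IsOpen Ω) {p : ℝ≥0} (hj : j ≤ m)
    {u : (Fin N → ℝ) → ℝ} (hu : MemSobolev Ω m p u) : gradNorm Ω j p u ≠ ⊤ :=
  ENNReal.sum_ne_top.2 fun _ hγ =>
    (hu.memLp_weakDeriv hΩ ((mem_multiIndices.1 hγ).trans_le hj)).2.ne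

theorem gradNorm_zero {N m : ℕ} {Ω : Set (Fin N → ℝ)} (hΩ : IsOpen Ω) {p : ℝ≥0}
    {u : (Fin N → ℝ) → ℝ} (hu : MemSobolev Ω m p u) :
    gradNorm Ω 0 p u = eLpNorm u p (volume.restrict Ω) := by
  rw [gradNorm, Finset.piAntidiag_zero, Finset.sum_singleton]
  exact eLpNorm_congr_ae (weakDeriv_zero_ae_eq hΩ hu.locallyIntegrableOn)

/-! ### Friedrichs' inequality in `W^{m,p}_0` -/

theorem isBounded_cube {N : ℕ} (a : Fin N → ℝ) {ℓ : ℝ} (hℓ : 0 < ℓ) :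
    Bornology.IsBounded (cube a ℓ) :=
  Metric.isBounded_closedBall.subset (cube_subset_closedBall a ℓ hℓ)

/-- Every step gains one order by differentiating in a single direction; the first coordinate will
do, and it exists because N > 0. -/
theorem exists_friedrichs_const {N : ℕ} (hN : 0 < N) (a : Fin N → ℝ) (L : ℝ≥0) {p : ℝ≥0}
    (hp : 1 ≤ p) (j n : ℕ) : ∃ C : ℝ≥0, ∀ φ, IsTestFunction (cube a L) φ →
      gradNorm (cube a L) j p φ ≤ C * gradNorm (cube a L) (j + n) p φ := by
  have hΩ := isOpen_cube a L
  induction n with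
  | zero => exact ⟨1, fun φ _ => by simp⟩
  | succ n ih =>
    obtain ⟨C, hC⟩ := ih
    refine ⟨C * ((Finset.piAntidiag (Finset.univ : Finset (Fin N)) (j + n)).card * L),
      fun φ hφ => (hC φ hφ).trans ?_⟩
    rw [ENNReal.coe_mul, mul_assoc]
    refine mul_le_mul_right ?_ _
    rw [gradNorm_eq_of_contDiff hΩ _ _ hφ.1, ENNReal.coe_mul, mul_assoc, ENNReal.coe_natCast,
      ← nsmul_eq_mul]
    refine Finset.sum_le_card_nsmul _ _ _ fun γ hγ => ?_
    have h1 := (isTestFunction_multiDeriv γ hφ).eLpNorm_le_partialDeriv hp ⟨0, hN⟩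
    refine h1.trans (mul_le_mul_right ?_ _)
    rw [partialDeriv_multiDeriv hφ.1, ← multiDeriv_add_single hφ.1]
    have h2 := (hasWeakDeriv_multiDeriv (cube a L) (γ + Pi.single ⟨0, hN⟩ 1)
      hφ.1).eLpNorm_le_gradNorm hΩ (p := p)
    rwa [sum_add_single, mem_multiIndices.1 hγ] at h2

theorem exists_friedrichs_const_sobolevZero {N : ℕ} (hN : 0 < N) (a : Fin N → ℝ) {L : ℝ}
    (hL : 0 < L) {p : ℝ≥0} (hp : 1 ≤ p) (m : ℕ) :
    ∃ C : ℝ≥0, ∀ u, MemSobolevZero (cube a L) m p u → ∀ j < m,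
      gradNorm (cube a L) j p u ≤ C * gradNorm (cube a L) m p u := by
  lift L to ℝ≥0 using hL.le
  have hΩ := isOpen_cube a L
  choose C hC using exists_friedrichs_const hN a L hp
  refine ⟨∑ j ∈ Finset.range m, C j (m - j), fun u hu j hj => ?_⟩
  set K := ∑ j ∈ Finset.range m, C j (m - j) with hK
  refine ENNReal.le_of_forall_pos_le_add fun ε hε _ => ?_
  -- The error enters once directly and once multiplied by K, hence the divisor 1 + K.
  obtain ⟨φ, hφ, hφu⟩ := hu.2 (ε / (1 + K) : ℝ≥0) (by
    rw [ENNReal.coe_pos]; positivity)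
  have hφm : MemSobolev (cube a L) m p φ := memSobolev_of_contDiff (isBounded_cube a hL) m p hφ.1
  have hd := hu.1.sub hΩ hφm
  have hlt : ∀ i ≤ m, gradNorm (cube a L) i p (u - φ) ≤ (ε / (1 + K) : ℝ≥0) := fun i hi =>
    (gradNorm_le_sobolevNorm _ hi p _).trans hφu.le
  have h1 : gradNorm (cube a L) j p u ≤ gradNorm (cube a L) j p (u - φ)
      + gradNorm (cube a L) j p φ := by
    have := gradNorm_add_le hΩ hp hj.le hd hφm
    rwa [sub_add_cancel] at this
  have h2 : gradNorm (cube a L) m p φ ≤ gradNorm (cube a L) m p u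
      + gradNorm (cube a L) m p (u - φ) := by
    have := gradNorm_sub_le hΩ hp le_rfl hu.1 hd
    rwa [sub_sub_cancel] at this
  have h3 : gradNorm (cube a L) j p φ ≤ K * gradNorm (cube a L) m p φ := by
    have := hC j (m - j) φ hφ
    rw [Nat.add_sub_cancel' hj.le] at this
    refine this.trans (mul_le_mul_left (ENNReal.coe_le_coe.2 ?_) _)
    exact Finset.single_le_sum (f := fun j => C j (m - j)) (fun _ _ => zero_le)
      (Finset.mem_range.2 hj)
  calc gradNorm (cube a L) j p u
      ≤ (ε / (1 + K) : ℝ≥0) + K * (gradNorm (cube a L) m p u + (ε / (1 + K) : ℝ≥0)) := by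
        refine h1.trans (add_le_add (hlt j hj.le) (h3.trans (mul_le_mul_right ?_ _)))
        exact h2.trans (add_le_add le_rfl (hlt m le_rfl))
    _ = K * gradNorm (cube a L) m p u + ((1 + K) * (ε / (1 + K)) : ℝ≥0) := by
        push_cast
        ring
    _ = _ := by rw [mul_div_cancel₀ _ (by positivity)]

/-! ### Derivatives of polynomials -/

theorem partialDeriv_mul {N : ℕ} {f g : (Fin N → ℝ) → ℝ} (hf : ContDiff ℝ ∞ f)
    (hg : ContDiff ℝ ∞ g) (i : Fin N) :
    partialDeriv i (f * g) = partialDeriv i f * g + f * partialDeriv i g := by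
  ext x
  simp only [partialDeriv, Pi.add_apply, Pi.mul_apply]
  rw [fderiv_mul (hf.differentiable (by simp) x) (hg.differentiable (by simp) x)]
  simp
  ring

theorem polyFun_add {N : ℕ} (P R : MvPolynomial (Fin N) ℝ) :
    polyFun (P + R) = polyFun P + polyFun R := by ext; simp [polyFun]

theorem polyFun_mul {N : ℕ} (P R : MvPolynomial (Fin N) ℝ) :
    polyFun (P * R) = polyFun P * polyFun R := by ext; simp [polyFun]

theorem polyFun_neg {N : ℕ} (P : MvPolynomial (Fin N) ℝ) : polyFun (-P) = -polyFun P := by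
  ext; simp [polyFun]

theorem polyFun_zero {N : ℕ} : polyFun (0 : MvPolynomial (Fin N) ℝ) = 0 := by ext; simp [polyFun]

theorem partialDeriv_polyFun {N : ℕ} (i : Fin N) (P : MvPolynomial (Fin N) ℝ) :
    partialDeriv i (polyFun P) = polyFun (MvPolynomial.pderiv i P) := by
  induction P using MvPolynomial.induction_on with
  | C c =>
    have : polyFun (N := N) (MvPolynomial.C c) = fun _ => c := by ext; simp [polyFun]
    ext x
    simp [partialDeriv, this, polyFun_zero]
  | add P R hP hR =>
    have := partialDeriv_smul_add (contDiff_polyFun P) (contDiff_polyFun R) 1 i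
    rw [one_smul, one_smul, hP, hR, ← polyFun_add, ← polyFun_add] at this
    rw [this, map_add]
  | mul_X P j hP =>
    rw [polyFun_mul, partialDeriv_mul (contDiff_polyFun _) (contDiff_polyFun _), hP]
    have hX : partialDeriv i (polyFun (MvPolynomial.X j : MvPolynomial (Fin N) ℝ))
        = polyFun (MvPolynomial.pderiv i (MvPolynomial.X j)) := by
      have : polyFun (MvPolynomial.X j : MvPolynomial (Fin N) ℝ) = fun x => x j := by
        ext; simp [polyFun]
      ext x
      rw [this, partialDeriv, (hasFDerivAt_apply j x).fderiv, MvPolynomial.pderiv_X]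
      by_cases h : i = j
      · subst h; simp [polyFun]
      · simp [polyFun, Ne.symm h]
    rw [hX, MvPolynomial.pderiv_mul, polyFun_add, polyFun_mul, polyFun_mul]

theorem totalDegree_pderiv_le {N : ℕ} (i : Fin N) (P : MvPolynomial (Fin N) ℝ) :
    (MvPolynomial.pderiv i P).totalDegree ≤ P.totalDegree - 1 := by
  refine Finset.sup_le fun s hs => ?_
  rw [MvPolynomial.mem_support_iff, MvPolynomial.coeff_pderiv] at hs
  have h := MvPolynomial.le_totalDegree (MvPolynomial.mem_support_iff.2 (left_ne_zero_of_mul hs))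
  rw [Finsupp.sum_add_index' (fun _ => rfl) (fun _ _ _ => rfl), Finsupp.sum_single_index rfl] at h
  omega

theorem multiDeriv_polyFun_eq_zero {N : ℕ} (γ : Fin N → ℕ) {P : MvPolynomial (Fin N) ℝ}
    (h : P.totalDegree < ∑ i, γ i) : multiDeriv γ (polyFun P) = 0 := by
  induction γ using multiIndex_induction generalizing P with
  | zero => simp at h
  | add_single γ i ih =>
    rw [multiDeriv_add_single (contDiff_polyFun P), partialDeriv_polyFun]
    rw [sum_add_single] at h
    -- Constants are treated apart: the truncated bound deg P - 1 does not decrease at degree 0, so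
    -- the induction hypothesis might not apply.
    rcases Nat.eq_zero_or_pos P.totalDegree with h0 | h0
    · rw [MvPolynomial.totalDegree_eq_zero_iff_eq_C.1 h0]
      simp [polyFun_zero, multiDeriv_zero]
    · have := totalDegree_pderiv_le i P
      exact ih (by omega)

/-- Among multi-indices of equal order, β ≠ γ means that some coordinate is differentiated more
often than its exponent allows. Thus monomials of order m and derivatives of order m are dual to
each other up to factorials. -/
theorem multiDeriv_polyFun_monomial {N : ℕ} (β γ : Fin N → ℕ) (c : ℝ)
    (h : ∑ i, β i = ∑ i, γ i) :
    multiDeriv β (polyFun (MvPolynomial.monomial (Finsupp.equivFunOnFinite.symm γ) c))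
      = fun _ => if γ = β then c * ∏ i, (β i).factorial else 0 := by
  induction β using multiIndex_induction generalizing γ c with
  | zero =>
    have : γ = 0 := by
      ext i
      have := Finset.sum_eq_zero_iff.1 (h.symm.trans (by simp)) i (Finset.mem_univ i)
      simpa using this
    subst this
    have e : (Finsupp.equivFunOnFinite.symm 0 : Fin N →₀ ℕ) = 0 := by ext; simp
    ext x
    simp [multiDeriv_zero_index, polyFun, e]
  | add_single β i ih =>
    rw [multiDeriv_add_single (contDiff_polyFun _), partialDeriv_polyFun,
      MvPolynomial.pderiv_monomial]
    rw [sum_add_single] at h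
    by_cases h0 : γ i = 0
    · have hne : γ ≠ β + Pi.single i 1 := fun e => by simp [e] at h0
      simp only [Finsupp.equivFunOnFinite_symm_apply_apply, h0]
      simp [polyFun_zero, multiDeriv_zero, hne]
      rfl
    · obtain ⟨γ', rfl⟩ : ∃ γ' : Fin N → ℕ, γ = γ' + Pi.single i 1 := by
        refine ⟨γ - Pi.single i 1, ?_⟩
        ext j
        by_cases hj : j = i
        · subst hj; simp; omega
        · simp [hj]
      have e : (Finsupp.equivFunOnFinite.symm (γ' + Pi.single i 1) : Fin N →₀ ℕ)
          - Finsupp.single i 1 = Finsupp.equivFunOnFinite.symm γ' := by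
        ext j
        by_cases hj : j = i
        · subst hj; simp
        · simp [hj]
      rw [sum_add_single] at h
      rw [e, ih γ' _ (by omega)]
      ext x
      by_cases hγ : γ' = β
      · subst hγ
        simp only [if_true, Finsupp.equivFunOnFinite_symm_apply_apply, Pi.add_apply,
          Pi.single_eq_same]
        have : ∏ j, ((γ' j + (Pi.single i 1 : Fin N → ℕ) j).factorial : ℝ)
            = (γ' i + 1) * ∏ j, ((γ' j).factorial : ℝ) := by
          rw [← Finset.mul_prod_erase _ _ (Finset.mem_univ i),
            ← Finset.mul_prod_erase _ (fun j => ((γ' j).factorial : ℝ)) (Finset.mem_univ i),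
            ← mul_assoc]
          congr 1
          · simp [Nat.factorial_succ]
          · refine Finset.prod_congr rfl fun j hj => ?_
            simp [Finset.ne_of_mem_erase hj]
        push_cast
        rw [this]
        ring
      · simp [hγ]

/-- There is a polynomial of degree `m` with prescribed derivatives of order `m`. -/
theorem exists_poly_multiDeriv_eq {N : ℕ} (m : ℕ) (c : (Fin N → ℕ) → ℝ) :
    ∃ T ∈ polys N m, ∀ γ : Fin N → ℕ, ∑ i, γ i = m →
      multiDeriv γ (polyFun T) = fun _ => c γ := by
  classical
  let I := Finset.piAntidiag (Finset.univ : Finset (Fin N)) m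
  let M : (Fin N → ℕ) → MvPolynomial (Fin N) ℝ := fun γ =>
    MvPolynomial.monomial (Finsupp.equivFunOnFinite.symm γ) (c γ / ∏ i, ((γ i).factorial : ℝ))
  refine ⟨∑ γ ∈ I, M γ, Submodule.sum_mem _ fun γ hγ => ?_, fun β hβ => ?_⟩
  · rw [MvPolynomial.mem_restrictTotalDegree]
    refine (MvPolynomial.totalDegree_monomial_le _ _).trans ?_
    rw [Finsupp.sum_fintype _ _ (fun _ => rfl)]
    exact (mem_multiIndices.1 hγ).le
  · have e : polyFun (∑ γ ∈ I, M γ) = ∑ γ ∈ I, polyFun (M γ) := by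
      ext x; simp [polyFun]
    rw [e, multiDeriv_sum β I fun γ _ => contDiff_polyFun _,
      Finset.sum_congr rfl fun γ hγ => multiDeriv_polyFun_monomial β γ _
        (hβ.trans (mem_multiIndices.1 hγ).symm)]
    ext x
    rw [Finset.sum_apply, Finset.sum_eq_single β]
    · have : ∏ i, ((β i).factorial : ℝ) ≠ 0 :=
        Finset.prod_ne_zero_iff.2 fun i _ => by positivity
      simp only [if_true]
      push_cast
      exact div_mul_cancel₀ _ this
    · intro γ _ hγ
      simp [hγ]
    · intro h
      exact absurd (mem_multiIndices.2 hβ) h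

/-- Smooth functions are approximated by polynomials of degree less than `m`, with an error
controlled by the derivatives of order `m`. -/
theorem exists_poly_approx_const {N : ℕ} {B : Set (Fin N → ℝ)} (hBo : IsOpen B)
    (hB : Convex ℝ B) (hBb : Bornology.IsBounded B) (hBn : B.Nonempty) {p : ℝ≥0} (hp : 1 ≤ p)
    (m : ℕ) : ∃ C : ℝ≥0, ∀ f : (Fin N → ℝ) → ℝ, ContDiff ℝ ∞ f → ∃ R ∈ polys N (m - 1),
      (∀ γ : Fin N → ℕ, ∑ i, γ i = m → multiDeriv γ (polyFun R) = 0) ∧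
      ∑ j ∈ Finset.range m, gradNorm B j p (f - polyFun R) ≤ C * gradNorm B m p f := by
  induction m with
  | zero =>
    -- For m = 0 the bound m - 1 is truncated to 0 and admits constants. It does not imply that the
    -- derivatives of order m of R vanish, so this is carried as a separate clause.
    exact ⟨1, fun f _ => ⟨0, Submodule.zero_mem _, fun γ _ => by
      rw [polyFun_zero, multiDeriv_zero], by simp⟩⟩
  | succ m ih =>
    obtain ⟨C, hC⟩ := ih
    obtain ⟨C₁, hC₁⟩ := exists_poincare_const hBo hB hBb hBn hp
    let I := Finset.piAntidiag (Finset.univ : Finset (Fin N)) m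
    refine ⟨(C + 1) * (I.card * (C₁ * N)), fun f hf => ?_⟩
    choose c hc using fun γ => hC₁ (multiDeriv γ f) (contDiff_multiDeriv hf γ)
    -- T takes the Poincaré constants of the functions D^γ f as its derivatives of order m, so the
    -- seminorm of order m of f - T is controlled by that of order m + 1 of f. The induction
    -- hypothesis for f - T then handles the lower orders.
    obtain ⟨T, hT, hTc⟩ := exists_poly_multiDeriv_eq m c
    have hfT : ContDiff ℝ ∞ (f - polyFun T) := hf.sub (contDiff_polyFun T)
    obtain ⟨R, hR, hR0, hRC⟩ := hC _ hfT
    have htop : gradNorm B m p (f - polyFun T)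
        ≤ (I.card * (C₁ * N) : ℝ≥0) * gradNorm B (m + 1) p f := by
      rw [gradNorm_eq_of_contDiff hBo _ _ hfT, ENNReal.coe_mul, mul_assoc, ENNReal.coe_natCast,
        ← nsmul_eq_mul]
      refine Finset.sum_le_card_nsmul _ _ _ fun γ hγ => ?_
      have hγ' := mem_multiIndices.1 hγ
      rw [multiDeriv_sub γ hf (contDiff_polyFun T), hTc γ hγ']
      refine (hc γ).trans ?_
      rw [ENNReal.coe_mul, mul_assoc]
      refine mul_le_mul_right ?_ _
      have : ((N : ℝ≥0) : ℝ≥0∞) * gradNorm B (m + 1) p f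
          = (Finset.univ : Finset (Fin N)).card • gradNorm B (m + 1) p f := by simp
      rw [this]
      refine Finset.sum_le_card_nsmul _ _ _ fun i _ => ?_
      rw [partialDeriv_multiDeriv hf, ← multiDeriv_add_single hf]
      have h2 := (hasWeakDeriv_multiDeriv B (γ + Pi.single i 1) hf).eLpNorm_le_gradNorm hBo
        (p := p)
      rwa [sum_add_single, hγ'] at h2
    have e : f - polyFun (T + R) = f - polyFun T - polyFun R := by
      rw [polyFun_add, sub_add_eq_sub_sub]
    refine ⟨T + R, Submodule.add_mem _ hT ?_, fun γ hγ => ?_, ?_⟩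
    · rw [MvPolynomial.mem_restrictTotalDegree] at hR ⊢
      omega
    · refine multiDeriv_polyFun_eq_zero γ ?_
      rw [MvPolynomial.mem_restrictTotalDegree] at hR hT
      have := MvPolynomial.totalDegree_add T R
      omega
    · rw [Finset.sum_range_succ, e]
      have hfTR : ContDiff ℝ ∞ (f - polyFun T - polyFun R) := hfT.sub (contDiff_polyFun R)
      -- Subtracting R does not disturb what T has achieved at order m.
      have h1 : gradNorm B m p (f - polyFun T - polyFun R) = gradNorm B m p (f - polyFun T) := by
        rw [gradNorm_eq_of_contDiff hBo _ _ hfT,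
          gradNorm_eq_of_contDiff hBo _ _ hfTR]
        refine Finset.sum_congr rfl fun γ hγ => ?_
        rw [multiDeriv_sub γ hfT (contDiff_polyFun R), hR0 γ (mem_multiIndices.1 hγ), sub_zero]
      rw [h1]
      calc _ ≤ C * gradNorm B m p (f - polyFun T) + gradNorm B m p (f - polyFun T) :=
            add_le_add hRC le_rfl
        _ = ((C + 1 : ℝ≥0) : ℝ≥0∞) * gradNorm B m p (f - polyFun T) := by
            push_cast; ring
        _ ≤ _ := by
            rw [ENNReal.coe_mul, mul_assoc]
            exact mul_le_mul_right htop _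

/-! ### From smooth functions to Sobolev functions -/

theorem gradNorm_sub_le_of_eLpNorm_le {N m n : ℕ} {B : Set (Fin N → ℝ)} (hBo : IsOpen B)
    {p : ℝ≥0} {u f : (Fin N → ℝ) → ℝ} (hu : MemSobolev B m p u) (hf : ContDiff ℝ ∞ f) (hn : n ≤ m)
    {η : ℝ≥0} (h : ∀ γ : Fin N → ℕ, ∑ i, γ i ≤ m →
      eLpNorm (multiDeriv γ f - weakDeriv B γ u) p (volume.restrict B) ≤ η) :
    gradNorm B n p (u - f)
      ≤ ((Finset.piAntidiag (Finset.univ : Finset (Fin N)) n).card * η : ℝ≥0) := by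
  rw [gradNorm_eq hBo fun γ hγ => (hu.hasWeakDeriv (hγ.trans_le hn)).sub hBo
    (hasWeakDeriv_multiDeriv B γ hf), ENNReal.coe_mul, ENNReal.coe_natCast, ← nsmul_eq_mul]
  refine Finset.sum_le_card_nsmul _ _ _ fun γ hγ => ?_
  rw [eLpNorm_sub_comm]
  exact h γ ((mem_multiIndices.1 hγ).trans_le hn)

/-- Smooth functions are dense in `W^{m,p}(B)`, in terms of the Sobolev norm. -/
theorem MemSobolev.exists_sobolevNorm_sub_le {N m : ℕ} {B : Set (Fin N → ℝ)} (hBo : IsOpen B)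
    (hB : Convex ℝ B) (hBb : Bornology.IsBounded B) (hBn : B.Nonempty) {p : ℝ≥0} (hp : 1 ≤ p)
    {u : (Fin N → ℝ) → ℝ} (hu : MemSobolev B m p u) {η : ℝ≥0} (hη : 0 < η) :
    ∃ f, ContDiff ℝ ∞ f ∧ sobolevNorm B m p (u - f) ≤ η := by
  obtain ⟨K, hK⟩ : ∃ K : ℝ≥0, K = ∑ n ∈ Finset.range (m + 1),
    ((Finset.piAntidiag (Finset.univ : Finset (Fin N)) n).card : ℝ≥0) := ⟨_, rfl⟩
  obtain ⟨f, hf, h⟩ := hu.exists_contDiff_approx hBo hB hBb hBn hp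
    (η := η / (K + 1)) (by positivity)
  refine ⟨f, hf, ?_⟩
  calc sobolevNorm B m p (u - f) ≤ ∑ n ∈ Finset.range (m + 1),
        (((Finset.piAntidiag (Finset.univ : Finset (Fin N)) n).card * (η / (K + 1)) : ℝ≥0) : ℝ≥0∞) :=
        Finset.sum_le_sum fun n hn => gradNorm_sub_le_of_eLpNorm_le hBo hu hf
          (Nat.lt_succ_iff.1 (Finset.mem_range.1 hn)) h
    _ = ((K * (η / (K + 1)) : ℝ≥0) : ℝ≥0∞) := by
        rw [← ENNReal.ofNNReal_finsetSum, ← Finset.sum_mul, ← hK]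
    _ ≤ η := by
        have hK1 : K / (K + 1) ≤ 1 := div_le_one_of_le₀ (le_add_of_nonneg_right zero_le) zero_le
        rw [ENNReal.coe_le_coe, mul_div_assoc', mul_comm, mul_div_assoc]
        exact mul_le_of_le_one_right zero_le hK1

/-- The best approximation by polynomials of degree less than `m` satisfies a Poincaré
inequality of order `m`. -/
theorem exists_bestApprox_const {N : ℕ} {B : Set (Fin N → ℝ)} (hBo : IsOpen B)
    (hB : Convex ℝ B) (hBb : Bornology.IsBounded B) (hBn : B.Nonempty) {p : ℝ≥0} (hp : 1 ≤ p)
    (r : ℕ) : ∃ C : ℝ≥0, ∀ (u : LpOn B p) (R : MvPolynomial (Fin N) ℝ), MemSobolev B (r + 1) p u →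
      IsBestApprox B r p u R →
      ∑ j ∈ Finset.range (r + 1), gradNorm B j p (⇑u - polyFun R) ≤ C * gradNorm B (r + 1) p u := by
  obtain ⟨C, hC⟩ := exists_poly_approx_const hBo hB hBb hBn hp (r + 1)
  refine ⟨C, fun u R hu hR => ?_⟩
  refine ENNReal.le_of_forall_pos_le_add fun ε hε _ => ?_
  obtain ⟨f, hf, hfu⟩ := hu.exists_sobolevNorm_sub_le hBo hB hBb hBn hp
    (η := ε / (1 + C)) (by positivity)
  obtain ⟨P, hP, -, hPC⟩ := hC f hf
  have hfm := memSobolev_of_contDiff hBb (r + 1) p hf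
  have hPm := memSobolev_of_contDiff hBb (r + 1) p (contDiff_polyFun P)
  have hfP := hfm.sub hBo hPm
  have huf := hu.sub hBo hfm
  have e : ⇑u - polyFun P = (⇑u - f) + (f - polyFun P) := by abel
  have h2 : gradNorm B (r + 1) p f ≤ gradNorm B (r + 1) p u + (ε / (1 + C) : ℝ≥0) := by
    have := gradNorm_sub_le hBo hp le_rfl hu huf
    rw [sub_sub_cancel] at this
    exact this.trans (add_le_add le_rfl ((gradNorm_le_sobolevNorm _ le_rfl p _).trans hfu))
  -- Minimality permits comparison with the polynomial of the smooth approximation f, although that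
  -- polynomial depends on ε.
  calc _ ≤ ∑ j ∈ Finset.range (r + 1), gradNorm B j p (⇑u - polyFun P) := hR.2 P hP
    _ ≤ ∑ j ∈ Finset.range (r + 1),
        (gradNorm B j p (⇑u - f) + gradNorm B j p (f - polyFun P)) := by
        refine Finset.sum_le_sum fun j hj => ?_
        rw [e]
        exact gradNorm_add_le hBo hp (Finset.mem_range.1 hj).le huf hfP
    _ ≤ (ε / (1 + C) : ℝ≥0) + C * (gradNorm B (r + 1) p u + (ε / (1 + C) : ℝ≥0)) := by
        rw [Finset.sum_add_distrib]
        refine add_le_add (le_trans ?_ hfu) (hPC.trans (mul_le_mul_right h2 _))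
        exact Finset.sum_le_sum_of_subset (Finset.range_mono (by omega))
    _ = C * gradNorm B (r + 1) p u + ((1 + C) * (ε / (1 + C)) : ℝ≥0) := by
        push_cast
        ring
    _ = _ := by rw [mul_div_cancel₀ _ (by positivity)]

/-! ### Weak derivatives of functions cut off at a hyperplane -/

/-- The open half-space beyond the hyperplane `x i = c`, in the direction of the sign `s`. -/
def halfSpace {N : ℕ} (i : Fin N) (c s : ℝ) : Set (Fin N → ℝ) := {x | 0 < s * (x i - c)}

theorem isOpen_halfSpace {N : ℕ} (i : Fin N) (c s : ℝ) : IsOpen (halfSpace i c s) :=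
  isOpen_lt continuous_const (by fun_prop)

theorem ae_apply_ne {N : ℕ} (i : Fin N) (c : ℝ) : ∀ᵐ x : Fin N → ℝ, x i ≠ c := by
  rw [ae_iff]
  simpa [volume_pi] using Measure.pi_hyperplane (fun _ : Fin N => (volume : Measure ℝ)) i c

/-- The cut-off function is q composed with the projection onto the closed half-space: points on the
other side go to the hyperplane, where q vanishes. The projection is nonexpansive in the sup metric.
-/
theorem LipschitzWith.indicator_halfSpace {N : ℕ} {i : Fin N} {c s : ℝ} (hs : s * s = 1)
    {q : (Fin N → ℝ) → ℝ} {C : ℝ≥0} (hq : LipschitzWith C q) (h0 : ∀ x, x i = c → q x = 0) :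
    LipschitzWith C ((halfSpace i c s).indicator q) := by
  have hs1 : |s| = 1 := by
    have : |s| * |s| = 1 := by rw [← abs_mul, hs, abs_one]
    nlinarith [abs_nonneg s]
  let fold : (Fin N → ℝ) → (Fin N → ℝ) :=
    fun x => Function.update x i (c + s * max (s * (x i - c)) 0)
  have hfold : LipschitzWith 1 fold := by
    refine LipschitzWith.of_dist_le_mul fun x y => ?_
    rw [NNReal.coe_one, one_mul, dist_pi_le_iff dist_nonneg]
    intro j
    by_cases hj : j = i
    · subst hj
      simp only [fold, Function.update_self]
      rw [dist_add_left, Real.dist_eq, ← mul_sub, abs_mul, hs1, one_mul]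
      refine (abs_max_sub_max_le_abs _ _ _).trans ?_
      rw [← mul_sub, abs_mul, hs1, one_mul, sub_sub_sub_cancel_right, ← Real.dist_eq]
      exact dist_le_pi_dist x y j
    · simp only [fold, Function.update_of_ne hj]
      exact dist_le_pi_dist x y j
  have e : (halfSpace i c s).indicator q = q ∘ fold := by
    ext x
    by_cases hx : x ∈ halfSpace i c s
    · have hx' : 0 < s * (x i - c) := hx
      rw [Set.indicator_of_mem hx, Function.comp_apply]
      congr 1
      simp only [fold]
      rw [max_eq_left hx'.le, ← mul_assoc, hs, one_mul, add_sub_cancel, Function.update_eq_self]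
    · have hx' : s * (x i - c) ≤ 0 := not_lt.1 hx
      rw [Set.indicator_of_notMem hx, Function.comp_apply, h0]
      simp [fold, max_eq_right hx']
  rw [e]
  simpa using hq.comp hfold

theorem lineDeriv_fun_const {N : ℕ} (a : ℝ) (x v : Fin N → ℝ) :
    lineDeriv ℝ (fun _ => a) x v = 0 := by simp [lineDeriv]

/-- As q vanishes on the hyperplane, cutting it off leaves a Lipschitz function of compact support,
and the integral of any of its directional derivatives is zero. Off the hyperplane, a null set, this
derivative is the one in the integrand. -/
theorem integral_indicator_partialDeriv_eq_zero {N : ℕ} {i : Fin N} {c s : ℝ} (hs : s * s = 1)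
    {q : (Fin N → ℝ) → ℝ} (hq : IsTestFunction Set.univ q) (h0 : ∀ x, x i = c → q x = 0)
    (l : Fin N) : ∫ x, (halfSpace i c s).indicator (partialDeriv l q) x = 0 := by
  obtain ⟨C, hC⟩ := ContDiff.lipschitzWith_of_hasCompactSupport hq.2 hq.1 (by simp)
  have hL := hC.indicator_halfSpace hs h0
  have hcs : HasCompactSupport ((halfSpace i c s).indicator q) :=
    hq.2.mono (by rw [Set.support_indicator]; exact Set.inter_subset_right)
  -- Integration by parts against the constant 1; the direction is negated because the formula
  -- reverses it.
  have key := LipschitzWith.integral_lineDeriv_mul_eq (μ := (volume : Measure (Fin N → ℝ)))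
    (LipschitzWith.const (1 : ℝ) : LipschitzWith 0 fun _ : Fin N → ℝ => (1 : ℝ)) hL hcs
    (-Pi.single l 1)
  simp only [lineDeriv_fun_const, zero_mul, integral_zero, mul_one, neg_neg] at key
  refine (integral_congr_ae ?_).trans key.symm
  filter_upwards [ae_apply_ne i c] with x hx
  have hqx : lineDeriv ℝ q x (Pi.single l 1) = partialDeriv l q x :=
    (hq.1.differentiable (by simp) x).lineDeriv_eq_fderiv
  by_cases hxH : x ∈ halfSpace i c s
  · rw [Set.indicator_of_mem hxH, ← hqx]
    refine (Filter.EventuallyEq.lineDeriv_eq ?_).symm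
    filter_upwards [(isOpen_halfSpace i c s).mem_nhds hxH] with y hy
    exact Set.indicator_of_mem hy q
  · rw [Set.indicator_of_notMem hxH]
    have hs0 : s ≠ 0 := fun h => by simp [h] at hs
    have hlt : s * (x i - c) < 0 :=
      lt_of_le_of_ne (not_lt.1 hxH) (mul_ne_zero hs0 (sub_ne_zero.2 hx))
    have hopen : IsOpen {y : Fin N → ℝ | s * (y i - c) < 0} :=
      isOpen_lt (by fun_prop) continuous_const
    have : (halfSpace i c s).indicator q =ᶠ[nhds x] fun _ => 0 := by
      filter_upwards [hopen.mem_nhds hlt] with y hy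
      have hyH : y ∉ halfSpace i c s := fun hy' => lt_asymm hy hy'
      exact Set.indicator_of_notMem hyH q
    rw [this.lineDeriv_eq, lineDeriv_fun_const]

/-- The product h φ vanishes on the hyperplane together with h, so the previous integral identity
applies to it, and the product rule splits it into the two sides of the weak formulation: no
boundary term appears. -/
theorem hasWeakDeriv_indicator_halfSpace_single {N : ℕ} {i : Fin N} {c s : ℝ} (hs : s * s = 1)
    {h : (Fin N → ℝ) → ℝ} (hh : ContDiff ℝ ∞ h) (h0 : ∀ x, x i = c → h x = 0) (l : Fin N) :
    HasWeakDeriv Set.univ (Pi.single l 1) ((halfSpace i c s).indicator h)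
      ((halfSpace i c s).indicator (partialDeriv l h)) := by
  have hH := (isOpen_halfSpace i c s).measurableSet
  have hh' := contDiff_partialDeriv hh l
  refine ⟨locallyIntegrableOn_univ.2 (hh.continuous.locallyIntegrable.indicator hH),
    locallyIntegrableOn_univ.2 (hh'.continuous.locallyIntegrable.indicator hH), fun φ ht => ?_⟩
  have ht' := ht.partialDeriv l
  have hq : IsTestFunction Set.univ (h * φ) :=
    ⟨hh.mul ht.1, ht.2.mul_left, Set.subset_univ _⟩
  have key := integral_indicator_partialDeriv_eq_zero hs hq (c := c) (i := i)
    (fun x hx => by simp [h0 x hx]) l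
  rw [partialDeriv_mul hh ht.1] at key
  have e : ∀ x, (halfSpace i c s).indicator (partialDeriv l h * φ + h * partialDeriv l φ) x
      = (halfSpace i c s).indicator (partialDeriv l h) x * φ x
        + (halfSpace i c s).indicator h x * partialDeriv l φ x := by
    intro x
    by_cases hx : x ∈ halfSpace i c s <;> simp [hx]
  have hfi : ∀ f ψ : (Fin N → ℝ) → ℝ, Continuous f → IsTestFunction Set.univ ψ →
      Integrable fun x => (halfSpace i c s).indicator f x * ψ x := by
    intro f ψ hf hψ
    have h1 : Integrable (f * ψ) :=
      (hf.mul hψ.1.continuous).integrable_of_hasCompactSupport hψ.2.mul_left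
    refine (h1.indicator hH).congr (.of_forall fun x => ?_)
    by_cases hx : x ∈ halfSpace i c s <;> simp [hx]
  simp_rw [e] at key
  rw [integral_add (hfi _ _ hh'.continuous ht) (hfi _ _ hh.continuous ht')] at key
  rw [multiDeriv_single ht.1, Measure.restrict_univ]
  simp
  linarith

theorem hasWeakDeriv_indicator_halfSpace {N : ℕ} {i : Fin N} {c s : ℝ} (hs : s * s = 1)
    (γ : Fin N → ℕ) {h : (Fin N → ℝ) → ℝ} (hh : ContDiff ℝ ∞ h)
    (h0 : ∀ β : Fin N → ℕ, ∑ j, β j < ∑ j, γ j → ∀ x, x i = c → multiDeriv β h x = 0) :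
    HasWeakDeriv Set.univ γ ((halfSpace i c s).indicator h)
      ((halfSpace i c s).indicator (multiDeriv γ h)) := by
  induction γ using multiIndex_induction generalizing h with
  | zero =>
    rw [multiDeriv_zero_index]
    exact .zero_index (locallyIntegrableOn_univ.2
      (hh.continuous.locallyIntegrable.indicator (isOpen_halfSpace i c s).measurableSet))
  | add_single γ l ih =>
    rw [multiDeriv_add_single hh]
    refine (hasWeakDeriv_indicator_halfSpace_single hs hh (fun x hx => ?_) l).comp_single
      (ih (contDiff_partialDeriv hh l) fun β hβ x hx => ?_)
    · have := h0 0 (by rw [sum_add_single]; simp) x hx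
      rwa [multiDeriv_zero_index] at this
    · rw [← multiDeriv_add_single hh]
      exact h0 _ (by rw [sum_add_single, sum_add_single]; omega) x hx

/-! ### Higher order reflection -/

/-- Interpolation at the m distinct nodes -1/(j + 1) is exact for powers below m; the weights are
the values at 1 of the Lagrange basis polynomials. -/
theorem exists_reflection_coeff (m : ℕ) : ∃ w : Fin m → ℝ, ∀ t < m,
    ∑ j : Fin m, w j * (-(1 / ((j : ℝ) + 1))) ^ t = 1 := by
  let v : Fin m → ℝ := fun j => -(1 / ((j : ℝ) + 1))
  have hv : Set.InjOn v (Finset.univ : Finset (Fin m)) := by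
    intro j _ k _ h
    simp only [v, neg_inj, one_div, inv_inj, add_left_inj, Nat.cast_inj] at h
    exact Fin.ext h
  refine ⟨fun j => (Lagrange.basis Finset.univ v j).eval 1, fun t ht => ?_⟩
  have h := Lagrange.eq_interpolate_of_eval_eq (fun j => v j ^ t) hv
    (f := (Polynomial.X ^ t : Polynomial ℝ))
    (by rw [Polynomial.degree_X_pow]; simpa using ht) (by simp)
  have h1 := congrArg (Polynomial.eval 1) h
  rw [Lagrange.interpolate_apply, Polynomial.eval_finsetSum] at h1
  simp only [Polynomial.eval_pow, Polynomial.eval_X, one_pow, Polynomial.eval_mul,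
    Polynomial.eval_C] at h1
  exact (Finset.sum_congr rfl fun j _ => mul_comm _ _).trans h1.symm

/-- The map `x i ↦ c - (x i - c) / (j + 1)`, which takes the half-space to its complement. -/
noncomputable def squeeze {N : ℕ} (i : Fin N) (c : ℝ) (j : ℕ) : (Fin N → ℝ) → (Fin N → ℝ) :=
  diagAffine (Function.update 1 i (-(1 / ((j : ℝ) + 1))))
    (Pi.single i ((1 + 1 / ((j : ℝ) + 1)) * c))

theorem squeeze_apply_self {N : ℕ} (i : Fin N) (c : ℝ) (j : ℕ) (x : Fin N → ℝ) :
    squeeze i c j x i = c - 1 / ((j : ℝ) + 1) * (x i - c) := by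
  simp [squeeze, diagAffine]; ring

theorem squeeze_apply_of_ne {N : ℕ} {i l : Fin N} (h : l ≠ i) (c : ℝ) (j : ℕ) (x : Fin N → ℝ) :
    squeeze i c j x l = x l := by
  simp [squeeze, diagAffine, h]

theorem multiDeriv_comp_squeeze {N : ℕ} (γ : Fin N → ℕ) {f : (Fin N → ℝ) → ℝ}
    (hf : ContDiff ℝ ∞ f) (i : Fin N) (c : ℝ) (j : ℕ) :
    multiDeriv γ (f ∘ squeeze i c j)
      = (-(1 / ((j : ℝ) + 1))) ^ γ i • (multiDeriv γ f ∘ squeeze i c j) := by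
  rw [squeeze, multiDeriv_comp_diagAffine γ hf]
  congr 1
  rw [Finset.prod_eq_single i]
  · simp
  · intro l _ hl
    simp [hl]
  · simp

open Classical in
/-- The reflection of order `m` of `g` across the hyperplane `x i = c`. The exponent `t` is
the order of the derivative in the direction `i` that `g` stands for. -/
noncomputable def reflect {N m : ℕ} (w : Fin m → ℝ) (i : Fin N) (c s : ℝ) (t : ℕ)
    (g : (Fin N → ℝ) → ℝ) : (Fin N → ℝ) → ℝ :=
  fun x => if x ∈ halfSpace i c s then
    ∑ j : Fin m, w j * (-(1 / ((j : ℝ) + 1))) ^ t * g (squeeze i c j x) else g x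

theorem reflect_sub {N m : ℕ} (w : Fin m → ℝ) (i : Fin N) (c s : ℝ) (t : ℕ)
    (f g : (Fin N → ℝ) → ℝ) :
    reflect w i c s t (f - g) = reflect w i c s t f - reflect w i c s t g := by
  ext x
  by_cases hx : x ∈ halfSpace i c s <;> simp [reflect, hx, mul_sub]

/-- The reflected function is f plus a cut-off of h, where h is the reflecting sum minus f. On the
hyperplane the maps `squeeze` are the identity, and differentiating β i times in the normal
direction brings out the powers in the moment conditions on w. Hence the derivatives of h of order
below m vanish there. -/
theorem hasWeakDeriv_reflect_of_contDiff {N m : ℕ} {w : Fin m → ℝ}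
    (hw : ∀ t < m, ∑ j : Fin m, w j * (-(1 / ((j : ℝ) + 1))) ^ t = 1) (i : Fin N) (c : ℝ) {s : ℝ}
    (hs : s * s = 1) {f : (Fin N → ℝ) → ℝ} (hf : ContDiff ℝ ∞ f) {γ : Fin N → ℕ}
    (hγ : ∑ j, γ j ≤ m) :
    HasWeakDeriv Set.univ γ (reflect w i c s 0 f) (reflect w i c s (γ i) (multiDeriv γ f)) := by
  let h : (Fin N → ℝ) → ℝ := ∑ j : Fin m, w j • (f ∘ squeeze i c j) - f
  have hfs : ∀ j : Fin m, ContDiff ℝ ∞ (f ∘ squeeze i c j) := fun j =>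
    hf.comp (contDiff_diagAffine _ _)
  have hfs' : ∀ j : Fin m, ContDiff ℝ ∞ (w j • (f ∘ squeeze i c j)) := fun j =>
    (hfs j).const_smul (w j)
  have hsum : ContDiff ℝ ∞ (∑ j : Fin m, w j • (f ∘ squeeze i c j)) := by
    rw [show (∑ j : Fin m, w j • (f ∘ squeeze i c j))
      = fun x => ∑ j : Fin m, (w j • (f ∘ squeeze i c j)) x by ext; simp]
    exact ContDiff.sum fun j _ => hfs' j
  have hh : ContDiff ℝ ∞ h := hsum.sub hf
  have hD : ∀ β : Fin N → ℕ, multiDeriv β h = ∑ j : Fin m,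
      w j • (-(1 / ((j : ℝ) + 1))) ^ β i • (multiDeriv β f ∘ squeeze i c j) - multiDeriv β f := by
    intro β
    rw [multiDeriv_sub β hsum hf, multiDeriv_sum β _ fun j _ => hfs' j]
    congr 1
    refine Finset.sum_congr rfl fun j _ => ?_
    rw [multiDeriv_smul β (hfs j), multiDeriv_comp_squeeze β hf]
  have hvan : ∀ β : Fin N → ℕ, ∑ j, β j < ∑ j, γ j → ∀ x, x i = c → multiDeriv β h x = 0 := by
    intro β hβ x hx
    have hsq : ∀ j : Fin m, squeeze i c j x = x := by
      intro j; ext l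
      by_cases hl : l = i
      · subst hl; rw [squeeze_apply_self, hx]; ring
      · rw [squeeze_apply_of_ne hl]
    have hβi : β i < m :=
      (Finset.single_le_sum (f := β) (fun _ _ => Nat.zero_le _) (Finset.mem_univ i)).trans_lt
        (hβ.trans_le hγ)
    rw [hD]
    simp only [Pi.sub_apply, Finset.sum_apply, Pi.smul_apply, Function.comp_apply, hsq,
      smul_eq_mul, ← mul_assoc]
    rw [← Finset.sum_mul, hw _ hβi, one_mul, sub_self]
  have key := (hasWeakDeriv_multiDeriv Set.univ γ hf).add isOpen_univ
    (hasWeakDeriv_indicator_halfSpace hs γ hh hvan)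
  have e : ∀ β : Fin N → ℕ, multiDeriv β f + (halfSpace i c s).indicator (multiDeriv β h)
      = reflect w i c s (β i) (multiDeriv β f) := by
    intro β
    ext x
    by_cases hx : x ∈ halfSpace i c s
    · simp [reflect, hx, hD, mul_assoc]
    · simp [reflect, hx]
  have e0 := e 0
  simp only [multiDeriv_zero_index, Pi.zero_apply] at e0
  rwa [e, e0] at key

/-- The data of a set `B` and an enlargement `B'` of it across the hyperplane `x i = c`. -/
structure ReflectionPair {N : ℕ} (i : Fin N) (c s : ℝ) (B B' : Set (Fin N → ℝ)) : Prop where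
  subset : B ⊆ B'
  neg_of_mem : ∀ x ∈ B, s * (x i - c) < 0
  mem_of_neg : ∀ x ∈ B', s * (x i - c) < 0 → x ∈ B
  squeeze_mem : ∀ x ∈ B', x ∈ halfSpace i c s → ∀ j : ℕ, squeeze i c j x ∈ B

/-- Up to the null hyperplane, the reflection is g on B plus finitely many compositions of g with
invertible affine maps from the far side into B; each distorts the measure by a bounded factor. -/
theorem ReflectionPair.exists_eLpNorm_reflect_le {N m : ℕ} {i : Fin N} {c s : ℝ} (hs : s * s = 1)
    {B B' : Set (Fin N → ℝ)} (h : ReflectionPair i c s B B') (hB : IsOpen B) (hB' : IsOpen B')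
    {p : ℝ≥0} (hp : 1 ≤ p) (w : Fin m → ℝ) (t : ℕ) :
    ∃ K : ℝ≥0, ∀ g : (Fin N → ℝ) → ℝ, AEStronglyMeasurable g (volume.restrict B) →
      AEStronglyMeasurable (reflect w i c s t g) (volume.restrict B') ∧
      eLpNorm (reflect w i c s t g) p (volume.restrict B')
        ≤ K * eLpNorm g p (volume.restrict B) := by
  have hp' : (1 : ℝ≥0∞) ≤ p := by exact_mod_cast hp
  have hs0 : s ≠ 0 := fun h => by simp [h] at hs
  have hBH : MeasurableSet (B' ∩ halfSpace i c s) :=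
    (hB'.inter (isOpen_halfSpace i c s)).measurableSet
  have hmeas : ∀ j : ℕ, Measurable (squeeze i c j) := fun j => measurable_diagAffine _ _
  have hmap : ∀ j : ℕ, ∃ K : ℝ≥0,
      (volume.restrict (B' ∩ halfSpace i c s)).map (squeeze i c j) ≤ K • volume.restrict B := by
    intro j
    refine ⟨_, map_diagAffine_restrict_le ?_ hB.measurableSet fun x hx =>
      h.squeeze_mem x hx.1 hx.2 j⟩
    intro l
    by_cases hl : l = i
    · subst hl
      rw [Function.update_self]
      exact neg_ne_zero.2 (by positivity)
    · simp [hl]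
  choose K hK using hmap
  let a : Fin m → ℝ := fun j => w j * (-(1 / ((j : ℝ) + 1))) ^ t
  refine ⟨1 + ∑ j : Fin m, ‖a j‖₊ * K j ^ (1 / (p : ℝ≥0∞)).toReal, fun g hg => ?_⟩
  let G : Fin m → (Fin N → ℝ) → ℝ := fun j =>
    a j • (B' ∩ halfSpace i c s).indicator (g ∘ squeeze i c j)
  have e : reflect w i c s t g =ᵐ[volume.restrict B'] B.indicator g + ∑ j, G j := by
    rw [Filter.EventuallyEq, ae_restrict_iff' hB'.measurableSet]
    filter_upwards [ae_apply_ne i c] with x hx hxB'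
    by_cases hxH : x ∈ halfSpace i c s
    · have hxB : x ∉ B := fun hxB => lt_asymm (h.neg_of_mem x hxB) hxH
      simp [reflect, hxH, hxB, G, a, hxB']
    · have hlt : s * (x i - c) < 0 :=
        lt_of_le_of_ne (not_lt.1 hxH) (mul_ne_zero hs0 (sub_ne_zero.2 hx))
      simp [reflect, hxH, h.mem_of_neg x hxB' hlt, G]
  have hgs : ∀ j : Fin m, AEStronglyMeasurable (g ∘ squeeze i c j)
      (volume.restrict (B' ∩ halfSpace i c s)) := fun j =>
    ((hg.smul_measure (K j)).mono_measure (hK j)).comp_measurable (hmeas j)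
  have hr : ∀ S : Set (Fin N → ℝ), MeasurableSet S → S ⊆ B' →
      (volume.restrict B').restrict S = volume.restrict S := fun S hS hSB => by
    rw [Measure.restrict_restrict hS, Set.inter_eq_left.2 hSB]
  have hG : ∀ j, AEStronglyMeasurable (G j) (volume.restrict B') := fun j => by
    refine AEStronglyMeasurable.const_smul ?_ _
    rw [aestronglyMeasurable_indicator_iff hBH, hr _ hBH Set.inter_subset_left]
    exact hgs j
  have hgB : AEStronglyMeasurable (B.indicator g) (volume.restrict B') := by
    rw [aestronglyMeasurable_indicator_iff hB.measurableSet, hr _ hB.measurableSet h.subset]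
    exact hg
  have hGsum : AEStronglyMeasurable (∑ j, G j) (volume.restrict B') :=
    Finset.aestronglyMeasurable_sum _ fun j _ => hG j
  refine ⟨(hgB.add hGsum).congr e.symm, ?_⟩
  rw [eLpNorm_congr_ae e]
  refine (eLpNorm_add_le hgB hGsum hp').trans ?_
  rw [ENNReal.coe_add, add_mul, ENNReal.coe_one, one_mul, ENNReal.ofNNReal_finsetSum,
    Finset.sum_mul]
  refine add_le_add (le_of_eq ?_) ((eLpNorm_sum_le (fun j _ => hG j) hp').trans
    (Finset.sum_le_sum fun j _ => ?_))
  · rw [eLpNorm_indicator_eq_eLpNorm_restrict hB.measurableSet, hr _ hB.measurableSet h.subset]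
  · rw [eLpNorm_const_smul, eLpNorm_indicator_eq_eLpNorm_restrict hBH,
      hr _ hBH Set.inter_subset_left, ENNReal.coe_mul, mul_assoc]
    refine mul_le_mul_right ?_ _
    rw [← eLpNorm_map_measure ((hg.smul_measure (K j)).mono_measure (hK j))
      (hmeas j).aemeasurable]
    refine (eLpNorm_mono_measure _ (hK j)).trans (le_of_eq ?_)
    have : (K j • volume.restrict B : Measure (Fin N → ℝ))
      = (K j : ℝ≥0∞) • volume.restrict B := rfl
    rw [this, eLpNorm_smul_measure_of_ne_top ENNReal.coe_ne_top,
      ENNReal.coe_rpow_of_nonneg _ ENNReal.toReal_nonneg]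
    rfl

/-! ### Extension of Sobolev functions from a box to a larger box -/

/-- There is a bounded extension from `W^{m,p}(B)` to `W^{m,p}(B')`. -/
def HasSobolevExtension {N : ℕ} (m : ℕ) (p : ℝ≥0) (B B' : Set (Fin N → ℝ)) : Prop :=
  B ⊆ B' ∧ ∃ C : ℝ≥0, ∀ u, MemSobolev B m p u → ∃ v, MemSobolev B' m p v ∧
    v =ᵐ[volume.restrict B] u ∧ sobolevNorm B' m p v ≤ C * sobolevNorm B m p u

theorem HasSobolevExtension.refl {N : ℕ} (m : ℕ) (p : ℝ≥0) (B : Set (Fin N → ℝ)) :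
    HasSobolevExtension m p B B :=
  ⟨subset_rfl, 1, fun u hu => ⟨u, hu, .refl _ _, by simp⟩⟩

theorem HasSobolevExtension.trans {N m : ℕ} {p : ℝ≥0} {B B' B'' : Set (Fin N → ℝ)}
    (h : HasSobolevExtension m p B B') (h' : HasSobolevExtension m p B' B'') :
    HasSobolevExtension m p B B'' := by
  obtain ⟨hs, C, hC⟩ := h
  obtain ⟨hs', C', hC'⟩ := h'
  refine ⟨hs.trans hs', C' * C, fun u hu => ?_⟩
  obtain ⟨v, hv, hvu, hvC⟩ := hC u hu
  obtain ⟨v', hv', hvv', hvC'⟩ := hC' v hv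
  have hB : v' =ᵐ[volume.restrict B] v := ae_restrict_of_ae_restrict_of_subset hs hvv'
  refine ⟨v', hv', hB.trans hvu, ?_⟩
  rw [ENNReal.coe_mul, mul_assoc]
  exact hvC'.trans (mul_le_mul_right hvC _)

/-- For smooth functions the derivatives of the reflection are known. All reflection operators
involved are bounded in L^p, so density of smooth functions and the closedness of weak derivatives
transfer the formula to u. -/
theorem ReflectionPair.hasSobolevExtension {N : ℕ} {i : Fin N} {c s : ℝ} (hs : s * s = 1)
    {B B' : Set (Fin N → ℝ)} (h : ReflectionPair i c s B B') (hBo : IsOpen B) (hB : Convex ℝ B)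
    (hBb : Bornology.IsBounded B) (hBn : B.Nonempty) (hB' : IsOpen B') {p : ℝ≥0} (hp : 1 ≤ p)
    (m : ℕ) : HasSobolevExtension m p B B' := by
  obtain ⟨w, hw⟩ := exists_reflection_coeff m
  choose K hK using fun t => h.exists_eLpNorm_reflect_le hs hBo hB' hp w t
  have hKle : ∀ t ≤ m, K t ≤ ∑ t ∈ Finset.range (m + 1), K t := fun t ht =>
    Finset.single_le_sum (f := K) (fun _ _ => zero_le) (Finset.mem_range.2 (by omega))
  obtain ⟨M, hM⟩ : ∃ M, M = ∑ t ∈ Finset.range (m + 1), K t := ⟨_, rfl⟩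
  rw [← hM] at hKle
  have hγi : ∀ γ : Fin N → ℕ, γ i ≤ ∑ j, γ j := fun γ =>
    Finset.single_le_sum (f := γ) (fun _ _ => Nat.zero_le _) (Finset.mem_univ i)
  refine ⟨h.subset, M, fun u hu => ?_⟩
  have hmem : ∀ t ≤ m, ∀ g, MemLp g p (volume.restrict B) →
      MemLp (reflect w i c s t g) p (volume.restrict B') := fun t ht g hg =>
    ⟨(hK t g hg.1).1, (hK t g hg.1).2.trans_lt (ENNReal.mul_lt_top ENNReal.coe_lt_top hg.2)⟩
  have hweak : ∀ γ : Fin N → ℕ, ∑ j, γ j ≤ m →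
      HasWeakDeriv B' γ (reflect w i c s 0 u) (reflect w i c s (γ i) (weakDeriv B γ u)) := by
    intro γ hγ
    have hγm := (hγi γ).trans hγ
    have hg := hu.memLp_weakDeriv hBo hγ
    refine HasWeakDeriv.of_approx hB' hp (hmem 0 (Nat.zero_le m) u (hu.memLp hBo))
      (hmem _ hγm _ hg) fun ε hε => ?_
    obtain ⟨f, hf, hfu⟩ := hu.exists_contDiff_approx hBo hB hBb hBn hp
      (η := ε / (M + 1)) (by positivity)
    have hbound : ∀ t ≤ m, ∀ g₁ g₂ : (Fin N → ℝ) → ℝ,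
        AEStronglyMeasurable (g₁ - g₂) (volume.restrict B) →
        eLpNorm (g₁ - g₂) p (volume.restrict B) ≤ (ε / (M + 1) : ℝ≥0) →
        eLpNorm (reflect w i c s t g₁ - reflect w i c s t g₂) p (volume.restrict B') ≤ ε := by
      intro t ht g₁ g₂ hm h12
      rw [← reflect_sub]
      refine ((hK t _ hm).2.trans (mul_le_mul' (ENNReal.coe_le_coe.2 (hKle t ht)) h12)).trans ?_
      have hM1 : M / (M + 1) ≤ 1 := div_le_one_of_le₀ (le_add_of_nonneg_right zero_le) zero_le
      rw [← ENNReal.coe_mul, ENNReal.coe_le_coe, mul_div_assoc', mul_comm, mul_div_assoc]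
      exact mul_le_of_le_one_right zero_le hM1
    refine ⟨_, _, (hasWeakDeriv_reflect_of_contDiff hw i c hs hf hγ).mono (Set.subset_univ _),
      hbound 0 (Nat.zero_le m) _ _ ?_ ?_, hbound _ hγm _ _ ?_ (hfu γ hγ)⟩
    · exact hf.continuous.aestronglyMeasurable.sub (hu.memLp hBo).1
    · have h0 := hfu 0 (by simp)
      rw [multiDeriv_zero_index] at h0
      refine le_trans (le_of_eq (eLpNorm_congr_ae ?_)) h0
      filter_upwards [weakDeriv_zero_ae_eq hBo hu.locallyIntegrableOn] with x hx
      simp [hx]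
    · exact (contDiff_multiDeriv hf γ).continuous.aestronglyMeasurable.sub hg.1
  refine ⟨reflect w i c s 0 u, fun γ hγ => ⟨_, hweak γ hγ, hmem _ ((hγi γ).trans hγ) _
    (hu.memLp_weakDeriv hBo hγ)⟩, ?_, ?_⟩
  · rw [Filter.EventuallyEq, ae_restrict_iff' hBo.measurableSet]
    refine .of_forall fun x hx => ?_
    have : x ∉ halfSpace i c s := fun hxH => lt_asymm (h.neg_of_mem x hx) hxH
    simp [reflect, this]
  · rw [sobolevNorm, sobolevNorm, Finset.mul_sum]
    refine Finset.sum_le_sum fun j hj => ?_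
    have hj' : j ≤ m := Nat.lt_succ_iff.1 (Finset.mem_range.1 hj)
    rw [gradNorm_eq hB' fun γ hγ => hweak γ (hγ.trans_le hj'), gradNorm, Finset.mul_sum]
    refine Finset.sum_le_sum fun γ hγ => ?_
    have hγ' := (mem_multiIndices.1 hγ).trans_le hj'
    exact (hK _ _ (hu.memLp_weakDeriv hBo hγ').1).2.trans
      (mul_le_mul_left (ENNReal.coe_le_coe.2 (hKle _ ((hγi γ).trans hγ'))) _)

/-- The open box with corners `l` and `r`. -/
def openBox {N : ℕ} (l r : Fin N → ℝ) : Set (Fin N → ℝ) := Set.univ.pi fun i => Set.Ioo (l i) (r i)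

theorem mem_openBox {N : ℕ} {l r x : Fin N → ℝ} : x ∈ openBox l r ↔ ∀ i, l i < x i ∧ x i < r i := by
  simp [openBox]

theorem isOpen_openBox {N : ℕ} (l r : Fin N → ℝ) : IsOpen (openBox l r) :=
  isOpen_set_pi Set.finite_univ fun _ _ => isOpen_Ioo

theorem convex_openBox {N : ℕ} (l r : Fin N → ℝ) : Convex ℝ (openBox l r) :=
  convex_pi fun _ _ => convex_Ioo _ _

theorem isBounded_openBox {N : ℕ} (l r : Fin N → ℝ) : Bornology.IsBounded (openBox l r) :=
  Bornology.IsBounded.pi fun _ => Metric.isBounded_Ioo _ _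

theorem nonempty_openBox {N : ℕ} {l r : Fin N → ℝ} (h : ∀ i, l i < r i) : (openBox l r).Nonempty :=
  Set.univ_pi_nonempty_iff.2 fun i => Set.nonempty_Ioo.2 (h i)

/-- No squeezed point is farther from the face than the original one. This is why a box may grow
across a face by up to its own width. -/
theorem squeeze_bounds {c x : ℝ} (hx : 0 < x - c) (j : ℕ) :
    c - (x - c) ≤ c - 1 / ((j : ℝ) + 1) * (x - c) ∧ c - 1 / ((j : ℝ) + 1) * (x - c) < c := by
  have h1 : 1 / ((j : ℝ) + 1) ≤ 1 := div_le_one_of_le₀ (by simp) (by positivity)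
  have h2 : 0 < 1 / ((j : ℝ) + 1) := by positivity
  constructor <;> nlinarith

theorem hasSobolevExtension_update_right {N : ℕ} {l r : Fin N → ℝ} (hlr : ∀ i, l i < r i)
    (i : Fin N) {b : ℝ} (hb : r i ≤ b) (hb' : b ≤ r i + (r i - l i)) {p : ℝ≥0} (hp : 1 ≤ p)
    (m : ℕ) : HasSobolevExtension m p (openBox l r) (openBox l (Function.update r i b)) := by
  have hmem : ∀ x, x ∈ openBox l (Function.update r i b) → l i < x i ∧ x i < b := fun x hx => by
    have := mem_openBox.1 hx i
    simpa using this
  have hmem' : ∀ x, x ∈ openBox l (Function.update r i b) → ∀ k ≠ i, l k < x k ∧ x k < r k :=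
    fun x hx k hk => by
      have := mem_openBox.1 hx k
      simpa [hk] using this
  refine ReflectionPair.hasSobolevExtension (i := i) (c := r i) (s := 1) (by norm_num)
    ⟨?_, ?_, ?_, ?_⟩ (isOpen_openBox _ _) (convex_openBox _ _) (isBounded_openBox _ _)
    (nonempty_openBox hlr) (isOpen_openBox _ _) hp m
  · intro x hx
    rw [mem_openBox] at hx ⊢
    intro k
    by_cases hk : k = i
    · subst hk; simpa using ⟨(hx k).1, (hx k).2.trans_le hb⟩
    · simpa [hk] using hx k
  · intro x hx
    linarith [(mem_openBox.1 hx i).2]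
  · intro x hx hlt
    rw [mem_openBox]
    intro k
    by_cases hk : k = i
    · subst hk; exact ⟨(hmem x hx).1, by linarith⟩
    · exact hmem' x hx k hk
  · intro x hx hxH j
    have hxH' : 0 < 1 * (x i - r i) := hxH
    rw [mem_openBox]
    intro k
    by_cases hk : k = i
    · subst hk
      rw [squeeze_apply_self]
      have := squeeze_bounds (c := r k) (x := x k) (by linarith) j
      have := hmem x hx
      constructor <;> linarith
    · rw [squeeze_apply_of_ne hk]; exact hmem' x hx k hk

theorem hasSobolevExtension_update_left {N : ℕ} {l r : Fin N → ℝ} (hlr : ∀ i, l i < r i)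
    (i : Fin N) {b : ℝ} (hb : b ≤ l i) (hb' : l i - (r i - l i) ≤ b) {p : ℝ≥0} (hp : 1 ≤ p)
    (m : ℕ) : HasSobolevExtension m p (openBox l r) (openBox (Function.update l i b) r) := by
  have hmem : ∀ x, x ∈ openBox (Function.update l i b) r → b < x i ∧ x i < r i := fun x hx => by
    have := mem_openBox.1 hx i
    simpa using this
  have hmem' : ∀ x, x ∈ openBox (Function.update l i b) r → ∀ k ≠ i, l k < x k ∧ x k < r k :=
    fun x hx k hk => by
      have := mem_openBox.1 hx k
      simpa [hk] using this
  refine ReflectionPair.hasSobolevExtension (i := i) (c := l i) (s := -1) (by norm_num)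
    ⟨?_, ?_, ?_, ?_⟩ (isOpen_openBox _ _) (convex_openBox _ _) (isBounded_openBox _ _)
    (nonempty_openBox hlr) (isOpen_openBox _ _) hp m
  · intro x hx
    rw [mem_openBox] at hx ⊢
    intro k
    by_cases hk : k = i
    · subst hk; simpa using ⟨hb.trans_lt (hx k).1, (hx k).2⟩
    · simpa [hk] using hx k
  · intro x hx
    linarith [(mem_openBox.1 hx i).1]
  · intro x hx hlt
    rw [mem_openBox]
    intro k
    by_cases hk : k = i
    · subst hk; exact ⟨by linarith, (hmem x hx).2⟩
    · exact hmem' x hx k hk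
  · intro x hx hxH j
    have hxH' : 0 < -1 * (x i - l i) := hxH
    rw [mem_openBox]
    intro k
    by_cases hk : k = i
    · subst hk
      rw [squeeze_apply_self]
      have := squeeze_bounds (c := -l k) (x := -x k) (by linarith) j
      have := hmem x hx
      have e : 1 / ((j : ℝ) + 1) * (-x k - -l k) = -(1 / ((j : ℝ) + 1) * (x k - l k)) := by ring
      constructor <;> linarith
    · rw [squeeze_apply_of_ne hk]; exact hmem' x hx k hk

theorem hasSobolevExtension_right {N : ℕ} {l r r' : Fin N → ℝ} (hlr : ∀ i, l i < r i)
    (hr : ∀ i, r i ≤ r' i) (hr' : ∀ i, r' i ≤ r i + (r i - l i)) {p : ℝ≥0} (hp : 1 ≤ p) (m : ℕ) :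
    HasSobolevExtension m p (openBox l r) (openBox l r') := by
  classical
  -- The right faces are moved one at a time, S being those already moved; the width in each
  -- remaining direction is still the original one.
  have key : ∀ S : Finset (Fin N),
      HasSobolevExtension m p (openBox l r) (openBox l (S.piecewise r' r)) := by
    intro S
    induction S using Finset.induction_on with
    | empty => rw [Finset.piecewise_empty]; exact .refl _ _ _
    | insert i S hi ih =>
      rw [Finset.piecewise_insert]
      refine ih.trans (hasSobolevExtension_update_right (fun k => ?_) i ?_ ?_ hp m)
      · by_cases hk : k ∈ S
        · rw [Finset.piecewise_eq_of_mem _ _ _ hk]; exact (hlr k).trans_le (hr k)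
        · rw [Finset.piecewise_eq_of_notMem _ _ _ hk]; exact hlr k
      · rw [Finset.piecewise_eq_of_notMem _ _ _ hi]; exact hr i
      · rw [Finset.piecewise_eq_of_notMem _ _ _ hi]; exact hr' i
  simpa using key Finset.univ

theorem hasSobolevExtension_left {N : ℕ} {l r l' : Fin N → ℝ} (hlr : ∀ i, l i < r i)
    (hl : ∀ i, l' i ≤ l i) (hl' : ∀ i, l i - (r i - l i) ≤ l' i) {p : ℝ≥0} (hp : 1 ≤ p) (m : ℕ) :
    HasSobolevExtension m p (openBox l r) (openBox l' r) := by
  classical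
  have key : ∀ S : Finset (Fin N),
      HasSobolevExtension m p (openBox l r) (openBox (S.piecewise l' l) r) := by
    intro S
    induction S using Finset.induction_on with
    | empty => rw [Finset.piecewise_empty]; exact .refl _ _ _
    | insert i S hi ih =>
      rw [Finset.piecewise_insert]
      refine ih.trans (hasSobolevExtension_update_left (fun k => ?_) i ?_ ?_ hp m)
      · by_cases hk : k ∈ S
        · rw [Finset.piecewise_eq_of_mem _ _ _ hk]; exact (hl k).trans_lt (hlr k)
        · rw [Finset.piecewise_eq_of_notMem _ _ _ hk]; exact hlr k
      · rw [Finset.piecewise_eq_of_notMem _ _ _ hi]; exact hl i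
      · rw [Finset.piecewise_eq_of_notMem _ _ _ hi]; exact hl' i
  simpa using key Finset.univ

theorem cube_eq_openBox {N : ℕ} (a : Fin N → ℝ) (ℓ : ℝ) :
    cube a ℓ = openBox (fun i => a i - ℓ / 2) (fun i => a i + ℓ / 2) := by
  ext x
  rw [mem_openBox]
  refine forall_congr' fun i => ?_
  rw [abs_lt]
  constructor <;> rintro ⟨h1, h2⟩ <;> constructor <;> linarith

theorem hasSobolevExtension_cube {N : ℕ} (a : Fin N → ℝ) {ℓ : ℝ} (hℓ : 0 < ℓ) {p : ℝ≥0}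
    (hp : 1 ≤ p) (m : ℕ) : HasSobolevExtension m p (cube a ℓ) (cube a (2 * ℓ)) := by
  rw [cube_eq_openBox, cube_eq_openBox]
  -- Each face moves by ℓ/2, while the width is ℓ for the right faces and 3ℓ/2 when the left ones
  -- follow.
  refine (hasSobolevExtension_right (r' := fun i => a i + 2 * ℓ / 2) ?_ ?_ ?_ hp m).trans
    (hasSobolevExtension_left ?_ ?_ ?_ hp m) <;> intro i <;> linarith

/-! ### Multiplication by cut-off functions -/

theorem HasWeakDeriv.mul_single {N : ℕ} {Ω : Set (Fin N → ℝ)} (hΩ : IsOpen Ω) {i : Fin N}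
    {χ u g : (Fin N → ℝ) → ℝ} (hχ : ContDiff ℝ ∞ χ) (h : HasWeakDeriv Ω (Pi.single i 1) u g) :
    HasWeakDeriv Ω (Pi.single i 1) (χ * u) (partialDeriv i χ * u + χ * g) := by
  have hχ' := contDiff_partialDeriv hχ i
  have hmul : ∀ ψ v : (Fin N → ℝ) → ℝ, ContDiff ℝ ∞ ψ → LocallyIntegrableOn v Ω →
      LocallyIntegrableOn (ψ * v) Ω := fun ψ v hψ hv =>
    hv.continuousOn_mul hψ.continuous.continuousOn hΩ.isLocallyClosed
  refine ⟨hmul _ _ hχ h.1, (hmul _ _ hχ' h.1).add (hmul _ _ hχ h.2), fun φ ht => ?_⟩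
  have hq : IsTestFunction Ω (χ * φ) :=
    ⟨hχ.mul ht.1, ht.2.mul_left, (tsupport_mul_subset_right).trans ht.3⟩
  have hq' : IsTestFunction Ω (partialDeriv i χ * φ) :=
    ⟨hχ'.mul ht.1, ht.2.mul_left, (tsupport_mul_subset_right).trans ht.3⟩
  have key := h.3 _ hq
  rw [multiDeriv_single hq.1] at key
  rw [multiDeriv_single ht.1]
  simp only [Finset.sum_pi_single', Finset.mem_univ, if_true, pow_one, neg_one_mul] at key ⊢
  have e1 : ∀ x, (χ * u) x * partialDeriv i φ x
      = u x * partialDeriv i (χ * φ) x - u x * (partialDeriv i χ * φ) x := by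
    intro x
    rw [partialDeriv_mul hχ ht.1]
    simp only [Pi.mul_apply, Pi.add_apply]
    ring
  have e2 : ∀ x, (partialDeriv i χ * u + χ * g) x * φ x
      = u x * (partialDeriv i χ * φ) x + g x * (χ * φ) x := by
    intro x
    simp only [Pi.mul_apply, Pi.add_apply]
    ring
  simp_rw [e1, e2]
  rw [integral_sub (integrable_mul_test hΩ h.1 (hq.partialDeriv i)) (integrable_mul_test hΩ h.1 hq'),
    integral_add (integrable_mul_test hΩ h.1 hq') (integrable_mul_test hΩ h.2 hq), key]
  ring

theorem MemSobolev.weakDeriv_single {N n : ℕ} {Ω : Set (Fin N → ℝ)} (hΩ : IsOpen Ω) {p : ℝ≥0}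
    {u : (Fin N → ℝ) → ℝ} (hu : MemSobolev Ω (n + 1) p u) (i : Fin N) :
    MemSobolev Ω n p (weakDeriv Ω (Pi.single i 1) u) := fun γ hγ => by
  have h1 : ∑ j, (γ + Pi.single i 1 : Fin N → ℕ) j ≤ n + 1 := by rw [sum_add_single]; omega
  have h2 : ∑ j, (Pi.single i 1 : Fin N → ℕ) j ≤ n + 1 := by simp
  exact ⟨_, (hu.hasWeakDeriv h2).of_add_single (hu.hasWeakDeriv h1), hu.memLp_weakDeriv hΩ h1⟩

theorem exists_sobolevNorm_weakDeriv_single_le {N : ℕ} {Ω : Set (Fin N → ℝ)} (hΩ : IsOpen Ω)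
    (p : ℝ≥0) (n : ℕ) : ∃ C : ℝ≥0, ∀ (u : (Fin N → ℝ) → ℝ) (i : Fin N),
      MemSobolev Ω (n + 1) p u →
      sobolevNorm Ω n p (weakDeriv Ω (Pi.single i 1) u) ≤ C * sobolevNorm Ω (n + 1) p u := by
  refine ⟨∑ j ∈ Finset.range (n + 1),
    ((Finset.piAntidiag (Finset.univ : Finset (Fin N)) j).card : ℝ≥0), fun u i hu => ?_⟩
  rw [sobolevNorm, ENNReal.ofNNReal_finsetSum, Finset.sum_mul]
  refine Finset.sum_le_sum fun j hj => ?_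
  rw [ENNReal.coe_natCast, ← nsmul_eq_mul]
  have hj' : j ≤ n := Nat.lt_succ_iff.1 (Finset.mem_range.1 hj)
  have h2 : ∑ k, (Pi.single i 1 : Fin N → ℕ) k ≤ n + 1 := by simp
  have h1 : ∀ γ : Fin N → ℕ, ∑ k, γ k = j →
      ∑ k, (γ + Pi.single i 1 : Fin N → ℕ) k ≤ n + 1 := fun γ hγ => by
    rw [sum_add_single]; omega
  rw [gradNorm_eq hΩ fun γ hγ => (hu.hasWeakDeriv h2).of_add_single (hu.hasWeakDeriv (h1 γ hγ))]
  exact Finset.sum_le_card_nsmul _ _ _ fun γ hγ =>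
    (hu.hasWeakDeriv (h1 γ (mem_multiIndices.1 hγ))).eLpNorm_le_sobolevNorm hΩ
      (h1 γ (mem_multiIndices.1 hγ))

/-- Splitting off one derivative, ∂_i(χ u) = (∂_i χ) u + χ ∂_i u, reduces the order. The first
summand has a new cut-off and the second a new function, so both vary in the induction and Leibniz'
formula is not needed. -/
theorem exists_weakDeriv_mul_le {N : ℕ} {Ω : Set (Fin N → ℝ)} (hΩ : IsOpen Ω) {p : ℝ≥0}
    (hp : 1 ≤ p) (γ : Fin N → ℕ) {χ : (Fin N → ℝ) → ℝ} (hχ : IsTestFunction Set.univ χ) :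
    ∃ C : ℝ≥0, ∀ u, MemSobolev Ω (∑ i, γ i) p u → ∃ g, HasWeakDeriv Ω γ (χ * u) g ∧
      MemLp g p (volume.restrict Ω) ∧
      eLpNorm g p (volume.restrict Ω) ≤ C * sobolevNorm Ω (∑ i, γ i) p u := by
  induction γ using multiIndex_induction generalizing χ with
  | zero =>
    obtain ⟨M, hM⟩ := hχ.2.exists_bound_of_continuous hχ.1.continuous
    refine ⟨M.toNNReal, fun u hu => ⟨χ * u, .zero_index ?_, ?_, ?_⟩⟩
    · exact hu.locallyIntegrableOn.continuousOn_mul hχ.1.continuous.continuousOn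
        hΩ.isLocallyClosed
    · refine (hu.memLp hΩ).of_le_mul
        (hχ.1.continuous.aestronglyMeasurable.mul (hu.memLp hΩ).1) (c := M) (.of_forall fun x => ?_)
      rw [Pi.mul_apply, norm_mul]
      exact mul_le_mul_of_nonneg_right (hM x) (norm_nonneg _)
    · have h1 : eLpNorm (χ * u) p (volume.restrict Ω)
          ≤ ENNReal.ofReal M * eLpNorm u p (volume.restrict Ω) := by
        refine eLpNorm_le_mul_eLpNorm_of_ae_le_mul (.of_forall fun x => ?_) p
        rw [Pi.mul_apply, norm_mul]
        exact mul_le_mul_of_nonneg_right (hM x) (norm_nonneg _)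
      refine h1.trans (mul_le_mul_right ?_ _)
      exact (HasWeakDeriv.zero_index hu.locallyIntegrableOn).eLpNorm_le_sobolevNorm hΩ le_rfl
  | add_single γ i ih =>
    obtain ⟨C₁, h₁⟩ := ih (hχ.partialDeriv i)
    obtain ⟨C₂, h₂⟩ := ih hχ
    obtain ⟨C₃, h₃⟩ := exists_sobolevNorm_weakDeriv_single_le hΩ p (∑ i, γ i)
    refine ⟨C₁ + C₂ * C₃, fun u hu => ?_⟩
    rw [sum_add_single] at hu ⊢
    obtain ⟨g₁, hg₁, hm₁, hb₁⟩ := h₁ u (hu.mono_order (by omega))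
    obtain ⟨g₂, hg₂, hm₂, hb₂⟩ := h₂ _ (hu.weakDeriv_single hΩ i)
    have hi := hu.hasWeakDeriv (γ := Pi.single i 1) (by simp)
    refine ⟨g₁ + g₂, (hi.mul_single hΩ hχ.1).comp_single (hg₁.add hΩ hg₂), hm₁.add hm₂, ?_⟩
    refine (eLpNorm_add_le hm₁.1 hm₂.1 (by exact_mod_cast hp)).trans ?_
    rw [ENNReal.coe_add, add_mul, ENNReal.coe_mul, mul_assoc]
    exact add_le_add (hb₁.trans (mul_le_mul_right (sobolevNorm_mono_order Ω (by omega) p u) _))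
      (hb₂.trans (mul_le_mul_right (h₃ u i hu) _))

theorem exists_sobolevNorm_mul_le {N : ℕ} {Ω : Set (Fin N → ℝ)} (hΩ : IsOpen Ω) {p : ℝ≥0}
    (hp : 1 ≤ p) (m : ℕ) {χ : (Fin N → ℝ) → ℝ} (hχ : IsTestFunction Set.univ χ) :
    ∃ C : ℝ≥0, ∀ u, MemSobolev Ω m p u → MemSobolev Ω m p (χ * u) ∧
      sobolevNorm Ω m p (χ * u) ≤ C * sobolevNorm Ω m p u := by
  choose C hC using fun γ => exists_weakDeriv_mul_le hΩ hp γ hχ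
  refine ⟨∑ j ∈ Finset.range (m + 1),
    ∑ γ ∈ Finset.piAntidiag (Finset.univ : Finset (Fin N)) j, C γ, fun u hu => ⟨fun γ hγ => ?_, ?_⟩⟩
  · obtain ⟨g, hg, hm, -⟩ := hC γ u (hu.mono_order hγ)
    exact ⟨g, hg, hm⟩
  · rw [sobolevNorm, ENNReal.ofNNReal_finsetSum, Finset.sum_mul]
    refine Finset.sum_le_sum fun j hj => ?_
    rw [gradNorm, ENNReal.ofNNReal_finsetSum, Finset.sum_mul]
    refine Finset.sum_le_sum fun γ hγ => ?_
    have hγ' : ∑ i, γ i ≤ m :=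
      (mem_multiIndices.1 hγ).trans_le (Nat.lt_succ_iff.1 (Finset.mem_range.1 hj))
    obtain ⟨g, hg, -, hb⟩ := hC γ u (hu.mono_order hγ')
    rw [eLpNorm_congr_ae (hg.weakDeriv_ae_eq hΩ)]
    exact hb.trans (mul_le_mul_right (sobolevNorm_mono_order Ω hγ' p u) _)

/-- If f is smooth and approximates u, then χ f is a test function in Ω and approximates χ u,
because multiplication by χ is bounded. -/
theorem IsTestFunction.exists_mul_memSobolevZero {N : ℕ} {Ω : Set (Fin N → ℝ)} (hΩ : IsOpen Ω)
    (hΩc : Convex ℝ Ω) (hΩb : Bornology.IsBounded Ω) (hΩn : Ω.Nonempty) {p : ℝ≥0}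
    (hp : 1 ≤ p) (m : ℕ) {χ : (Fin N → ℝ) → ℝ} (hχ : IsTestFunction Ω χ) :
    ∃ C : ℝ≥0, ∀ u, MemSobolev Ω m p u → MemSobolevZero Ω m p (χ * u) ∧
      sobolevNorm Ω m p (χ * u) ≤ C * sobolevNorm Ω m p u := by
  obtain ⟨C, hC⟩ := exists_sobolevNorm_mul_le hΩ hp m
    (⟨hχ.1, hχ.2, Set.subset_univ _⟩ : IsTestFunction Set.univ χ)
  refine ⟨C, fun u hu => ⟨⟨(hC u hu).1, fun ε hε => ?_⟩, (hC u hu).2⟩⟩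
  obtain ⟨δ, hδ, hδε⟩ := ENNReal.lt_iff_exists_nnreal_btwn.1 hε
  rw [ENNReal.coe_pos] at hδ
  obtain ⟨f, hf, hfu⟩ := hu.exists_sobolevNorm_sub_le hΩ hΩc hΩb hΩn hp
    (η := δ / (C + 1)) (by positivity)
  refine ⟨χ * f, ⟨hχ.1.mul hf, hχ.2.mul_right, (tsupport_mul_subset_left).trans hχ.3⟩, ?_⟩
  rw [← mul_sub]
  refine lt_of_le_of_lt ?_ hδε
  refine ((hC _ (hu.sub hΩ (memSobolev_of_contDiff hΩb m p hf))).2.trans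
    (mul_le_mul_right hfu _)).trans ?_
  have hC1 : C / (C + 1) ≤ 1 := div_le_one_of_le₀ (le_add_of_nonneg_right zero_le) zero_le
  rw [← ENNReal.coe_mul, ENNReal.coe_le_coe, mul_div_assoc', mul_comm, mul_div_assoc]
  exact mul_le_of_le_one_right zero_le hC1

/-- Bounded extension from `W^{m,p}(Q)` to `W^{m,p}_0(2Q)`. -/
theorem exists_extension_sobolevZero {N : ℕ} (a : Fin N → ℝ) {ℓ : ℝ} (hℓ : 0 < ℓ) {p : ℝ≥0}
    (hp : 1 ≤ p) (m : ℕ) : ∃ C : ℝ≥0, ∀ u, MemSobolev (cube a ℓ) m p u →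
      ∃ v, MemSobolevZero (cube a (2 * ℓ)) m p v ∧ v =ᵐ[volume.restrict (cube a ℓ)] u ∧
        sobolevNorm (cube a (2 * ℓ)) m p v ≤ C * sobolevNorm (cube a ℓ) m p u := by
  obtain ⟨-, C₁, hC₁⟩ := hasSobolevExtension_cube a hℓ hp m
  -- Balls are cubes in the sup metric: the radius ℓ/2 covers Q, and 3ℓ/4 < ℓ keeps the support
  -- inside 2Q.
  let Χ : ContDiffBump a := ⟨ℓ / 2, 3 * ℓ / 4, by positivity, by linarith⟩
  have hΧ : IsTestFunction (cube a (2 * ℓ)) Χ := by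
    refine ⟨Χ.contDiff, Χ.hasCompactSupport, ?_⟩
    rw [Χ.tsupport_eq]
    intro x hx i
    have h1 : dist (x i) (a i) ≤ 3 * ℓ / 4 := (dist_le_pi_dist x a i).trans hx
    rw [Real.dist_eq] at h1
    linarith
  have hne : (cube a (2 * ℓ)).Nonempty := ⟨a, fun i => by simpa using hℓ⟩
  have hconv : Convex ℝ (cube a (2 * ℓ)) := by rw [cube_eq_openBox]; exact convex_openBox _ _
  obtain ⟨C₂, hC₂⟩ := hΧ.exists_mul_memSobolevZero (isOpen_cube _ _) hconv
    (isBounded_cube a (by positivity)) hne hp m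
  refine ⟨C₂ * C₁, fun u hu => ?_⟩
  obtain ⟨v, hv, hvu, hb⟩ := hC₁ u hu
  refine ⟨Χ * v, (hC₂ v hv).1, ?_, ?_⟩
  · have h1 : (Χ * v : (Fin N → ℝ) → ℝ) =ᵐ[volume.restrict (cube a ℓ)] v := by
      rw [Filter.EventuallyEq, ae_restrict_iff' (isOpen_cube a ℓ).measurableSet]
      refine .of_forall fun x hx => ?_
      rw [Pi.mul_apply, Χ.one_of_mem_closedBall (cube_subset_closedBall a ℓ hℓ hx), one_mul]
    exact h1.trans hvu
  · rw [ENNReal.coe_mul, mul_assoc]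
    exact (hC₂ v hv).2.trans (mul_le_mul_right hb _)

/-! ### Norms of polynomials -/

theorem polyNorm_ne_top {N : ℕ} {Ω : Set (Fin N → ℝ)} (hΩ : Bornology.IsBounded Ω) (p : ℝ≥0)
    (P : MvPolynomial (Fin N) ℝ) : polyNorm Ω p P ≠ ⊤ :=
  ((contDiff_polyFun P).continuous.memLp_restrict_of_isBounded hΩ p).2.ne

theorem polyNorm_neg {N : ℕ} (Ω : Set (Fin N → ℝ)) (p : ℝ≥0) (P : MvPolynomial (Fin N) ℝ) :
    polyNorm Ω p (-P) = polyNorm Ω p P := by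
  rw [polyNorm, polyFun_neg, eLpNorm_neg, polyNorm]

theorem polyNorm_add_le {N : ℕ} (Ω : Set (Fin N → ℝ)) {p : ℝ≥0} (hp : 1 ≤ p)
    (P R : MvPolynomial (Fin N) ℝ) :
    polyNorm Ω p (P + R) ≤ polyNorm Ω p P + polyNorm Ω p R := by
  rw [polyNorm, polyFun_add]
  exact eLpNorm_add_le (contDiff_polyFun P).continuous.aestronglyMeasurable
    (contDiff_polyFun R).continuous.aestronglyMeasurable (by exact_mod_cast hp)

theorem polyNorm_sub_le {N : ℕ} (Ω : Set (Fin N → ℝ)) {p : ℝ≥0} (hp : 1 ≤ p)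
    (P R : MvPolynomial (Fin N) ℝ) :
    polyNorm Ω p (P - R) ≤ polyNorm Ω p P + polyNorm Ω p R := by
  rw [sub_eq_add_neg, ← polyNorm_neg Ω p R]
  exact polyNorm_add_le Ω hp _ _

theorem eq_zero_of_polyNorm_eq_zero {N : ℕ} (a : Fin N → ℝ) {ℓ : ℝ} (hℓ : 0 < ℓ) {p : ℝ≥0}
    (hp : 1 ≤ p) {P : MvPolynomial (Fin N) ℝ} (h : polyNorm (cube a ℓ) p P = 0) : P = 0 := by
  have hc := (contDiff_polyFun P).continuous
  have hp0 : (p : ℝ≥0∞) ≠ 0 := by exact_mod_cast (zero_lt_one.trans_le hp).ne'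
  have h1 := (eLpNorm_eq_zero_iff hc.aestronglyMeasurable hp0).1 h
  have h2 : Set.EqOn (polyFun P) 0 (cube a ℓ) :=
    Measure.eqOn_open_of_ae_eq h1 (isOpen_cube a ℓ) hc.continuousOn continuousOn_const
  refine MvPolynomial.funext_set (fun i => Set.Ioo (a i - ℓ / 2) (a i + ℓ / 2))
    (fun i => Set.Ioo_infinite (by linarith)) fun x hx => ?_
  rw [map_zero]
  refine h2 fun i => ?_
  have := hx i (Set.mem_univ i)
  rw [abs_lt]
  constructor <;> linarith [this.1, this.2]

theorem lowPart_add {N : ℕ} (k : ℕ) (P R : MvPolynomial (Fin N) ℝ) :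
    lowPart k (P + R) = lowPart k P + lowPart k R := by
  simp [lowPart, Finset.sum_add_distrib]

theorem lowPart_smul {N : ℕ} (k : ℕ) (c : ℝ) (P : MvPolynomial (Fin N) ℝ) :
    lowPart k (c • P) = c • lowPart k P := by
  simp [lowPart, Finset.smul_sum]

theorem lowPart_eq_self {N k : ℕ} {P : MvPolynomial (Fin N) ℝ} (hP : P ∈ polys N k) :
    lowPart k P = P := by
  rw [MvPolynomial.mem_restrictTotalDegree] at hP
  conv_rhs => rw [← MvPolynomial.sum_homogeneousComponent P]
  refine (Finset.sum_subset (Finset.range_mono (by omega)) fun j _ hj => ?_).symm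
  exact MvPolynomial.homogeneousComponent_eq_zero _ _ (by simpa using hj)

/-- S factors through the range of T, a finite-dimensional normed space, on which every linear map
is bounded. -/
theorem LinearMap.exists_norm_le_mul_norm_of_injective {V E F : Type*} [AddCommGroup V]
    [Module ℝ V] [Module.Finite ℝ V] [NormedAddCommGroup E] [NormedSpace ℝ E]
    [NormedAddCommGroup F] [NormedSpace ℝ F] (T : V →ₗ[ℝ] E) (hT : Function.Injective T)
    (S : V →ₗ[ℝ] F) : ∃ K : ℝ≥0, ∀ x, ‖S x‖ ≤ K * ‖T x‖ := by
  let e := LinearEquiv.ofInjective T hT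
  let f := LinearMap.toContinuousLinearMap (S ∘ₗ (e.symm : LinearMap.range T →ₗ[ℝ] V))
  refine ⟨‖f‖₊, fun x => ?_⟩
  have h := f.le_opNorm (e x)
  simpa [f, e] using h

/-- Truncation is linear on a finite-dimensional space where the L^p norm over the cube is a genuine
norm, since a polynomial vanishing almost everywhere on an open set is zero. -/
theorem exists_polyNorm_lowPart_le {N : ℕ} (a : Fin N → ℝ) {ℓ : ℝ} (hℓ : 0 < ℓ) {p : ℝ≥0}
    (hp : 1 ≤ p) (k r : ℕ) : ∃ K : ℝ≥0, ∀ P ∈ polys N r,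
      polyNorm (cube a ℓ) p (lowPart k P) ≤ K * polyNorm (cube a ℓ) p P := by
  have : Fact (1 ≤ (p : ℝ≥0∞)) := ⟨by exact_mod_cast hp⟩
  have hL : ∀ P : MvPolynomial (Fin N) ℝ, MemLp (polyFun P) p (volume.restrict (cube a ℓ)) :=
    fun P => (contDiff_polyFun P).continuous.memLp_restrict_of_isBounded (isBounded_cube a hℓ) p
  let T : polys N r →ₗ[ℝ] LpOn (cube a ℓ) p :=
    { toFun := fun P => (hL P).toLp
      map_add' := fun P R => by
        rw [← MemLp.toLp_add, MemLp.toLp_eq_toLp_iff]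
        exact .of_forall fun x => by simp [polyFun]
      map_smul' := fun c P => by
        rw [RingHom.id_apply, ← MemLp.toLp_const_smul, MemLp.toLp_eq_toLp_iff]
        exact .of_forall fun x => by simp [polyFun] }
  let S : polys N r →ₗ[ℝ] LpOn (cube a ℓ) p :=
    { toFun := fun P => (hL (lowPart k P)).toLp
      map_add' := fun P R => by
        rw [← MemLp.toLp_add, MemLp.toLp_eq_toLp_iff]
        exact .of_forall fun x => by simp [polyFun, lowPart_add]
      map_smul' := fun c P => by
        rw [RingHom.id_apply, ← MemLp.toLp_const_smul, MemLp.toLp_eq_toLp_iff]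
        exact .of_forall fun x => by simp [polyFun, lowPart_smul] }
  have hTn : ∀ P, ‖T P‖ = (polyNorm (cube a ℓ) p P.1).toReal := fun P => Lp.norm_toLp _ (hL _)
  have hSn : ∀ P, ‖S P‖ = (polyNorm (cube a ℓ) p (lowPart k P.1)).toReal :=
    fun P => Lp.norm_toLp _ (hL _)
  have hT : Function.Injective T := by
    rw [injective_iff_map_eq_zero]
    intro P hP
    rw [← norm_eq_zero, hTn, ENNReal.toReal_eq_zero_iff] at hP
    exact Subtype.ext (eq_zero_of_polyNorm_eq_zero a hℓ hp
      (hP.resolve_right (polyNorm_ne_top (isBounded_cube a hℓ) p _)))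
  obtain ⟨K, hK⟩ := T.exists_norm_le_mul_norm_of_injective hT S
  refine ⟨K, fun P hP => ?_⟩
  have h := hK ⟨P, hP⟩
  rw [hTn, hSn] at h
  have h1 := polyNorm_ne_top (isBounded_cube a hℓ) p P
  rw [← ENNReal.toReal_le_toReal (polyNorm_ne_top (isBounded_cube a hℓ) p _)
    (ENNReal.mul_ne_top ENNReal.coe_ne_top h1), ENNReal.toReal_mul, ENNReal.coe_toReal]
  exact h

theorem gradNorm_sub_polyFun {N m : ℕ} {Ω : Set (Fin N → ℝ)} (hΩ : IsOpen Ω) {p : ℝ≥0}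
    {u : (Fin N → ℝ) → ℝ} (hu : MemSobolev Ω m p u) {P : MvPolynomial (Fin N) ℝ}
    (hP : P.totalDegree < m) : gradNorm Ω m p (u - polyFun P) = gradNorm Ω m p u := by
  refine gradNorm_eq hΩ fun γ hγ => ?_
  have h := (hu.hasWeakDeriv hγ.le).sub hΩ (hasWeakDeriv_multiDeriv Ω γ (contDiff_polyFun P))
  rwa [multiDeriv_polyFun_eq_zero γ (hγ ▸ hP), sub_zero] at h

/-! ### Comparison of the capacities -/

theorem cube_subset_cube {N : ℕ} (a : Fin N → ℝ) {ℓ L : ℝ} (h : ℓ ≤ L) : cube a ℓ ⊆ cube a L :=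
  fun _ hx i => (hx i).trans_le (by linarith)

/-- The elementary estimates by which a function close to a polynomial of degree at most `k`
lies in the test class. -/
theorem test_inequalities {C K α t n P R L H E D : ℝ≥0}
    (ht : t * (4 * (C + 1) * (K + 1) * (α + 1)) = 1)
    (hn : n ≤ t * P) (hE : E ≤ C * n) (hD : D ≤ 2 * C * n) (hL : P ≤ L + K * D)
    (hH : H ≤ D + K * D) (hR : P ≤ R + D) : α * H ≤ L ∧ 2 * E ≤ R ∧ P ≤ 2 * L := by
  -- All conclusions follow from this: by the choice of t, the error stays below P even when
  -- multiplied by each of the constants.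
  have key : 4 * (C * n) * ((K + 1) * (α + 1)) ≤ P := by
    calc 4 * (C * n) * ((K + 1) * (α + 1))
        ≤ 4 * ((C + 1) * (t * P)) * ((K + 1) * (α + 1)) := by gcongr; simp
      _ = t * (4 * (C + 1) * (K + 1) * (α + 1)) * P := by ring
      _ = P := by rw [ht, one_mul]
  have hD' : 2 * D * ((K + 1) * (α + 1)) ≤ P := by
    refine le_trans ?_ key
    calc 2 * D * ((K + 1) * (α + 1)) ≤ 2 * (2 * C * n) * ((K + 1) * (α + 1)) := by gcongr
      _ = 4 * (C * n) * ((K + 1) * (α + 1)) := by ring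
  have hE' : 4 * E ≤ P := by
    refine le_trans ?_ key
    calc 4 * E ≤ 4 * (C * n) * (1 * 1) := by simpa using hE
      _ ≤ 4 * (C * n) * ((K + 1) * (α + 1)) := by gcongr <;> simp
  have h1 : 2 * (K * D) ≤ P := by
    refine le_trans ?_ hD'
    calc 2 * (K * D) = 2 * D * (K * 1) := by ring
      _ ≤ _ := by gcongr <;> simp
  have h2 : 2 * D ≤ P := by
    refine le_trans ?_ hD'
    calc 2 * D = 2 * D * (1 * 1) := by ring
      _ ≤ _ := by gcongr <;> simp
  have h3 : 2 * (α * H) ≤ P := by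
    refine le_trans ?_ hD'
    calc 2 * (α * H) ≤ 2 * ((α + 1) * (D + K * D)) := by gcongr; simp
      _ = _ := by ring
  rw [← NNReal.coe_le_coe] at *
  push_cast at *
  refine ⟨?_, ?_, ?_⟩ <;> linarith

/-- The projection of a competitor in `Γ_{m,k,p}` differs from the competing polynomial by little,
in terms of the gradient of the competing function. -/
theorem exists_bestApprox_extension_const {N : ℕ} (hN : 0 < N) (a : Fin N → ℝ) {ℓ : ℝ}
    (hℓ : 0 < ℓ) {p : ℝ≥0} (hp : 1 ≤ p) (r : ℕ) : ∃ C : ℝ≥0,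
      ∀ (u : (Fin N → ℝ) → ℝ) (v : LpOn (cube a ℓ) p) (P R : MvPolynomial (Fin N) ℝ),
        MemSobolevZero (cube a (2 * ℓ)) (r + 1) p u → MemSobolev (cube a ℓ) (r + 1) p v →
        u - polyFun P =ᵐ[volume.restrict (cube a ℓ)] v → P ∈ polys N r →
        IsBestApprox (cube a ℓ) r p v R →
        eLpNorm (⇑v - polyFun R) p (volume.restrict (cube a ℓ))
            ≤ C * gradNorm (cube a (2 * ℓ)) (r + 1) p u ∧
          polyNorm (cube a ℓ) p (R + P) ≤ 2 * C * gradNorm (cube a (2 * ℓ)) (r + 1) p u ∧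
          gradNorm (cube a ℓ) (r + 1) p v ≤ gradNorm (cube a (2 * ℓ)) (r + 1) p u := by
  obtain ⟨C, hC⟩ := exists_friedrichs_const_sobolevZero hN a (L := 2 * ℓ) (by positivity) hp (r + 1)
  have hQ := isOpen_cube a ℓ
  have hQb := isBounded_cube a hℓ
  have hsub := cube_subset_cube a (show ℓ ≤ 2 * ℓ by linarith)
  have hp' : 1 ≤ (p : ℝ≥0∞) := by exact_mod_cast hp
  refine ⟨(r + 1) * C + C, fun u v P R hu hv huv hP hR => ?_⟩
  have huQ : MemSobolev (cube a ℓ) (r + 1) p u := hu.1.mono_set hsub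
  have hPS := memSobolev_of_contDiff hQb (r + 1) p (contDiff_polyFun P)
  have hRS := memSobolev_of_contDiff hQb (r + 1) p (contDiff_polyFun R)
  -- Since v = u - P on Q, the polynomial to compare with in the minimization is -P, with remainder
  -- u.
  have hvu : u =ᵐ[volume.restrict (cube a ℓ)] ⇑v - polyFun (-P) := by
    filter_upwards [huv] with x hx
    rw [polyFun_neg]
    simp only [Pi.sub_apply, Pi.neg_apply] at hx ⊢
    linarith
  have hu0 : eLpNorm u p (volume.restrict (cube a ℓ))
      ≤ C * gradNorm (cube a (2 * ℓ)) (r + 1) p u := by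
    rw [← gradNorm_zero hQ huQ]
    exact (gradNorm_mono_set hQ hsub (zero_le) hu.1).trans (hC u hu 0 (by omega))
  have hvR : eLpNorm (⇑v - polyFun R) p (volume.restrict (cube a ℓ))
      ≤ (r + 1) * C * gradNorm (cube a (2 * ℓ)) (r + 1) p u := by
    rw [← gradNorm_zero hQ (hv.sub hQ hRS)]
    calc gradNorm (cube a ℓ) 0 p (⇑v - polyFun R)
        ≤ ∑ i ∈ Finset.range (r + 1), gradNorm (cube a ℓ) i p (⇑v - polyFun R) :=
          Finset.single_le_sum (f := fun i => gradNorm (cube a ℓ) i p (⇑v - polyFun R))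
            (fun _ _ => zero_le) (Finset.mem_range.2 (by omega))
      _ ≤ ∑ i ∈ Finset.range (r + 1), gradNorm (cube a ℓ) i p (⇑v - polyFun (-P)) :=
          hR.2 (-P) (Submodule.neg_mem _ hP)
      _ ≤ ∑ i ∈ Finset.range (r + 1), C * gradNorm (cube a (2 * ℓ)) (r + 1) p u := by
          refine Finset.sum_le_sum fun i hi => ?_
          have hi' := Finset.mem_range.1 hi
          rw [gradNorm_congr hQ hi'.le huQ hvu]
          exact (gradNorm_mono_set hQ hsub hi'.le hu.1).trans (hC u hu i hi')
      _ = _ := by simp [mul_assoc]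
  have hRP : polyNorm (cube a ℓ) p (R + P)
      ≤ eLpNorm (⇑v - polyFun R) p (volume.restrict (cube a ℓ))
        + eLpNorm u p (volume.restrict (cube a ℓ)) := by
    have e : polyFun (R + P) =ᵐ[volume.restrict (cube a ℓ)] u - (⇑v - polyFun R) := by
      filter_upwards [huv] with x hx
      rw [polyFun_add]
      simp only [Pi.sub_apply, Pi.add_apply] at hx ⊢
      linarith
    rw [polyNorm, eLpNorm_congr_ae e, add_comm]
    exact eLpNorm_sub_le (huQ.memLp hQ).1 ((hv.sub hQ hRS).memLp hQ).1 hp'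
  push_cast
  refine ⟨hvR.trans (by gcongr; exact le_self_add), (hRP.trans (add_le_add hvR hu0)).trans ?_, ?_⟩
  · rw [← add_mul, two_mul ((r + 1 : ℝ≥0∞) * C + C)]
    gcongr
    · exact le_self_add
    · exact le_add_self
  -- The degree of P is at most r, so P does not contribute to derivatives of order r + 1.
  · rw [gradNorm_congr hQ le_rfl (huQ.sub hQ hPS) huv, gradNorm_sub_polyFun hQ huQ
      (Nat.lt_succ_of_le ((MvPolynomial.mem_restrictTotalDegree _ _ _).1 hP))]
    exact gradNorm_mono_set hQ hsub le_rfl hu.1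

theorem exists_capTheta_le_capGamma {N : ℕ} (hN : 0 < N) (a : Fin N → ℝ) {ℓ : ℝ} (hℓ : 0 < ℓ)
    {p : ℝ≥0} (hp : 1 ≤ p) (α : ℝ≥0) {k r : ℕ} (hk : k ≤ r) : ∃ δ : ℝ≥0, 0 < δ ∧
      ∀ Pr : LpOn (cube a ℓ) p → MvPolynomial (Fin N) ℝ, IsPolyProjection (cube a ℓ) r p Pr →
      ∀ A : Set (LpOn (cube a ℓ) p), A ⊆ sobolevSpace (cube a ℓ) (r + 1) p →
        capGamma a ℓ (r + 1) k p A ≤ δ →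
          capTheta (cube a ℓ) (r + 1) k p Pr α A
            ≤ ((2 : ℝ≥0) ^ (p : ℝ) : ℝ≥0) * capGamma a ℓ (r + 1) k p A := by
  obtain ⟨C, hC⟩ := exists_bestApprox_extension_const hN a hℓ hp r
  obtain ⟨K, hK⟩ := exists_polyNorm_lowPart_le a hℓ hp k r
  have hQb := isBounded_cube a hℓ
  have hp0 : (0 : ℝ) < p := by exact_mod_cast zero_lt_one.trans_le hp
  obtain ⟨t, ht⟩ : ∃ t : ℝ≥0, t * (4 * (C + 1) * (K + 1) * (α + 1)) = 1 :=
    ⟨_, inv_mul_cancel₀ (by positivity)⟩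
  have ht0 : 0 < t := pos_of_ne_zero (left_ne_zero_of_mul_eq_one ht)
  -- Half of t^p ensures Γ < t^p strictly, so that competitors close to the infimum also have
  -- quotients below t^p.
  refine ⟨t ^ (p : ℝ) / 2, by positivity, fun Pr hPr A hA hδ => ?_⟩
  have key : ∀ P ∈ {P | P ∈ polys N k ∧ P ≠ 0}, ∀ u ∈ extensions a ℓ (r + 1) p A P,
      gradNorm (cube a (2 * ℓ)) (r + 1) p u ^ (p : ℝ) / polyNorm (cube a ℓ) p P ^ (p : ℝ)
        < (t ^ (p : ℝ) : ℝ≥0) →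
      capTheta (cube a ℓ) (r + 1) k p Pr α A ≤ ((2 : ℝ≥0) ^ (p : ℝ) : ℝ≥0) *
        (gradNorm (cube a (2 * ℓ)) (r + 1) p u ^ (p : ℝ) / polyNorm (cube a ℓ) p P ^ (p : ℝ)) := by
    rintro P ⟨hPk, hP0⟩ u ⟨hu, v, hvA, huv⟩ hlt
    have hv := hA hvA
    have hR := hPr v hv
    have hPr' : P ∈ polys N r := by
      rw [MvPolynomial.mem_restrictTotalDegree] at hPk ⊢
      exact hPk.trans hk
    obtain ⟨hE, hD, hg⟩ := hC u v P (Pr v) hu hv huv hPr' hR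
    have hDmem : Pr v + P ∈ polys N r := Submodule.add_mem _ hR.1 hPr'
    have hlowD := hK _ hDmem
    have hlow : lowPart k (Pr v + P) = lowPart k (Pr v) + P := by
      rw [lowPart_add, lowPart_eq_self hPk]
    have hL : polyNorm (cube a ℓ) p P ≤ polyNorm (cube a ℓ) p (lowPart k (Pr v))
        + K * polyNorm (cube a ℓ) p (Pr v + P) := by
      have e : P = lowPart k (Pr v + P) - lowPart k (Pr v) := by rw [hlow]; ring
      calc polyNorm (cube a ℓ) p P
          = polyNorm (cube a ℓ) p (lowPart k (Pr v + P) - lowPart k (Pr v)) := by rw [← e]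
        _ ≤ _ := polyNorm_sub_le _ hp _ _
        _ ≤ _ := by rw [add_comm]; gcongr
    have hH : polyNorm (cube a ℓ) p (Pr v - lowPart k (Pr v))
        ≤ polyNorm (cube a ℓ) p (Pr v + P) + K * polyNorm (cube a ℓ) p (Pr v + P) := by
      have e : Pr v - lowPart k (Pr v) = (Pr v + P) - lowPart k (Pr v + P) := by rw [hlow]; ring
      rw [e]
      exact (polyNorm_sub_le _ hp _ _).trans (by gcongr)
    have hRn : polyNorm (cube a ℓ) p P
        ≤ polyNorm (cube a ℓ) p (Pr v) + polyNorm (cube a ℓ) p (Pr v + P) := by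
      have e : P = (Pr v + P) - Pr v := by ring
      calc polyNorm (cube a ℓ) p P = polyNorm (cube a ℓ) p ((Pr v + P) - Pr v) := by rw [← e]
        _ ≤ _ := polyNorm_sub_le _ hp _ _
        _ = _ := add_comm _ _
    have hPn : polyNorm (cube a ℓ) p P ≠ 0 := fun h => hP0 (eq_zero_of_polyNorm_eq_zero a hℓ hp h)
    have hn : gradNorm (cube a (2 * ℓ)) (r + 1) p u ≤ t * polyNorm (cube a ℓ) p P := by
      rw [← ENNReal.rpow_le_rpow_iff hp0, ENNReal.mul_rpow_of_nonneg _ _ hp0.le,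
        ← ENNReal.coe_rpow_of_nonneg _ hp0.le]
      refine (ENNReal.div_le_iff (by simp [hPn, hp0]) ?_).1 hlt.le
      exact ENNReal.rpow_ne_top_of_nonneg hp0.le (polyNorm_ne_top hQb p P)
    have tests : α * polyNorm (cube a ℓ) p (Pr v - lowPart k (Pr v))
          ≤ polyNorm (cube a ℓ) p (lowPart k (Pr v)) ∧
        2 * eLpNorm (⇑v - polyFun (Pr v)) p (volume.restrict (cube a ℓ))
          ≤ polyNorm (cube a ℓ) p (Pr v) ∧
        polyNorm (cube a ℓ) p P ≤ 2 * polyNorm (cube a ℓ) p (lowPart k (Pr v)) := by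
      -- All quantities are finite, so the linear estimates are transferred to `ℝ≥0`.
      have f1 := gradNorm_ne_top (isOpen_cube a (2 * ℓ)) le_rfl hu.1
      have f2 := polyNorm_ne_top hQb p P
      have f3 := polyNorm_ne_top hQb p (Pr v)
      have f4 := polyNorm_ne_top hQb p (lowPart k (Pr v))
      have f5 := polyNorm_ne_top hQb p (Pr v - lowPart k (Pr v))
      have f6 := polyNorm_ne_top hQb p (Pr v + P)
      have f7 : eLpNorm (⇑v - polyFun (Pr v)) p (volume.restrict (cube a ℓ)) ≠ ⊤ :=
        ne_top_of_le_ne_top (ENNReal.mul_ne_top ENNReal.coe_ne_top f1) hE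
      clear hlt hPn hlowD
      generalize gradNorm (cube a (2 * ℓ)) (r + 1) p u = n at *
      generalize polyNorm (cube a ℓ) p P = x at *
      generalize polyNorm (cube a ℓ) p (Pr v) = y at *
      generalize polyNorm (cube a ℓ) p (lowPart k (Pr v)) = z at *
      generalize polyNorm (cube a ℓ) p (Pr v - lowPart k (Pr v)) = w at *
      generalize polyNorm (cube a ℓ) p (Pr v + P) = d at *
      generalize eLpNorm (⇑v - polyFun (Pr v)) p (volume.restrict (cube a ℓ)) = e at *
      lift n to ℝ≥0 using f1
      lift x to ℝ≥0 using f2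
      lift y to ℝ≥0 using f3
      lift z to ℝ≥0 using f4
      lift w to ℝ≥0 using f5
      lift d to ℝ≥0 using f6
      lift e to ℝ≥0 using f7
      norm_cast at *
      exact test_inequalities ht hn hE hD hL hH hRn
    obtain ⟨t1, t2, t3⟩ := tests
    have hlow0 : lowPart k (Pr v) ≠ 0 := by
      intro h
      have h0 : polyNorm (cube a ℓ) p 0 = 0 := by rw [polyNorm, polyFun_zero, eLpNorm_zero]
      rw [h, h0, mul_zero] at t3
      exact hPn (le_antisymm t3 zero_le)
    have hvT : v ∈ testClass (cube a ℓ) k p Pr α A := by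
      refine ⟨hvA, t1, ?_⟩
      rw [one_div, mul_comm, ← div_eq_mul_inv]
      rwa [ENNReal.le_div_iff_mul_le (by simp) (by simp), mul_comm]
    have hLp0 : polyNorm (cube a ℓ) p (lowPart k (Pr v)) ≠ 0 :=
      fun h => hlow0 (eq_zero_of_polyNorm_eq_zero a hℓ hp h)
    refine (min_le_left _ _).trans ((iInf₂_le v ⟨hvT, hlow0⟩).trans ?_)
    rw [← mul_div_assoc, ENNReal.div_le_iff (by simp [hLp0, hp0])
      (ENNReal.rpow_ne_top_of_nonneg hp0.le (polyNorm_ne_top hQb p _)), ← ENNReal.mul_div_right_comm,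
      ENNReal.le_div_iff_mul_le (.inl (by simp [hPn, hp0]))
      (.inl (ENNReal.rpow_ne_top_of_nonneg hp0.le (polyNorm_ne_top hQb p _))),
      ENNReal.coe_rpow_of_nonneg _ hp0.le, ENNReal.coe_ofNat,
      ← ENNReal.mul_rpow_of_nonneg _ _ hp0.le, ← ENNReal.mul_rpow_of_nonneg _ _ hp0.le,
      ← ENNReal.mul_rpow_of_nonneg _ _ hp0.le]
    refine ENNReal.rpow_le_rpow ?_ hp0.le
    calc _ ≤ gradNorm (cube a (2 * ℓ)) (r + 1) p u
          * (2 * polyNorm (cube a ℓ) p (lowPart k (Pr v))) := mul_le_mul' hg t3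
      _ = _ := by ring
  have h2 : ((2 : ℝ≥0) ^ (p : ℝ) : ℝ≥0) ≠ 0 := by positivity
  -- The infimum in Γ need not be attained. If the claim failed, some competitor would have a
  -- quotient below both Θ/2^p and t^p, contradicting `key`.
  by_contra! hcon
  rw [mul_comm, ← ENNReal.lt_div_iff_mul_lt (by simp [h2]) (by simp)] at hcon
  have hlt : capGamma a ℓ (r + 1) k p A < (t ^ (p : ℝ) : ℝ≥0) :=
    hδ.trans_lt (ENNReal.coe_lt_coe.2 (NNReal.half_lt_self (by positivity)))
  have hmin := lt_min hcon hlt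
  rw [capGamma] at hmin
  simp only [iInf_lt_iff] at hmin
  obtain ⟨P, hP, u, hu, hq⟩ := hmin
  have h := key P hP u hu (hq.trans_le (min_le_right _ _))
  have h' := hq.trans_le (min_le_left _ _)
  rw [ENNReal.lt_div_iff_mul_lt (by simp [h2]) (by simp), mul_comm] at h'
  exact absurd h (not_le.2 h')

/-- The function u - R extends to 2Q with norm bounded by its Sobolev norm on Q. Poincaré's
inequality for best approximations bounds the orders up to r by the order r + 1, which R does not
affect. On Q the extension minus -R is u, so the pair competes in Γ. -/
theorem exists_capGamma_le {N : ℕ} (a : Fin N → ℝ) {ℓ : ℝ} (hℓ : 0 < ℓ) {p : ℝ≥0} (hp : 1 ≤ p)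
    (r : ℕ) : ∃ C : ℝ≥0, ∀ A : Set (LpOn (cube a ℓ) p), ∀ u ∈ A,
      MemSobolev (cube a ℓ) (r + 1) p u → ∀ R, IsBestApprox (cube a ℓ) r p u R → R ≠ 0 →
        capGamma a ℓ (r + 1) r p A ≤ C *
          (gradNorm (cube a ℓ) (r + 1) p u ^ (p : ℝ) / polyNorm (cube a ℓ) p R ^ (p : ℝ)) := by
  have hQ := isOpen_cube a ℓ
  have hQb := isBounded_cube a hℓ
  have hp0 : (0 : ℝ) < p := by exact_mod_cast zero_lt_one.trans_le hp
  have hQn : (cube a ℓ).Nonempty := ⟨a, fun i => by simpa using hℓ⟩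
  have hQc : Convex ℝ (cube a ℓ) := by rw [cube_eq_openBox]; exact convex_openBox _ _
  obtain ⟨C₁, hC₁⟩ := exists_bestApprox_const hQ hQc hQb hQn hp r
  obtain ⟨C₂, hC₂⟩ := exists_extension_sobolevZero a hℓ hp (r + 1)
  refine ⟨(C₂ * (C₁ + 1)) ^ (p : ℝ), fun A u huA hu R hR hR0 => ?_⟩
  obtain ⟨w, hw, hwu, hwn⟩ := hC₂ (⇑u - polyFun R)
    (hu.sub hQ (memSobolev_of_contDiff hQb (r + 1) p (contDiff_polyFun R)))
  have hbound : gradNorm (cube a (2 * ℓ)) (r + 1) p w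
      ≤ (C₂ * (C₁ + 1) : ℝ≥0) * gradNorm (cube a ℓ) (r + 1) p u := by
    refine (gradNorm_le_sobolevNorm _ le_rfl p w).trans (hwn.trans ?_)
    rw [sobolevNorm, Finset.sum_range_succ, gradNorm_sub_polyFun hQ hu
      (Nat.lt_succ_of_le ((MvPolynomial.mem_restrictTotalDegree _ _ _).1 hR.1))]
    push_cast
    rw [mul_assoc, add_mul, one_mul]
    gcongr
    exact hC₁ u R hu hR
  have hmem : w ∈ extensions a ℓ (r + 1) p A (-R) := by
    refine ⟨hw, u, huA, ?_⟩
    filter_upwards [hwu] with x hx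
    rw [polyFun_neg]
    simp only [Pi.sub_apply, Pi.neg_apply] at hx ⊢
    linarith
  refine (iInf₂_le (-R) ⟨Submodule.neg_mem _ hR.1, neg_ne_zero.2 hR0⟩).trans
    ((iInf₂_le w hmem).trans ?_)
  rw [polyNorm_neg, ← mul_div_assoc, ENNReal.coe_rpow_of_nonneg _ hp0.le,
    ← ENNReal.mul_rpow_of_nonneg _ _ hp0.le]
  gcongr

theorem corollary2p12 (N m k : ℕ) (hN : 0 < N) (hk : k < m) (p : ℝ≥0) (hp : 1 ≤ p)
    (α : ℝ≥0) (hα : 0 < α) (a : Fin N → ℝ) (ℓ : ℝ) (hℓ : 0 < ℓ) :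
    (∃ δ C : ℝ≥0, 0 < δ ∧ 0 < C ∧
      ∀ Pr : LpOn (cube a ℓ) p → MvPolynomial (Fin N) ℝ,
        IsPolyProjection (cube a ℓ) (m - 1) p Pr →
      ∀ A : Set (LpOn (cube a ℓ) p), A ⊆ sobolevSpace (cube a ℓ) m p →
        capGamma a ℓ m k p A ≤ δ →
          capTheta (cube a ℓ) m k p Pr α A ≤ C * capGamma a ℓ m k p A) ∧
    (∃ δ C : ℝ≥0, 0 < δ ∧ 0 < C ∧
      ∀ Pr : LpOn (cube a ℓ) p → MvPolynomial (Fin N) ℝ,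
        IsPolyProjection (cube a ℓ) (m - 1) p Pr →
      ∀ A : Set (LpOn (cube a ℓ) p), A ⊆ sobolevSpace (cube a ℓ) m p →
        capGamma a ℓ m (m - 1) p A ≤ δ →
          capTheta (cube a ℓ) m (m - 1) p Pr α A ≤ C * capGamma a ℓ m (m - 1) p A ∧
          capGamma a ℓ m (m - 1) p A ≤ C * capTheta (cube a ℓ) m (m - 1) p Pr α A) := by
  obtain ⟨r, rfl⟩ : ∃ r, m = r + 1 := ⟨m - 1, by omega⟩
  simp only [Nat.add_sub_cancel]
  constructor
  · obtain ⟨δ, hδ, h⟩ := exists_capTheta_le_capGamma hN a hℓ hp α (Nat.lt_succ_iff.1 hk)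
    exact ⟨δ, _, hδ, by positivity, h⟩
  obtain ⟨δ, hδ, h⟩ := exists_capTheta_le_capGamma hN a hℓ hp α (le_refl r)
  obtain ⟨C, hC⟩ := exists_capGamma_le a hℓ hp r
  -- The summands serve, in turn, the first inequality, the infimum in Θ, and the value 1 in the
  -- minimum.
  refine ⟨δ, 2 ^ (p : ℝ) + C + δ, hδ, by positivity, fun Pr hPr A hA hΓ => ⟨?_, ?_⟩⟩
  · refine (h Pr hPr A hA hΓ).trans ?_
    gcongr
    rw [add_assoc]
    exact le_self_add
  · have hne : ((2 ^ (p : ℝ) + C + δ : ℝ≥0) : ℝ≥0∞) ≠ 0 :=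
      ENNReal.coe_ne_zero.2 (by positivity)
    rw [← ENNReal.div_le_iff' hne ENNReal.coe_ne_top, capTheta]
    refine le_min (le_iInf₂ fun u hu => ?_) ?_
    · obtain ⟨huT, hu0⟩ := hu
      have hR := hPr u (hA huT.1)
      -- For k = m - 1 the projection is its own truncation.
      rw [lowPart_eq_self hR.1] at hu0 ⊢
      rw [ENNReal.div_le_iff' hne ENNReal.coe_ne_top]
      refine (hC A u huT.1 (hA huT.1) _ hR hu0).trans ?_
      gcongr
      rw [add_assoc, add_left_comm]
      exact le_self_add
    -- Where the minimum is 1, the inequality is just Γ ≤ δ.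
    · rw [ENNReal.div_le_iff' hne ENNReal.coe_ne_top, mul_one]
      exact hΓ.trans (ENNReal.coe_le_coe.2 le_add_self)
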